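/- Let $N\ge 1$ and $\hbar>0$. For $n\ge 1$, $\boldsymbol y\in\mathbb C^{n}$ and $\boldsymbol x\in\mathbb R^n$ define the kernels $\varphi_{\boldsymbol y}(\boldsymbol x)$ inductively by $\varphi_{y}(x)=e^{\frac{i}{\hbar}xy}$ for $n=1$ and $$\varphi_{\boldsymbol y}(\boldsymbol x)=\int_{(\mathbb R-i\beta)^{n}} e^{\frac{i}{\hbar}\left(\sum_{b=1}^{n+1} y_b-\sum_{a=1}^{n} w_a\right)x_{n+1}}\,\varphi_{\boldsymbol w}(x_1,\dots,x_n)\,\varpi(\boldsymbol w\mid\boldsymbol y)\,\frac{d^{n}w}{n!\,(2\pi\hbar)^{n}}$$ for $\boldsymbol y\in\mathbb C^{n+1}$, $\boldsymbol x\in\mathbb R^{n+1}$, the contour lying below all the points $y_b$ (that is, $-\beta<\operatorname{Im} y_b$), where $$\varpi(\boldsymbol w\mid\boldsymbol y)=\prod_{a=1}^{n}\prod_{b=1}^{n+1}\Big\{\hbar^{\frac{i}{\hbar}(w_a-y_b)}\,\Gamma\Big(\frac{y_b-w_a}{i\hbar}\Big)\Big\}\cdot\prod_{\substack{a,b=1\\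 a\neq b}}^{n}\Gamma^{-1}\Big(\frac{w_b-w_a}{i\hbar}\Big).$$ To evaluate $\varphi_{\boldsymbol y}$ at $\boldsymbol y\in\mathbb R^N$, the successive contours, from the outermost ($N-1$ variables) to the innermost (one variable), are $(\mathbb R-i\alpha_1)^{N-1},(\mathbb R-i\alpha_2)^{N-2},\dots,\mathbb R-i\alpha_{N-1}$, where $0<\alpha_1<\dots<\alpha_{N-1}$ are free parameters. Let $$\mu(\boldsymbol y)=\frac{1}{(2\pi\hbar)^N}\prod_{\substack{k,p=1\\ k\neq p}}^{N}\Gamma^{-1}\Big(\frac{y_k-y_p}{i\hbar}\Big),\qquad \mathcal U_N[F](\boldsymbol x)=\frac{1}{\sqrt{N!}}\int_{\mathbb R^N}\varphi_{\boldsymbol y}(\boldsymbol x)\,F(\boldsymbol y)\,\mu(\boldsymbol y)\,d^Ny .$$ Then for every $F\in C_c^\infty(\mathbb R^N)$ (complex-valued, not necessarily symmetric) the transform $\mathcal U_N[F]$ is well defined: for all $\boldsymbol x,\boldsymbol y\in\mathbb R^N$ all the iterated integrals that define $\varphi_{\boldsymbol y}(\boldsymbol x)$ converge absolutely, for every $\boldsymbol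 x\in\mathbb R^N$ the integral over $\boldsymbol y$ that defines $\mathcal U_N[F](\boldsymbol x)$ converges absolutely, and its value does not depend on the choice of $0<\alpha_1<\dots<\alpha_{N-1}$. Moreover $\mathcal U_N[F]$ belongs to the Schwartz class $\mathcal S(\mathbb R^N)$; in particular $\mathcal U_N[F]\in L^2(\mathbb R^N,d^Nx)$. -/

import Mathlib

/-- The point `w = u - i β` (every coordinate shifted by `-i β`) of the contour `(ℝ - i β)^n`,
parametrised by `u ∈ ℝ^n`. -/
noncomputable def contourPoint {n : ℕ} (β : ℝ) (u : Fin n → ℝ) : Fin n → ℂ :=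
  fun a => (u a : ℂ) - Complex.I * (β : ℂ)

/-- The weight `ϖ(w | y)`, for `w ∈ ℂ^n` and `y ∈ ℂ^(n+1)`:
`∏_{a, b} ħ^{(i/ħ)(w_a - y_b)} Γ((y_b - w_a)/(iħ)) · ∏_{a ≠ b} 1/Γ((w_b - w_a)/(iħ))`,
the last product being over ordered pairs. (Mathlib's `Γ` takes the value `0` at its poles, so that
`(Γ z)⁻¹` is the entire function `1/Γ` everywhere.) -/
noncomputable def mbWeight (hbar : ℝ) {n : ℕ} (w : Fin n → ℂ) (y : Fin (n + 1) → ℂ) : ℂ :=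
  (∏ a : Fin n, ∏ b : Fin (n + 1),
      ((hbar : ℂ) ^ (Complex.I / (hbar : ℂ) * (w a - y b)) *
        Complex.Gamma ((y b - w a) / (Complex.I * (hbar : ℂ))))) *
    ∏ a : Fin n, ∏ b ∈ Finset.univ.erase a,
      (Complex.Gamma ((w b - w a) / (Complex.I * (hbar : ℂ))))⁻¹

/-- The integrand of the Mellin-Barnes induction, at the point `w = u - i β` of the contour, where
`φ` is the kernel in `n` variables. -/
noncomputable def mbIntegrand (hbar : ℝ) {n : ℕ} (φ : (Fin n → ℂ) → (Fin n → ℝ) → ℂ) (β : ℝ)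
    (y : Fin (n + 1) → ℂ) (x : Fin (n + 1) → ℝ) (u : Fin n → ℝ) : ℂ :=
  Complex.exp (Complex.I / (hbar : ℂ) * (∑ b, y b - ∑ a, contourPoint β u a) *
      ((x (Fin.last n) : ℝ) : ℂ)) *
    φ (contourPoint β u) (fun a => x a.castSucc) *
    mbWeight hbar (contourPoint β u) y /
    ((n.factorial : ℂ) * (2 * (Real.pi : ℂ) * (hbar : ℂ)) ^ n)

/-- The kernel `φ_y(x)` in `n` variables, by the Mellin-Barnes induction. The outermost contour is
`(ℝ - i α 0)^(n-1)`, the next one `(ℝ - i α 1)^(n-2)`, and so on. The induction is started from the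
empty kernel `1`, which gives `φ_y(x) = exp (i x y / ħ)` in one variable
(see `whittakerKernel_one`). -/
noncomputable def whittakerKernel (hbar : ℝ) :
    (n : ℕ) → (α : ℕ → ℝ) → (Fin n → ℂ) → (Fin n → ℝ) → ℂ
  | 0, _, _, _ => 1
  | n + 1, α, y, x =>
      ∫ u : Fin n → ℝ,
        mbIntegrand hbar (whittakerKernel hbar n (fun s => α (s + 1))) (α 0) y x u

/-- All the integrals met in the induction that defines `φ_y(x)` converge absolutely. -/
def KernelConverges (hbar : ℝ) :
    (n : ℕ) → (α : ℕ → ℝ) → (Fin n → ℂ) → (Fin n → ℝ) → Prop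
  | 0, _, _, _ => True
  | n + 1, α, y, x =>
      (∀ u : Fin n → ℝ, KernelConverges hbar n (fun s => α (s + 1)) (contourPoint (α 0) u)
        (fun a => x a.castSucc)) ∧
      MeasureTheory.Integrable
        (mbIntegrand hbar (whittakerKernel hbar n (fun s => α (s + 1))) (α 0) y x)

/-- In one variable the kernel is the plane wave. -/
theorem whittakerKernel_one (hbar : ℝ) (α : ℕ → ℝ) (y : Fin 1 → ℂ) (x : Fin 1 → ℝ) :
    whittakerKernel hbar 1 α y x =
      Complex.exp (Complex.I / (hbar : ℂ) * ((x 0 : ℝ) : ℂ) * y 0) := by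
  simp only [whittakerKernel]
  rw [MeasureTheory.Measure.volume_pi_eq_dirac, MeasureTheory.integral_dirac]
  simp [mbIntegrand, mbWeight]
  ring_nf

/-- The density `μ(y) = (2πħ)^(-N) ∏_{k ≠ p} 1/Γ((y_k - y_p)/(iħ))` with respect to the Lebesgue
measure on `ℝ^N`; the product is over ordered pairs. -/
noncomputable def sklyaninDensity (hbar : ℝ) {N : ℕ} (y : Fin N → ℝ) : ℂ :=
  1 / (2 * (Real.pi : ℂ) * (hbar : ℂ)) ^ N *
    ∏ k : Fin N, ∏ p ∈ Finset.univ.erase k,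
      (Complex.Gamma (((y k : ℂ) - (y p : ℂ)) / (Complex.I * (hbar : ℂ))))⁻¹

/-- The integrand `φ_y(x) F(y) μ(y)` of the separation of variables transform. -/
noncomputable def sovIntegrand (hbar : ℝ) (α : ℕ → ℝ) {N : ℕ} (F : (Fin N → ℝ) → ℂ)
    (x y : Fin N → ℝ) : ℂ :=
  whittakerKernel hbar N α (fun a => (y a : ℂ)) x * F y * sklyaninDensity hbar y

/-- The separation of variables transform
`𝒰_N[F](x) = (1 / √(N!)) ∫_{ℝ^N} φ_y(x) F(y) μ(y) d^N y`. -/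
noncomputable def sovTransform (hbar : ℝ) (α : ℕ → ℝ) {N : ℕ} (F : (Fin N → ℝ) → ℂ)
    (x : Fin N → ℝ) : ℂ :=
  1 / ((Real.sqrt (N.factorial : ℝ) : ℝ) : ℂ) * ∫ y : Fin N → ℝ, sovIntegrand hbar α F x y

/-! Two mechanisms carry the proof. The first is a balance of exponentials. With `κ = π/(2ħ)`, the
factors `Γ` of the weight decay like `exp(-κ|v_b - u_a|)`, and each `1/Γ` grows like `exp(κ|u_a -
u_b|)`. The interlacing inequality `spread u + spread v ≤ 2 crossDist u v` (`spread_add_spread_le`),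
with its gain when `u` leaves the box of `v` (`spread_add_spread_add_le`), shows that one step of
the induction preserves the class `IsWhittakerBounded`: polynomial growth times `exp(-κ spread/2)`.
This gives absolute convergence (`kernelConverges_contourPoint`). It does not give decay in `x`,
because a contour at positive depth leaves a factor exponential in `x`.

The second is a Fourier representation, `exists_fourier_representation`. The density `μ` splits into
two halves. One is smooth and is absorbed in `F`; the other, `halfDensity`, stays with the kernel.
For Schwartz `f(v, p)`, with parameters `p`, the integral of `φ_v(x) halfDensity(v) f(v, p)` over
`v` equals `∫ exp(i x·ξ/ħ) ρ(ξ, p) dξ`, where `ρ` is Schwartz and depends neither on `x` nor on the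
contours. The theorem follows because the Fourier transform preserves the Schwartz class.

The representation is proved by induction on the number of variables. After integration against the
test function the relative depth `δ` of the contour may be changed: the double integral is
holomorphic in a complex depth `z` with `Re z > 0`, and replacing `z` by `z + iθ` amounts to
translating `u`, so it is constant (`integral_stepIntegrand_eq`). Hence `δ` may tend to `0+`.

For small `δ` the singular part of the kernel is `vdm u · vdm v / ∏ (v_b - u_a + iδ)`. The bordered
Cauchy determinant `vdm_mul_vdm` writes it as a signed sum over permutations `σ` of products of `n`
simple poles `1/(v_{σ(a+1)} - u_a + iδ)`, one for each `a`. With the coordinates `r_a = v_{σ(a+1)} -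
u_a` and `τ = ∑ v - ∑ u`, the poles involve separate variables and the plane wave depends on `τ`
alone. The regular part is analytic near the real points, so the interlacing bound and Cauchy's
estimates make its product with `f` a Schwartz function. Two integrations by parts per variable,
with the second primitive `s log s - s` of `1/s`, show that the `r`-integral tends to a Schwartz
function of `(u, τ, p)` (`SchwartzMap.exists_singular_limit`). What remains is a Fourier integral in
`τ`, dual to the last coordinate of `x`, of the same problem in `n` variables with `τ` as a new
parameter. -/

open MeasureTheory

open scoped SchwartzMap LineDeriv FourierTransform Topology

/-! ### Bounds for `Γ` and `1/Γ` in vertical strips. -/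

open Real Complex in
/-- On a vertical line, `‖Γ‖ / Γ(Re)` increases with the real part. -/
theorem norm_Gamma_div_le {z : ℂ} {c : ℝ} (hz : 0 < z.re) (hc : 0 < c) :
    ‖Complex.Gamma z‖ ≤ Real.Gamma z.re / Real.Gamma (z.re + c) * ‖Complex.Gamma (z + c)‖ := by
  have hc' : 0 < (c : ℂ).re := by simpa using hc
  have hx' : 0 < (z.re : ℂ).re := by simpa using hz
  have h1 := Complex.Gamma_mul_Gamma_eq_betaIntegral hz hc'
  have h2 := Complex.Gamma_mul_Gamma_eq_betaIntegral hx' hc'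
  have h3 : ‖Complex.betaIntegral z c‖ ≤ ‖Complex.betaIntegral (z.re : ℂ) c‖ := by
    have e : Complex.betaIntegral (z.re : ℂ) c =
        ((∫ x in (0:ℝ)..1, x ^ (z.re - 1) * (1 - x) ^ (c - 1) : ℝ) : ℂ) := by
      rw [Complex.betaIntegral, ← intervalIntegral.integral_ofReal]
      refine intervalIntegral.integral_congr fun x hx => ?_
      rw [Set.uIcc_of_le zero_le_one] at hx
      push_cast
      rw [Complex.ofReal_cpow hx.1, Complex.ofReal_cpow (by linarith [hx.2])]
      push_cast
      ring
    have h4 : ‖Complex.betaIntegral z c‖ ≤ ∫ x in (0:ℝ)..1, x ^ (z.re - 1) * (1 - x) ^ (c - 1) := by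
      rw [Complex.betaIntegral]
      refine (intervalIntegral.norm_integral_le_integral_norm zero_le_one).trans (le_of_eq ?_)
      rw [intervalIntegral.integral_of_le zero_le_one, intervalIntegral.integral_of_le zero_le_one,
        MeasureTheory.integral_Ioc_eq_integral_Ioo, MeasureTheory.integral_Ioc_eq_integral_Ioo]
      refine MeasureTheory.setIntegral_congr_fun measurableSet_Ioo fun x hx => ?_
      rw [norm_mul, Complex.norm_cpow_eq_rpow_re_of_pos hx.1]
      have : (1 - (x : ℂ)) = ((1 - x : ℝ) : ℂ) := by push_cast; ring
      rw [this, Complex.norm_cpow_eq_rpow_re_of_pos (by linarith [hx.2])]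
      simp
    refine h4.trans ?_
    rw [e, Complex.norm_real]
    exact le_abs_self _
  have g1 : 0 < Real.Gamma c := Real.Gamma_pos_of_pos hc
  have g2 : 0 < Real.Gamma z.re := Real.Gamma_pos_of_pos hz
  have g3 : 0 < Real.Gamma (z.re + c) := Real.Gamma_pos_of_pos (by linarith)
  have n1 := congrArg norm h1
  have n2 := congrArg norm h2
  rw [norm_mul, norm_mul] at n1 n2
  rw [← Complex.ofReal_add, Complex.Gamma_ofReal, Complex.Gamma_ofReal, Complex.Gamma_ofReal,
    Complex.norm_real, Complex.norm_real, Complex.norm_real, Real.norm_of_nonneg g1.le,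
    Real.norm_of_nonneg g2.le, Real.norm_of_nonneg g3.le] at n2
  rw [Complex.Gamma_ofReal, Complex.norm_real, Real.norm_of_nonneg g1.le] at n1
  have n3 : ‖Complex.betaIntegral (z.re : ℂ) c‖ = Real.Gamma z.re * Real.Gamma c /
      Real.Gamma (z.re + c) := by field_simp; linarith
  rw [n3] at h3
  refine le_of_mul_le_mul_right ?_ g1
  rw [n1]
  calc _ ≤ ‖Complex.Gamma (z + c)‖ * (Real.Gamma z.re * Real.Gamma c / Real.Gamma (z.re + c)) := by
        gcongr
    _ = _ := by ring

/-- On the critical line `1 - z` is the conjugate of `z`, so the reflection formula gives `|Γ|² = π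
/ cosh(πt)` exactly. -/
theorem norm_Gamma_half_add_mul_I_le (t : ℝ) :
    ‖Complex.Gamma (1 / 2 + t * Complex.I)‖ ≤ √(2 * Real.pi) * Real.exp (-(Real.pi / 2 * |t|)) := by
  have h := Complex.Gamma_mul_Gamma_one_sub (1 / 2 + t * Complex.I)
  have hc : (1 : ℂ) - (1 / 2 + t * Complex.I) = (starRingEnd ℂ) (1 / 2 + t * Complex.I) := by
    simp [Complex.ext_iff]; norm_num
  have hs : Complex.sin (Real.pi * (1 / 2 + t * Complex.I)) = (Real.cosh (Real.pi * t) : ℂ) := by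
    rw [show (Real.pi : ℂ) * (1 / 2 + t * Complex.I) = (Real.pi * t : ℂ) * Complex.I + Real.pi / 2 by
      ring, Complex.sin_add_pi_div_two, Complex.cos_mul_I]
    push_cast; rfl
  rw [hc, hs, Complex.Gamma_conj] at h
  have hn := congrArg norm h
  rw [norm_mul, RCLike.norm_conj, ← Complex.ofReal_div, Complex.norm_real,
    Real.norm_of_nonneg (by positivity)] at hn
  refine Real.le_sqrt_of_sq_le (x := ‖_‖) (y := 2 * Real.pi * Real.exp (-(Real.pi * |t|))) ?_ |>.trans
    (le_of_eq ?_)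
  · rw [sq, hn, div_le_iff₀ (Real.cosh_pos _), ← Real.cosh_abs, abs_mul, abs_of_pos Real.pi_pos,
      Real.cosh_eq]
    have e1 : Real.exp (-(Real.pi * |t|)) * Real.exp (Real.pi * |t|) = 1 := by
      rw [← Real.exp_add]; simp
    have e2 := congrArg (Real.pi * ·) e1
    simp only [mul_one] at e2
    linarith [mul_nonneg Real.pi_pos.le (sq_nonneg (Real.exp (-(Real.pi * |t|))))]
  · rw [Real.sqrt_mul (by positivity)]
    congr 1
    rw [show -(Real.pi * |t|) = -(Real.pi / 2 * |t|) + -(Real.pi / 2 * |t|) by ring, Real.exp_add,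
      Real.sqrt_mul_self (Real.exp_pos _).le]

/-- The recurrence `Γ(z + 1) = zΓ(z)` moves the bound from the line `Re = 1/2`; each unit step costs
one factor `1 + |t|`. -/
theorem exists_norm_Gamma_nat_add_half_le (k : ℕ) : ∃ C : ℝ, 0 < C ∧ ∀ t : ℝ,
    ‖Complex.Gamma (k + 1 / 2 + t * Complex.I)‖ ≤
      C * (1 + |t|) ^ k * Real.exp (-(Real.pi / 2 * |t|)) := by
  induction k with
  | zero => exact ⟨√(2 * Real.pi), by positivity, fun t => by
      simpa using norm_Gamma_half_add_mul_I_le t⟩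
  | succ k ih =>
    obtain ⟨C, hC, h⟩ := ih
    refine ⟨(k + 1) * C, by positivity, fun t => ?_⟩
    have hne : (k + 1 / 2 + t * Complex.I : ℂ) ≠ 0 := by
      intro h0
      have := congrArg Complex.re h0
      simp at this
      have hk : (0 : ℝ) ≤ k := k.cast_nonneg
      linarith
    have e : ((k + 1 : ℕ) + 1 / 2 + t * Complex.I : ℂ) = (k + 1 / 2 + t * Complex.I) + 1 := by
      push_cast; ring
    rw [e, Complex.Gamma_add_one _ hne, norm_mul]
    have h2 : ‖(k + 1 / 2 + t * Complex.I : ℂ)‖ ≤ (k + 1) * (1 + |t|) := by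
      refine (norm_add_le _ _).trans ?_
      have h3 : ‖(k + 1 / 2 : ℂ)‖ = k + 1 / 2 := by
        rw [show (k + 1 / 2 : ℂ) = ((k + 1 / 2 : ℝ) : ℂ) by push_cast; rfl, Complex.norm_real,
          Real.norm_of_nonneg (by positivity)]
      rw [h3, norm_mul, Complex.norm_I, Complex.norm_real, Real.norm_eq_abs]
      nlinarith [abs_nonneg t, (k.cast_nonneg : (0 : ℝ) ≤ k)]
    calc _ ≤ ((k + 1) * (1 + |t|)) * (C * (1 + |t|) ^ k * Real.exp (-(Real.pi / 2 * |t|))) := by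
          gcongr; exact h t
      _ = _ := by ring

/-- Exponential decay of `Γ` in vertical strips of the right half-plane. -/
theorem exists_norm_Gamma_le {a : ℝ} (ha : 0 < a) (b : ℝ) : ∃ C : ℝ, 0 < C ∧ ∃ M : ℕ, ∀ z : ℂ,
    a ≤ z.re → z.re ≤ b →
      ‖Complex.Gamma z‖ ≤ C * (1 + |z.im|) ^ M * Real.exp (-(Real.pi / 2 * |z.im|)) := by
  obtain ⟨k, hk⟩ := exists_nat_gt b
  obtain ⟨C, hC, h⟩ := exists_norm_Gamma_nat_add_half_le k
  have hcont : ContinuousOn Real.Gamma (Set.Icc a b) := fun x hx =>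
    (Real.differentiableAt_Gamma fun m => by
      have : (0 : ℝ) ≤ m := m.cast_nonneg
      have := hx.1
      linarith).continuousAt.continuousWithinAt
  obtain ⟨B, hB⟩ := isCompact_Icc.exists_bound_of_continuousOn hcont
  have gk : 0 < Real.Gamma (k + 1 / 2) := Real.Gamma_pos_of_pos (by positivity)
  refine ⟨(|B| + 1) / Real.Gamma (k + 1 / 2) * C, by positivity, k, fun z h1 h2 => ?_⟩
  -- The shift `c` carries `z` horizontally to the line `Re = k + 1/2`; it is positive because `k >
  -- b`.
  have h3 := norm_Gamma_div_le (z := z) (c := k + 1 / 2 - z.re) (by linarith) (by linarith)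
  have e1 : z.re + (k + 1 / 2 - z.re) = (k + 1 / 2 : ℝ) := by ring
  have e2 : z + ((k + 1 / 2 - z.re : ℝ) : ℂ) = k + 1 / 2 + z.im * Complex.I := by
    apply Complex.ext <;> simp
  rw [e1, e2] at h3
  refine h3.trans ?_
  have h4 : Real.Gamma z.re ≤ |B| + 1 := by
    have := hB z.re ⟨h1, h2⟩
    rw [Real.norm_eq_abs] at this
    linarith [le_abs_self (Real.Gamma z.re), le_abs_self B]
  calc _ ≤ (|B| + 1) / Real.Gamma (k + 1 / 2) *
        (C * (1 + |z.im|) ^ k * Real.exp (-(Real.pi / 2 * |z.im|))) := by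
        gcongr; exact h _
    _ = _ := by ring

/-- Growth of the entire function `1 / Γ` in a vertical strip around `Re = 1`. -/
theorem exists_norm_inv_Gamma_one_add_le : ∃ C : ℝ, 0 < C ∧ ∃ M : ℕ, ∀ w : ℂ, |w.re| ≤ 1 / 2 →
    ‖(Complex.Gamma (1 + w))⁻¹‖ ≤ C * (1 + |w.im|) ^ M * Real.exp (Real.pi / 2 * |w.im|) := by
  obtain ⟨C, hC, M, h⟩ := exists_norm_Gamma_le (a := 1 / 2) (by norm_num) (3 / 2)
  have hcont : Continuous fun w : ℂ => (Complex.Gamma (1 + w))⁻¹ :=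
    Complex.differentiable_one_div_Gamma.continuous.comp (by fun_prop : Continuous fun w : ℂ => 1 + w)
  obtain ⟨B, hB⟩ := (isCompact_closedBall (0 : ℂ) 1).exists_bound_of_continuousOn hcont.continuousOn
  refine ⟨max C (|B| + 1), by positivity, M, fun w hw => ?_⟩
  have one1 : 1 ≤ (1 + |w.im|) ^ M := one_le_pow₀ (by linarith [abs_nonneg w.im])
  have one2 : 1 ≤ Real.exp (Real.pi / 2 * |w.im|) := Real.one_le_exp (by positivity)
  -- Near `0` continuity suffices. Elsewhere the reflection formula gives `Γ(1 - w) sin(π(1 + w)) /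
  -- (-πw)`, whose denominator has modulus at least `1`; the sine contributes `exp(π|Im w|)` and `Γ`
  -- removes half of it.
  rcases le_total ‖w‖ 1 with h1 | h1
  · have h2 := hB w (by simpa using h1)
    have h3 : B ≤ |B| + 1 := by linarith [le_abs_self B]
    have h4 := le_max_right C (|B| + 1)
    calc _ ≤ max C (|B| + 1) * 1 * 1 := by linarith
      _ ≤ _ := by gcongr
  · have hw0 : w ≠ 0 := by rintro rfl; simp at h1; linarith
    have hr := abs_le.1 hw
    have e := Complex.Gamma_mul_Gamma_one_sub (1 + w)
    rw [show (1 : ℂ) - (1 + w) = -w by ring] at e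
    have e2 := Complex.Gamma_add_one (-w) (neg_ne_zero.2 hw0)
    have g0 : Complex.Gamma (1 + w) ≠ 0 := Complex.Gamma_ne_zero_of_re_pos (by simp; linarith)
    have g1 : Complex.Gamma (-w + 1) ≠ 0 := Complex.Gamma_ne_zero_of_re_pos (by simp; linarith)
    have g2 : Complex.Gamma (-w) ≠ 0 := by rintro h0; rw [h0, mul_zero] at e2; exact g1 e2
    have hs0 : Complex.sin (Real.pi * (1 + w)) ≠ 0 := by
      intro h0; rw [h0, div_zero] at e; exact mul_ne_zero g0 g2 e
    have e3 : (Complex.Gamma (1 + w))⁻¹ =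
        Complex.Gamma (-w + 1) * Complex.sin (Real.pi * (1 + w)) / (Real.pi * -w) := by
      rw [e2]
      have hpi : (Real.pi : ℂ) ≠ 0 := by exact_mod_cast Real.pi_ne_zero
      generalize Complex.sin (Real.pi * (1 + w)) = S at *
      rw [eq_div_iff hs0] at e
      field_simp
      rw [← e]
    have hs : ‖Complex.sin (Real.pi * (1 + w))‖ ≤ Real.exp (Real.pi * |w.im|) := by
      rw [Complex.sin]
      have hb : ∀ s : ℂ, |s.im| ≤ Real.pi * |w.im| → ‖Complex.exp (s * Complex.I)‖ ≤
          Real.exp (Real.pi * |w.im|) := fun s hs => by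
        rw [Complex.norm_exp]; simp; linarith [neg_abs_le s.im]
      rw [norm_div, norm_mul, Complex.norm_I, mul_one, div_le_iff₀ (by simp)]
      refine (norm_sub_le _ _).trans ?_
      have i1 := hb (-(Real.pi * (1 + w))) (by simp [abs_mul, abs_of_pos Real.pi_pos])
      have i2 := hb (Real.pi * (1 + w)) (by simp [abs_mul, abs_of_pos Real.pi_pos])
      simp only [RCLike.norm_ofNat]
      linarith
    have hG := h (-w + 1) (by simp; linarith) (by simp; linarith)
    simp only [Complex.add_im, Complex.neg_im, Complex.one_im, add_zero, abs_neg] at hG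
    rw [e3, norm_div, norm_mul, norm_mul, norm_neg, Complex.norm_real, Real.norm_of_nonneg Real.pi_pos.le]
    have hden : 1 ≤ Real.pi * ‖w‖ := by nlinarith [Real.pi_gt_three]
    calc _ ≤ ‖Complex.Gamma (-w + 1)‖ * ‖Complex.sin (Real.pi * (1 + w))‖ :=
          div_le_self (by positivity) hden
      _ ≤ (C * (1 + |w.im|) ^ M * Real.exp (-(Real.pi / 2 * |w.im|))) * Real.exp (Real.pi * |w.im|) := by
          gcongr
      _ = C * (1 + |w.im|) ^ M * Real.exp (Real.pi / 2 * |w.im|) := by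
          rw [mul_assoc, ← Real.exp_add]; congr 2; ring
      _ ≤ _ := by gcongr; exact le_max_left _ _

/-! ### The interlacing inequality. -/

/-- The total spread `∑_{a, b} |u_a - u_b|` of a configuration, over ordered pairs. -/
noncomputable def spread {n : ℕ} (u : Fin n → ℝ) : ℝ := ∑ a, ∑ b, |u a - u b|

/-- The total distance `∑_{a, b} |v_b - u_a|` between two configurations. -/
noncomputable def crossDist {n m : ℕ} (u : Fin n → ℝ) (v : Fin m → ℝ) : ℝ :=
  ∑ a, ∑ b, |v b - u a|

theorem sum_sq_sub_of_idempotent {n m : ℕ} {p : Fin n → ℤ} {q : Fin m → ℤ}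
    (hp : ∀ a, p a ^ 2 = p a) (hq : ∀ b, q b ^ 2 = q b) :
    ∑ a, ∑ b, (q b - p a) ^ 2 = m * ∑ a, p a + n * ∑ b, q b - 2 * (∑ a, p a) * ∑ b, q b := by
  have h : ∀ a b, (q b - p a) ^ 2 = p a + q b - 2 * p a * q b := fun a b => by
    rw [sub_sq, hp, hq]; ring
  simp only [h, Finset.sum_sub_distrib, Finset.sum_add_distrib, ← Finset.mul_sum, ← Finset.sum_mul]
  simp [Finset.mul_sum]

/-- For values in `{0, 1}` every sum depends only on `∑ p` and `∑ q`, and having exactly one more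
`q` than `p` produces `k(k + 1)` with `k = ∑ p - ∑ q`. This is nonnegative for every integer `k`. -/
theorem interlacing_defect_of_idempotent {n : ℕ} {p : Fin n → ℤ} {q : Fin (n + 1) → ℤ}
    (hp : ∀ a, p a ^ 2 = p a) (hq : ∀ b, q b ^ 2 = q b) :
    2 * ∑ a, ∑ b, (q b - p a) ^ 2 - ∑ a, ∑ b, (p a - p b) ^ 2 - ∑ a, ∑ b, (q a - q b) ^ 2 =
      2 * ((∑ a, p a - ∑ b, q b) * (∑ a, p a - ∑ b, q b + 1)) := by
  have e1 : ∑ a, ∑ b, (p a - p b) ^ 2 = ∑ a, ∑ b, (p b - p a) ^ 2 :=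
    Finset.sum_congr rfl fun a _ => Finset.sum_congr rfl fun b _ => by ring
  have e2 : ∑ a, ∑ b, (q a - q b) ^ 2 = ∑ a, ∑ b, (q b - q a) ^ 2 :=
    Finset.sum_congr rfl fun a _ => Finset.sum_congr rfl fun b _ => by ring
  rw [e1, e2, sum_sq_sub_of_idempotent hp hq, sum_sq_sub_of_idempotent hp hp,
    sum_sq_sub_of_idempotent hq hq]
  push_cast
  ring

/-- The step function `1_{t < x}`. -/
noncomputable def stepFun (t x : ℝ) : ℤ := if t < x then 1 else 0

theorem stepFun_sq (t x : ℝ) : stepFun t x ^ 2 = stepFun t x := by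
  unfold stepFun; split_ifs <;> simp

theorem stepFun_sub_sq_eq_indicator (t x y : ℝ) : (((stepFun t x - stepFun t y) ^ 2 : ℤ) : ℝ) =
    (Set.Ico (min x y) (max x y)).indicator (fun _ => (1 : ℝ)) t := by
  unfold stepFun
  simp only [Set.indicator_apply, Set.mem_Ico, min_le_iff, lt_max_iff]
  split_ifs <;> grind

theorem integrable_stepFun_sub_sq (x y : ℝ) :
    MeasureTheory.Integrable fun t => (((stepFun t x - stepFun t y) ^ 2 : ℤ) : ℝ) := by
  simp only [stepFun_sub_sq_eq_indicator]
  exact (MeasureTheory.integrable_indicator_iff measurableSet_Ico).2 (by simp)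

theorem integral_stepFun_sub_sq (x y : ℝ) :
    ∫ t, (((stepFun t x - stepFun t y) ^ 2 : ℤ) : ℝ) = |x - y| := by
  simp only [stepFun_sub_sq_eq_indicator]
  rw [MeasureTheory.integral_indicator measurableSet_Ico]
  simp [abs_sub_comm, max_sub_min_eq_abs]

/-- Layer-cake formula: `|x - y|` is the integral over `t` of `(1_{t<x} - 1_{t<y})²`. An inequality
between sums of distances thereby becomes a pointwise one between step functions. -/
theorem integral_interlacing_defect {n : ℕ} (u : Fin n → ℝ) (v : Fin (n + 1) → ℝ) :
    2 * crossDist u v - spread u - spread v = ∫ t, (((2 *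
      ((∑ a, stepFun t (u a) - ∑ b, stepFun t (v b)) *
        (∑ a, stepFun t (u a) - ∑ b, stepFun t (v b) + 1)) : ℤ)) : ℝ) ∧
    MeasureTheory.Integrable fun t => (((2 *
      ((∑ a, stepFun t (u a) - ∑ b, stepFun t (v b)) *
        (∑ a, stepFun t (u a) - ∑ b, stepFun t (v b) + 1)) : ℤ)) : ℝ) := by
  have hi : ∀ {k l : ℕ} (x : Fin k → ℝ) (y : Fin l → ℝ), MeasureTheory.Integrable fun t =>
      ∑ a, ∑ b, (((stepFun t (y b) - stepFun t (x a)) ^ 2 : ℤ) : ℝ) := fun x y =>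
    MeasureTheory.integrable_finsetSum _ fun a _ => MeasureTheory.integrable_finsetSum _
      fun b _ => integrable_stepFun_sub_sq _ _
  have hi' : ∀ {k : ℕ} (x : Fin k → ℝ), MeasureTheory.Integrable fun t =>
      ∑ a, ∑ b, (((stepFun t (x a) - stepFun t (x b)) ^ 2 : ℤ) : ℝ) := fun x =>
    MeasureTheory.integrable_finsetSum _ fun a _ => MeasureTheory.integrable_finsetSum _
      fun b _ => integrable_stepFun_sub_sq _ _
  have e : ∀ t, (((2 *
      ((∑ a, stepFun t (u a) - ∑ b, stepFun t (v b)) *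
        (∑ a, stepFun t (u a) - ∑ b, stepFun t (v b) + 1)) : ℤ)) : ℝ) =
      2 * (∑ a, ∑ b, (((stepFun t (v b) - stepFun t (u a)) ^ 2 : ℤ) : ℝ)) -
        (∑ a, ∑ b, (((stepFun t (u a) - stepFun t (u b)) ^ 2 : ℤ) : ℝ)) -
        (∑ a, ∑ b, (((stepFun t (v a) - stepFun t (v b)) ^ 2 : ℤ) : ℝ)) := fun t => by
    rw [← interlacing_defect_of_idempotent (fun a => stepFun_sq t (u a))
      (fun b => stepFun_sq t (v b))]
    push_cast
    rfl
  simp only [e]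
  refine ⟨?_, (((hi u v).const_mul 2).sub (hi' u)).sub (hi' v)⟩
  rw [MeasureTheory.integral_sub (f := fun t =>
      2 * (∑ a, ∑ b, (((stepFun t (v b) - stepFun t (u a)) ^ 2 : ℤ) : ℝ)) -
        (∑ a, ∑ b, (((stepFun t (u a) - stepFun t (u b)) ^ 2 : ℤ) : ℝ)))
      (((hi u v).const_mul 2).sub (hi' u)) (hi' v),
    MeasureTheory.integral_sub ((hi u v).const_mul 2) (hi' u), MeasureTheory.integral_const_mul]
  have hs : ∀ {k l : ℕ} (F : Fin k → Fin l → ℝ → ℝ), (∀ a b, MeasureTheory.Integrable (F a b)) →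
      ∫ t, ∑ a, ∑ b, F a b t = ∑ a, ∑ b, ∫ t, F a b t := fun F hF => by
    rw [MeasureTheory.integral_finsetSum _ fun a _ => MeasureTheory.integrable_finsetSum _
      fun b _ => hF a b]
    exact Finset.sum_congr rfl fun a _ => MeasureTheory.integral_finsetSum _ fun b _ => hF a b
  rw [hs _ fun a b => integrable_stepFun_sub_sq _ _, hs _ fun a b => integrable_stepFun_sub_sq _ _,
    hs _ fun a b => integrable_stepFun_sub_sq _ _]
  simp only [integral_stepFun_sub_sq]
  rfl

/-- The integrand `2k(k + 1)` is nonnegative everywhere and at least `4` on the given interval,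
where `k` avoids `-1` and `0`. -/
theorem four_mul_sub_le_interlacing_defect {n : ℕ} (u : Fin n → ℝ) (v : Fin (n + 1) → ℝ) {c d : ℝ}
    (hcd : c ≤ d) (h : ∀ t ∈ Set.Ico c d,
      2 ≤ ((∑ a, stepFun t (u a) - ∑ b, stepFun t (v b)) *
        (∑ a, stepFun t (u a) - ∑ b, stepFun t (v b) + 1))) :
    4 * (d - c) ≤ 2 * crossDist u v - spread u - spread v := by
  obtain ⟨h1, h2⟩ := integral_interlacing_defect u v
  rw [h1]
  have h3 : ∫ t, (Set.Ico c d).indicator (fun _ => (4 : ℝ)) t = 4 * (d - c) := by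
    rw [MeasureTheory.integral_indicator measurableSet_Ico]
    simp [hcd, mul_comm]
  rw [← h3]
  refine MeasureTheory.integral_mono
    ((MeasureTheory.integrable_indicator_iff measurableSet_Ico).2 (by simp)) h2 fun t => ?_
  simp only [Set.indicator_apply]
  split_ifs with ht
  · have := h t ht
    exact_mod_cast (by linarith : (4 : ℤ) ≤ _)
  · generalize ∑ a, stepFun t (u a) - ∑ b, stepFun t (v b) = k
    have : 0 ≤ k * (k + 1) := by
      rcases le_or_gt 0 k with hk | hk
      · positivity
      · nlinarith
    exact_mod_cast (by linarith : (0 : ℤ) ≤ _)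

theorem spread_add_spread_le {n : ℕ} (u : Fin n → ℝ) (v : Fin (n + 1) → ℝ) :
    spread u + spread v ≤ 2 * crossDist u v := by
  have := four_mul_sub_le_interlacing_defect u v (le_refl (0 : ℝ)) (by simp)
  linarith

/-- If some `u_a` lies beyond the box of radius `‖v‖`, the counting difference `k` is at least `1`
on the gap to the right of the box, or at most `-2` on the gap to its left. In both cases `k(k + 1)
≥ 2` along the whole gap. -/
theorem spread_add_spread_add_le {n : ℕ} (u : Fin n → ℝ) (v : Fin (n + 1) → ℝ) :
    spread u + spread v + 4 * (‖u‖ - ‖v‖) ≤ 2 * crossDist u v := by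
  have h0 := spread_add_spread_le u v
  rcases le_total ‖u‖ ‖v‖ with h | h
  · linarith
  have key : ∀ a, |u a| ≤ ‖v‖ + (2 * crossDist u v - spread u - spread v) / 4 := fun a => by
    rcases le_total |u a| ‖v‖ with h1 | h1
    · linarith
    have hv : ∀ b, |v b| ≤ ‖v‖ := fun b => norm_le_pi_norm v b
    have nn : ∀ t x, 0 ≤ stepFun t x := fun t x => by unfold stepFun; split_ifs <;> simp
    have le1 : ∀ t x, stepFun t x ≤ 1 := fun t x => by unfold stepFun; split_ifs <;> simp
    rcases le_total 0 (u a) with h2 | h2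
    · rw [abs_of_nonneg h2] at h1 ⊢
      have := four_mul_sub_le_interlacing_defect u v h1 fun t ht => by
        have e1 : ∑ b, stepFun t (v b) = 0 := Finset.sum_eq_zero fun b _ => by
          have := (abs_le.1 (hv b)).2
          simp only [stepFun, ite_eq_right_iff]
          intro h3; linarith [ht.1]
        have e2 : 1 ≤ ∑ a, stepFun t (u a) := by
          refine le_trans ?_ (Finset.single_le_sum (fun i _ => nn t (u i)) (Finset.mem_univ a))
          simp [stepFun, ht.2]
        rw [e1]; nlinarith
      linarith
    · rw [abs_of_nonpos h2] at h1 ⊢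
      have := four_mul_sub_le_interlacing_defect u v (c := u a) (d := -‖v‖) (by linarith)
        fun t ht => by
        have e1 : ∑ b, stepFun t (v b) = n + 1 := by
          rw [Finset.sum_congr rfl (g := fun _ => (1 : ℤ)) fun b _ => by
            have := (abs_le.1 (hv b)).1
            simp only [stepFun, ite_eq_left_iff]
            intro h3; exact absurd (lt_of_lt_of_le ht.2 this) h3]
          simp
        have e2 : ∑ a, stepFun t (u a) ≤ n - 1 := by
          rw [← Finset.add_sum_erase _ _ (Finset.mem_univ a)]
          have e3 : stepFun t (u a) = 0 := by simp [stepFun, ht.1]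
          have e4 : ∑ i ∈ Finset.univ.erase a, stepFun t (u i) ≤
              ∑ i ∈ Finset.univ.erase a, (1 : ℤ) := Finset.sum_le_sum fun i _ => le1 _ _
          rw [Finset.sum_const, Finset.card_erase_of_mem (Finset.mem_univ a), Finset.card_univ,
            Fintype.card_fin] at e4
          have hn : 1 ≤ n := by have := a.2; omega
          simp only [nsmul_eq_mul, mul_one] at e4
          push_cast [hn] at e4
          rw [e3]; linarith
        rw [e1]; nlinarith
      linarith
  have := (pi_norm_le_iff_of_nonneg (x := u)
    (r := ‖v‖ + (2 * crossDist u v - spread u - spread v) / 4) (by linarith [norm_nonneg v])).2 key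
  linarith

/-- The exponential weight of one step of the induction trades decay in `u` for growth in `v`. -/
theorem exists_exp_interlacing_le {κ : ℝ} (hκ : 0 < κ) (M : ℕ) : ∃ C : ℝ, 0 < C ∧
    ∀ {n : ℕ} (u : Fin n → ℝ) (v : Fin (n + 1) → ℝ),
      (1 + ‖u‖) ^ M * Real.exp (κ * (spread u / 2 + spread v / 2 - crossDist u v)) ≤
        C * (1 + ‖v‖) ^ M := by
  refine ⟨M.factorial * Real.exp (2 * κ) / (2 * κ) ^ M + 1, by positivity, fun u v => ?_⟩
  have h0 := spread_add_spread_le u v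
  have h1 := spread_add_spread_add_le u v
  set e := spread u / 2 + spread v / 2 - crossDist u v
  have hv1 : 1 ≤ 1 + ‖v‖ := by linarith [norm_nonneg v]
  rcases le_total ‖u‖ ‖v‖ with h | h
  · have h2 : Real.exp (κ * e) ≤ 1 := Real.exp_le_one_iff.2 (by
      have : e ≤ 0 := by simp only [e]; linarith
      nlinarith)
    have : (0 : ℝ) ≤ M.factorial * Real.exp (2 * κ) / (2 * κ) ^ M := by positivity
    calc _ ≤ (1 + ‖v‖) ^ M * 1 := by gcongr
      _ = 1 * (1 + ‖v‖) ^ M := by ring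
      _ ≤ _ := by gcongr; linarith
  · set y := ‖u‖ - ‖v‖
    have hy : 0 ≤ y := by simp only [y]; linarith
    -- The interlacing gain `4y` gives `e ≤ -2y`. The constant `exp(2κ)` completes `y` to `1 + y`,
    -- so that the power `(1 + y)^M` is absorbed below.
    have h2 : Real.exp (κ * e) ≤ Real.exp (2 * κ) * Real.exp (-(2 * κ * (1 + y))) := by
      rw [← Real.exp_add]
      refine Real.exp_le_exp.2 ?_
      have : e ≤ -(2 * y) := by simp only [e, y]; linarith
      nlinarith
    have h3 : 1 + ‖u‖ ≤ (1 + ‖v‖) * (1 + y) := by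
      have : ‖u‖ = ‖v‖ + y := by simp only [y]; ring
      rw [this]; nlinarith [norm_nonneg v]
    have h4 : (1 + y) ^ M * Real.exp (-(2 * κ * (1 + y))) ≤ M.factorial / (2 * κ) ^ M := by
      have := Real.pow_div_factorial_le_exp (2 * κ * (1 + y)) (by positivity) M
      rw [Real.exp_neg, ← div_eq_mul_inv, div_le_div_iff₀ (Real.exp_pos _) (by positivity),
        ← mul_pow, mul_comm (1 + y)]
      rw [div_le_iff₀ (by positivity)] at this
      linarith
    calc _ ≤ ((1 + ‖v‖) * (1 + y)) ^ M * (Real.exp (2 * κ) * Real.exp (-(2 * κ * (1 + y)))) := by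
          gcongr
      _ = (1 + ‖v‖) ^ M * Real.exp (2 * κ) * ((1 + y) ^ M * Real.exp (-(2 * κ * (1 + y)))) := by
          rw [mul_pow]; ring
      _ ≤ (1 + ‖v‖) ^ M * Real.exp (2 * κ) * (M.factorial / (2 * κ) ^ M) := by gcongr
      _ = (M.factorial * Real.exp (2 * κ) / (2 * κ) ^ M) * (1 + ‖v‖) ^ M := by ring
      _ ≤ _ := by gcongr; linarith

/-! ### The bordered Cauchy determinant. -/

open Polynomial in
theorem Matrix.det_eval_eq_det_vandermonde_mul {R : Type*} [CommRing R] {m : ℕ} (v : Fin m → R)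
    (p : Fin m → R[X]) (hp : ∀ i, (p i).natDegree < m) :
    (Matrix.of fun b i => (p i).eval (v b)).det =
      (Matrix.vandermonde v).det * (Matrix.of fun (j i : Fin m) => (p i).coeff j).det := by
  rw [← Matrix.det_mul]
  congr 1
  ext b i
  rw [Matrix.mul_apply, Matrix.of_apply, Polynomial.eval_eq_sum_range' (hp i)]
  simp only [Matrix.vandermonde_apply, Matrix.of_apply, ← Fin.sum_univ_eq_sum_range
    (fun j => (p i).coeff j * v b ^ j) m]
  exact Finset.sum_congr rfl fun j _ => mul_comm _ _

/-- The Vandermonde product `∏_{a < b} (w_b - w_a)`. -/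
def vdm {n : ℕ} (w : Fin n → ℂ) : ℂ := ∏ a, ∏ b ∈ Finset.Ioi a, (w b - w a)

/-- The sign in the bordered Cauchy determinant. -/
def borderSign (n : ℕ) : ℂ := (-1) ^ n * ∏ a : Fin n, ∏ _b ∈ Finset.Ioi a, (-1 : ℂ)

theorem borderSign_mul_self (n : ℕ) : borderSign n * borderSign n = 1 := by
  unfold borderSign
  rw [mul_mul_mul_comm, ← mul_pow, ← Finset.prod_mul_distrib]
  simp only [← Finset.prod_mul_distrib, mul_neg, mul_one, neg_neg, one_pow, Finset.prod_const_one]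

open Polynomial in
/-- The Lagrange type basis `∏_a (X - w_a)`, `∏_{a' ≠ a} (X - w_{a'})`. -/
noncomputable def nodePoly {n : ℕ} (w : Fin n → ℂ) : Fin (n + 1) → ℂ[X] :=
  Fin.cons (∏ a, (X - C (w a))) fun a => ∏ a' ∈ Finset.univ.erase a, (X - C (w a'))

open Polynomial in
theorem natDegree_nodePoly_lt {n : ℕ} (w : Fin n → ℂ) (i : Fin (n + 1)) :
    (nodePoly w i).natDegree < n + 1 := by
  refine Fin.cases ?_ (fun a => ?_) i
  · simp only [nodePoly, Fin.cons_zero]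
    rw [Polynomial.natDegree_prod_of_monic _ _ fun a _ => monic_X_sub_C _]
    simp
  · simp only [nodePoly, Fin.cons_succ]
    rw [Polynomial.natDegree_prod_of_monic _ _ fun a _ => monic_X_sub_C _]
    simp

theorem eval_nodePoly_zero {n : ℕ} (w : Fin n → ℂ) (x : ℂ) :
    (nodePoly w 0).eval x = ∏ a, (x - w a) := by
  simp [nodePoly, Polynomial.eval_prod]

theorem eval_nodePoly_succ {n : ℕ} (w : Fin n → ℂ) (a : Fin n) (x : ℂ) :
    (nodePoly w a.succ).eval x = ∏ a' ∈ Finset.univ.erase a, (x - w a') := by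
  simp [nodePoly, Polynomial.eval_prod]

/-- The coefficient determinant is computed by evaluating the basis at `w_1, …, w_n` and one
auxiliary point `x`: the evaluation matrix is triangular, and dividing by the Vandermonde
determinant of these points leaves the claim. -/
theorem det_coeff_nodePoly {n : ℕ} {w : Fin n → ℂ} (hw : vdm w ≠ 0) :
    (Matrix.of fun (j i : Fin (n + 1)) => (nodePoly w i).coeff j).det = borderSign n * vdm w := by
  obtain ⟨x, hx⟩ := (Set.finite_range w).exists_notMem
  have hx' : ∏ a, (x - w a) ≠ 0 := Finset.prod_ne_zero_iff.2 fun a _ => by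
    rw [sub_ne_zero]; rintro rfl; exact hx ⟨a, rfl⟩
  have h := Matrix.det_eval_eq_det_vandermonde_mul (Fin.cons x w : Fin (n + 1) → ℂ) (nodePoly w)
    (natDegree_nodePoly_lt w)
  have h1 : (Matrix.of fun b i =>
      (nodePoly w i).eval ((Fin.cons x w : Fin (n + 1) → ℂ) b)).det =
      (∏ a, (x - w a)) * ∏ a, ∏ a' ∈ Finset.univ.erase a, (w a - w a') := by
    rw [Matrix.det_of_isUpperTriangular]
    · rw [Fin.prod_univ_succ]
      simp only [Matrix.of_apply, Fin.cons_zero, Fin.cons_succ, eval_nodePoly_zero,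
        eval_nodePoly_succ]
    · intro i j hij
      simp only [id] at hij
      obtain ⟨i, rfl⟩ := Fin.exists_succ_eq.2 (ne_of_gt (lt_of_le_of_lt (Fin.zero_le _) hij))
      simp only [Matrix.of_apply, Fin.cons_succ]
      revert hij
      refine Fin.cases (fun _ => ?_) (fun j hij => ?_) j
      · rw [eval_nodePoly_zero]
        exact Finset.prod_eq_zero (Finset.mem_univ i) (sub_self _)
      · rw [eval_nodePoly_succ]
        exact Finset.prod_eq_zero (Finset.mem_erase.2
          ⟨by rintro rfl; exact lt_irrefl _ hij, Finset.mem_univ i⟩) (sub_self _)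
  have h2 : (Matrix.vandermonde (Fin.cons x w : Fin (n + 1) → ℂ)).det =
      ((-1) ^ n * ∏ a, (x - w a)) * vdm w := by
    rw [Matrix.det_vandermonde, Fin.prod_univ_succ, Fin.prod_Ioi_zero]
    simp only [Fin.prod_Ioi_succ, Fin.cons_zero, Fin.cons_succ]
    congr 1
    have : ((-1 : ℂ)) ^ n = ∏ _a : Fin n, (-1 : ℂ) := by simp
    rw [this, ← Finset.prod_mul_distrib]
    exact Finset.prod_congr rfl fun a _ => by ring
  have h3 : ∏ a, ∏ a' ∈ Finset.univ.erase a, (w a - w a') =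
      (∏ a : Fin n, ∏ _b ∈ Finset.Ioi a, (-1 : ℂ)) * (vdm w * vdm w) := by
    have := Finset.prod_prod_Ioi_mul_eq_prod_prod_off_diag fun a b : Fin n => (w b - w a)
    simp only [Finset.compl_singleton] at this
    rw [← this, vdm]
    simp only [← Finset.prod_mul_distrib]
    exact Finset.prod_congr rfl fun a _ => Finset.prod_congr rfl fun b _ => by ring
  rw [h1, h2, h3] at h
  have h4 : ((-1 : ℂ) ^ n * (-1) ^ n) = 1 := by rw [← mul_pow]; simp
  refine mul_left_cancel₀ (mul_ne_zero (mul_ne_zero (pow_ne_zero n (by norm_num : (-1 : ℂ) ≠ 0)) hx') hw) ?_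
  rw [← h, borderSign]
  linear_combination (-(∏ a, (x - w a)) * (∏ a : Fin n, ∏ _b ∈ Finset.Ioi a, (-1 : ℂ)) *
    vdm w * vdm w) * h4

/-- The bordered Cauchy determinant, expanded over permutations. -/
theorem vdm_mul_vdm {n : ℕ} (w : Fin n → ℂ) (v : Fin (n + 1) → ℂ) (h : ∀ a b, v b ≠ w a) :
    vdm w * vdm v = borderSign n * (∏ a, ∏ b, (v b - w a)) *
      ∑ σ : Equiv.Perm (Fin (n + 1)), ((Equiv.Perm.sign σ : ℤ) : ℂ) *
        ∏ a : Fin n, (v (σ a.succ) - w a)⁻¹ := by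
  set A : Matrix (Fin (n + 1)) (Fin (n + 1)) ℂ :=
    Matrix.of fun b i => (Fin.cons 1 fun a => (v b - w a)⁻¹ : Fin (n + 1) → ℂ) i with hA
  have h0 : A.det = ∑ σ : Equiv.Perm (Fin (n + 1)), ((Equiv.Perm.sign σ : ℤ) : ℂ) *
        ∏ a : Fin n, (v (σ a.succ) - w a)⁻¹ := by
    rw [Matrix.det_apply']
    exact Finset.sum_congr rfl fun σ _ => by rw [Fin.prod_univ_succ]; simp [hA]
  rw [← h0]
  -- When two nodes coincide, both sides vanish: the Cauchy matrix has two equal columns.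
  by_cases hw : vdm w = 0
  · rw [hw, zero_mul]
    obtain ⟨a, -, ha⟩ := Finset.prod_eq_zero_iff.1 hw
    obtain ⟨b, hb, hab⟩ := Finset.prod_eq_zero_iff.1 ha
    rw [Finset.mem_Ioi] at hb
    rw [Matrix.det_zero_of_column_eq (M := A) (i := a.succ) (j := b.succ)
      (by simpa using hb.ne) (fun k => by simp [hA, sub_eq_zero.1 hab]), mul_zero]
  -- Multiplying row `b` by `∏_a (v_b - w_a)` clears the denominators and turns the Cauchy matrix
  -- into the values of the node polynomials.
  have h1 : (Matrix.of fun b i => (nodePoly w i).eval (v b)).det =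
      (∏ b, ∏ a, (v b - w a)) * A.det := by
    rw [← Matrix.det_mul_column]
    congr 1
    ext b i
    simp only [Matrix.of_apply, hA]
    refine Fin.cases ?_ (fun a => ?_) i
    · simp [eval_nodePoly_zero]
    · rw [eval_nodePoly_succ, ← Finset.mul_prod_erase _ _ (Finset.mem_univ a)]
      have := sub_ne_zero.2 (h a b)
      simp only [Fin.cons_succ]
      field_simp
  have h2 := Matrix.det_eval_eq_det_vandermonde_mul v (nodePoly w) (natDegree_nodePoly_lt w)
  rw [h1, det_coeff_nodePoly hw, Matrix.det_vandermonde] at h2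
  rw [Finset.prod_comm, mul_assoc, h2]
  simp only [vdm]
  linear_combination (-(∏ a, ∏ b ∈ Finset.Ioi a, (w b - w a)) *
    (∏ a, ∏ b ∈ Finset.Ioi a, (v b - v a))) * borderSign_mul_self n

/-! ### Integrals of functions with polynomial decay. -/

section Decay
variable {E F : Type*} [NormedAddCommGroup E] [NormedSpace ℝ E] [FiniteDimensional ℝ E]
  [MeasurableSpace E] [BorelSpace E] [NormedAddCommGroup F]

theorem integrable_inv_one_add_norm_pow {k : ℕ} (hk : Module.finrank ℝ E < k) (μ : Measure E)
    [μ.IsAddHaarMeasure] : Integrable (fun x : E => ((1 + ‖x‖) ^ k)⁻¹) μ := by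
  have := integrable_one_add_norm (E := E) (μ := μ) (r := k) (by exact_mod_cast hk)
  refine this.congr (Filter.Eventually.of_forall fun x => ?_)
  simp only []
  rw [Real.rpow_neg (by positivity), Real.rpow_natCast]

theorem integrable_of_decay {k : ℕ} (hk : Module.finrank ℝ E < k) (μ : Measure E)
    [μ.IsAddHaarMeasure] {f : E → F} (hf : AEStronglyMeasurable f μ) {B : ℝ}
    (h : ∀ x, (1 + ‖x‖) ^ k * ‖f x‖ ≤ B) : Integrable f μ :=
  ((integrable_inv_one_add_norm_pow hk μ).const_mul B).mono' hf (Filter.Eventually.of_forall fun x => by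
    rw [← div_eq_mul_inv, le_div_iff₀ (by positivity), mul_comm]; exact h x)

theorem norm_integral_le_of_decay [NormedSpace ℝ F] {k : ℕ} (hk : Module.finrank ℝ E < k) (μ : Measure E)
    [μ.IsAddHaarMeasure] {f : E → F} {B : ℝ}
    (h : ∀ x, (1 + ‖x‖) ^ k * ‖f x‖ ≤ B) :
    ‖∫ x, f x ∂μ‖ ≤ B * ∫ x, ((1 + ‖x‖) ^ k)⁻¹ ∂μ := by
  rw [← integral_const_mul]
  refine norm_integral_le_of_norm_le ((integrable_inv_one_add_norm_pow hk μ).const_mul B)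
    (Filter.Eventually.of_forall fun x => ?_)
  rw [← div_eq_mul_inv, le_div_iff₀ (by positivity), mul_comm]; exact h x

end Decay

/-! ### Factorisation of the Mellin-Barnes weight and bounds for its factors. -/

theorem norm_prod_le_of_exp_bound {ι : Type*} (s : Finset ι) {f : ι → ℂ} {x : ι → ℝ}
    {C c R : ℝ} {M : ℕ} (h : ∀ i ∈ s, ‖f i‖ ≤ C * (1 + R) ^ M * Real.exp (c * x i)) :
    ‖∏ i ∈ s, f i‖ ≤ (C * (1 + R) ^ M) ^ s.card * Real.exp (c * ∑ i ∈ s, x i) := by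
  rw [norm_prod]
  refine (Finset.prod_le_prod (fun i _ => norm_nonneg _) h).trans (le_of_eq ?_)
  rw [Finset.prod_mul_distrib, Finset.prod_const, ← Real.exp_sum, Finset.mul_sum]

theorem norm_prod_prod_le_of_exp_bound {n : ℕ} {ι : Type*} (t : Fin n → Finset ι)
    {f : Fin n → ι → ℂ} {x : Fin n → ι → ℝ}
    {C c R : ℝ} {M : ℕ} (h : ∀ a, ∀ b ∈ t a, ‖f a b‖ ≤ C * (1 + R) ^ M * Real.exp (c * x a b)) :
    ‖∏ a, ∏ b ∈ t a, f a b‖ ≤ (C * (1 + R) ^ M) ^ (Finset.univ.sigma t).card *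
      Real.exp (c * ∑ a, ∑ b ∈ t a, x a b) := by
  rw [Finset.prod_sigma', Finset.sum_sigma']
  exact norm_prod_le_of_exp_bound _ fun i hi => h _ _ (Finset.mem_sigma.1 hi).2

theorem sum_Ioi_abs_sub {n : ℕ} (u : Fin n → ℝ) :
    ∑ a, ∑ b ∈ Finset.Ioi a, |u a - u b| = spread u / 2 := by
  have h := Finset.sum_sum_Ioi_add_eq_sum_sum_off_diag fun a b : Fin n => |u a - u b|
  have h2 : ∀ a : Fin n, ∑ b ∈ ({a}ᶜ : Finset (Fin n)), |u b - u a| = ∑ b, |u a - u b| := fun a => by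
    rw [Finset.compl_singleton, ← Finset.add_sum_erase _ _ (Finset.mem_univ a)]
    simp [abs_sub_comm]
  simp only [h2] at h
  rw [spread, ← h]
  have : ∀ a b : Fin n, |u b - u a| + |u a - u b| = 2 * |u a - u b| := fun a b => by
    rw [abs_sub_comm]; ring
  simp only [this, ← Finset.mul_sum]
  ring

theorem abs_sub_le_two_mul_norm {n : ℕ} (u : Fin n → ℝ) (a b : Fin n) : |u a - u b| ≤ 2 * ‖u‖ := by
  have h1 := norm_le_pi_norm u a
  have h2 := norm_le_pi_norm u b
  rw [Real.norm_eq_abs] at h1 h2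
  linarith [abs_sub (u a) (u b)]

theorem abs_sub_le_norm_add_norm {n m : ℕ} (u : Fin n → ℝ) (v : Fin m → ℝ) (a : Fin n) (b : Fin m) :
    |v b - u a| ≤ ‖u‖ + ‖v‖ := by
  have h1 := norm_le_pi_norm u a
  have h2 := norm_le_pi_norm v b
  rw [Real.norm_eq_abs] at h1 h2
  linarith [abs_sub (v b) (u a)]

/-- One factor of the Mellin-Barnes weight, as a function of `s = y_b - w_a`. -/
noncomputable def mbFactor (h : ℝ) (s : ℂ) : ℂ :=
  (h : ℂ) ^ (-(Complex.I / h * s)) * Complex.Gamma (s / (Complex.I * h))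

/-- The product of the factors `mbFactor` for `y = v` real and `w = u - i z`. -/
noncomputable def crossGamma (h : ℝ) {n : ℕ} (z : ℂ) (u : Fin n → ℝ) (v : Fin (n + 1) → ℝ) : ℂ :=
  ∏ a, ∏ b, mbFactor h ((v b : ℂ) - u a + Complex.I * z)

/-- One half of the Sklyanin density: the product over `a < b` of `1 / Γ((u_a - u_b)/(iħ))`. -/
noncomputable def halfDensity (h : ℝ) {n : ℕ} (u : Fin n → ℝ) : ℂ :=
  ∏ a, ∏ b ∈ Finset.Ioi a, (Complex.Gamma (((u a : ℂ) - u b) / (Complex.I * h)))⁻¹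

/-- The other half of the Sklyanin density. -/
noncomputable def halfDensity' (h : ℝ) {n : ℕ} (u : Fin n → ℝ) : ℂ :=
  ∏ a, ∏ b ∈ Finset.Ioi a, (Complex.Gamma (((u b : ℂ) - u a) / (Complex.I * h)))⁻¹

theorem prod_erase_inv_Gamma (h : ℝ) {n : ℕ} (u : Fin n → ℝ) :
    ∏ a : Fin n, ∏ b ∈ Finset.univ.erase a,
      (Complex.Gamma (((u b : ℂ) - u a) / (Complex.I * h)))⁻¹ =
      halfDensity h u * halfDensity' h u := by
  have := Finset.prod_prod_Ioi_mul_eq_prod_prod_off_diag fun a b : Fin n =>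
    (Complex.Gamma (((u a : ℂ) - u b) / (Complex.I * h)))⁻¹
  simp only [Finset.compl_singleton, Finset.prod_mul_distrib] at this
  rw [← this, halfDensity, halfDensity', mul_comm]

theorem prod_erase_inv_Gamma' (h : ℝ) {n : ℕ} (u : Fin n → ℝ) :
    ∏ a : Fin n, ∏ b ∈ Finset.univ.erase a,
      (Complex.Gamma (((u a : ℂ) - u b) / (Complex.I * h)))⁻¹ =
      halfDensity h u * halfDensity' h u := by
  have := Finset.prod_prod_Ioi_mul_eq_prod_prod_off_diag fun a b : Fin n =>
    (Complex.Gamma (((u b : ℂ) - u a) / (Complex.I * h)))⁻¹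
  simp only [Finset.compl_singleton, Finset.prod_mul_distrib] at this
  rw [← this, halfDensity, halfDensity']

/-- Only the relative depth `β - γ` of the two contours enters; a common shift of the `w_a` cancels
in the `1/Γ` factors. -/
theorem mbWeight_contourPoint (h β γ : ℝ) {n : ℕ} (u : Fin n → ℝ) (v : Fin (n + 1) → ℝ) :
    mbWeight h (contourPoint β u) (contourPoint γ v) =
      crossGamma h ((β - γ : ℝ) : ℂ) u v * (halfDensity h u * halfDensity' h u) := by
  rw [← prod_erase_inv_Gamma, mbWeight, crossGamma]
  congr 1
  · refine Finset.prod_congr rfl fun a _ => Finset.prod_congr rfl fun b _ => ?_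
    simp only [mbFactor, contourPoint]
    push_cast
    congr 2 <;> ring
  · refine Finset.prod_congr rfl fun a _ => Finset.prod_congr rfl fun b _ => ?_
    simp only [contourPoint]
    congr 3; ring

section Bounds
variable {h : ℝ} (hh : 0 < h)
include hh

/-- Division by `iħ` is a rotation: the height of `s` becomes the real part of the argument of `Γ`,
and decay of `Γ` along vertical lines becomes decay in `Re s`. -/
theorem div_I_mul_eq (s : ℂ) : s / (Complex.I * h) = (s.im / h : ℝ) + (-(s.re / h) : ℝ) * Complex.I := by
  have h0 : (h : ℂ) ≠ 0 := by exact_mod_cast hh.ne'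
  rw [div_eq_iff (mul_ne_zero Complex.I_ne_zero h0)]
  conv_lhs => rw [← Complex.re_add_im s]
  push_cast
  field_simp
  ring_nf
  simp

theorem div_I_mul_re (s : ℂ) : (s / (Complex.I * h)).re = s.im / h := by
  rw [div_I_mul_eq hh]; simp

theorem div_I_mul_im (s : ℂ) : (s / (Complex.I * h)).im = -(s.re / h) := by
  rw [div_I_mul_eq hh]; simp

theorem one_add_abs_div_le (x : ℝ) : 1 + |-(x / h)| ≤ (1 + h⁻¹) * (1 + |x|) := by
  have : 0 < h⁻¹ := by positivity
  rw [abs_neg, abs_div, abs_of_pos hh, div_eq_mul_inv]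
  nlinarith [abs_nonneg x]

theorem norm_hbar_cpow_le {δ : ℝ} {s : ℂ} (hs : |s.im| ≤ δ) :
    ‖(h : ℂ) ^ (-(Complex.I / h * s))‖ ≤ Real.exp (|Real.log h| * (δ / h)) := by
  rw [Complex.norm_cpow_eq_rpow_re_of_pos hh, Real.rpow_def_of_pos hh]
  refine Real.exp_le_exp.2 ((le_abs_self _).trans ?_)
  rw [abs_mul]
  have : (-(Complex.I / h * s)).re = s.im / h := by
    rw [div_mul_eq_mul_div, Complex.neg_re, Complex.div_ofReal_re]
    simp [neg_div]
  rw [this, abs_div, abs_of_pos hh]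
  gcongr

theorem exists_norm_mbFactor_le {δ₁ : ℝ} (hδ : 0 < δ₁) (δ₂ : ℝ) : ∃ C : ℝ, 0 < C ∧ ∃ M : ℕ,
    ∀ s : ℂ, δ₁ ≤ s.im → s.im ≤ δ₂ → ‖mbFactor h s‖ ≤
      C * (1 + |s.re|) ^ M * Real.exp (-(Real.pi / (2 * h)) * |s.re|) := by
  obtain ⟨C, hC, M, H⟩ := exists_norm_Gamma_le (a := δ₁ / h) (by positivity) (δ₂ / h)
  refine ⟨Real.exp (|Real.log h| * (δ₂ / h)) * C * (1 + h⁻¹) ^ M, by positivity, M,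
    fun s h1 h2 => ?_⟩
  have h3 := H (s / (Complex.I * h)) (by rw [div_I_mul_re hh]; gcongr)
    (by rw [div_I_mul_re hh]; gcongr)
  rw [div_I_mul_im hh] at h3
  rw [mbFactor, norm_mul]
  calc _ ≤ Real.exp (|Real.log h| * (δ₂ / h)) *
        (C * ((1 + h⁻¹) * (1 + |s.re|)) ^ M * Real.exp (-(Real.pi / 2 * |-(s.re / h)|))) := by
        gcongr
        · exact norm_hbar_cpow_le hh (by rw [abs_of_nonneg (by linarith)]; exact h2)
        · refine h3.trans ?_
          gcongr
          exact one_add_abs_div_le hh _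
    _ = _ := by
        rw [abs_neg, abs_div, abs_of_pos hh, mul_pow]
        have : -(Real.pi / 2 * (|s.re| / h)) = -(Real.pi / (2 * h)) * |s.re| := by
          field_simp
        rw [this]; ring

/-- Here the argument `w` is purely imaginary, and `1/Γ(w) = w/Γ(1 + w)` brings it to the strip
already treated, at the cost of one power. -/
theorem exists_norm_inv_Gamma_le : ∃ C : ℝ, 0 < C ∧ ∃ M : ℕ, ∀ x : ℝ,
    ‖(Complex.Gamma ((x : ℂ) / (Complex.I * h)))⁻¹‖ ≤
      C * (1 + |x|) ^ M * Real.exp (Real.pi / (2 * h) * |x|) := by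
  obtain ⟨C, hC, M, H⟩ := exists_norm_inv_Gamma_one_add_le
  refine ⟨C * (1 + h⁻¹) ^ (M + 1), by positivity, M + 1, fun x => ?_⟩
  set w := (x : ℂ) / (Complex.I * h) with hw
  have e1 : w.re = 0 := by rw [hw, div_I_mul_re hh]; simp
  have e2 : w.im = -(x / h) := by rw [hw, div_I_mul_im hh]; simp
  have h3 := H w (by rw [e1]; norm_num)
  rw [e2] at h3
  have e3 : (Complex.Gamma w)⁻¹ = w * (Complex.Gamma (1 + w))⁻¹ := by
    rcases eq_or_ne w 0 with h0 | h0
    · simp [h0]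
    · rw [add_comm, Complex.Gamma_add_one _ h0, mul_inv, ← mul_assoc, mul_inv_cancel₀ h0, one_mul]
  have e4 : ‖w‖ ≤ 1 + |-(x / h)| := by
    have := Complex.norm_le_abs_re_add_abs_im w
    rw [e1, e2, abs_zero] at this
    linarith
  rw [e3, norm_mul]
  have e5 := one_add_abs_div_le hh x
  calc _ ≤ (1 + |-(x / h)|) * (C * (1 + |-(x / h)|) ^ M * Real.exp (Real.pi / 2 * |-(x / h)|)) := by
        gcongr
    _ = C * (1 + |-(x / h)|) ^ (M + 1) * Real.exp (Real.pi / 2 * |-(x / h)|) := by ring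
    _ ≤ C * ((1 + h⁻¹) * (1 + |x|)) ^ (M + 1) * Real.exp (Real.pi / 2 * |-(x / h)|) := by gcongr
    _ = _ := by
        rw [abs_neg, abs_div, abs_of_pos hh, mul_pow]
        have : Real.pi / 2 * (|x| / h) = Real.pi / (2 * h) * |x| := by field_simp
        rw [this]; ring

/-- The imaginary part of `z` displaces `v_b - u_a` by at most `|θ|`, which costs only a factor
bounded in `u` and `v`. The real part keeps the arguments at height at least `δ₁`, away from the
poles. -/
theorem exists_norm_crossGamma_le (n : ℕ) {δ₁ : ℝ} (hδ : 0 < δ₁) (δ₂ θ : ℝ) :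
    ∃ C : ℝ, 0 < C ∧ ∃ M : ℕ, ∀ (z : ℂ) (u : Fin n → ℝ) (v : Fin (n + 1) → ℝ),
      δ₁ ≤ z.re → z.re ≤ δ₂ → |z.im| ≤ θ → ‖crossGamma h z u v‖ ≤
        C * ((1 + ‖u‖) * (1 + ‖v‖)) ^ M * Real.exp (-(Real.pi / (2 * h)) * crossDist u v) := by
  obtain ⟨C, hC, M, H⟩ := exists_norm_mbFactor_le hh hδ δ₂
  set κ := Real.pi / (2 * h) with hκ
  have κpos : 0 < κ := by positivity
  set c := (Finset.univ.sigma fun _ : Fin n => (Finset.univ : Finset (Fin (n + 1)))).card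
  refine ⟨(C * Real.exp (κ * |θ|) * (1 + |θ|) ^ M) ^ c, by positivity, M * c, fun z u v h1 h2 h3 => ?_⟩
  have key : ‖crossGamma h z u v‖ ≤ ((C * Real.exp (κ * |θ|) * (1 + |θ|) ^ M) *
      (1 + (‖u‖ + ‖v‖)) ^ M) ^ c * Real.exp (-κ * crossDist u v) := by
    refine norm_prod_prod_le_of_exp_bound (fun _ => Finset.univ)
      (f := fun a b => mbFactor h ((v b : ℂ) - u a + Complex.I * z))
      (x := fun a b => |v b - u a|) fun a b _ => ?_
    have r1 : ((v b : ℂ) - u a + Complex.I * z).re = v b - u a - z.im := by simp; ring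
    have r2 : ((v b : ℂ) - u a + Complex.I * z).im = z.re := by simp
    refine (H _ (by rw [r2]; exact h1) (by rw [r2]; exact h2)).trans ?_
    rw [r1]
    have i0 := abs_sub_le_norm_add_norm u v a b
    have h3' : |z.im| ≤ |θ| := h3.trans (le_abs_self _)
    have i1 : |v b - u a - z.im| ≤ |v b - u a| + |θ| := (abs_sub _ _).trans (by gcongr)
    have i2 : |v b - u a| - |θ| ≤ |v b - u a - z.im| :=
      le_trans (by gcongr) (abs_sub_abs_le_abs_sub _ _)
    have i3 : 1 + |v b - u a - z.im| ≤ (1 + |θ|) * (1 + (‖u‖ + ‖v‖)) := by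
      nlinarith [abs_nonneg θ, norm_nonneg u, norm_nonneg v]
    calc _ ≤ C * ((1 + |θ|) * (1 + (‖u‖ + ‖v‖))) ^ M *
          Real.exp (κ * |θ| + -κ * |v b - u a|) := by
          gcongr ?_ * ?_
          · gcongr
          · refine Real.exp_le_exp.2 ?_
            nlinarith
      _ = _ := by rw [Real.exp_add, mul_pow]; ring
  refine key.trans ?_
  rw [mul_pow, ← pow_mul]
  gcongr
  nlinarith [norm_nonneg u, norm_nonneg v]

theorem exists_norm_halfDensity_le (n : ℕ) : ∃ C : ℝ, 0 < C ∧ ∃ M : ℕ, ∀ u : Fin n → ℝ,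
    ‖halfDensity h u‖ ≤ C * (1 + ‖u‖) ^ M * Real.exp (Real.pi / (2 * h) * (spread u / 2)) ∧
    ‖halfDensity' h u‖ ≤ C * (1 + ‖u‖) ^ M * Real.exp (Real.pi / (2 * h) * (spread u / 2)) := by
  obtain ⟨C, hC, M, H⟩ := exists_norm_inv_Gamma_le hh
  set c := (Finset.univ.sigma fun a : Fin n => Finset.Ioi a).card
  have key : ∀ u : Fin n → ℝ, ∀ a b, (1 + |u a - u b|) ^ M ≤ 2 ^ M * (1 + ‖u‖) ^ M := fun u a b => by
    rw [← mul_pow]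
    gcongr
    linarith [abs_sub_le_two_mul_norm u a b]
  refine ⟨(C * 2 ^ M) ^ c, by positivity, M * c, fun u => ⟨?_, ?_⟩⟩
  all_goals
    rw [← sum_Ioi_abs_sub, pow_mul, ← mul_pow]
    refine norm_prod_prod_le_of_exp_bound (fun a => Finset.Ioi a) fun a b _ => ?_
    rw [mul_assoc C]
  · have := H (u a - u b)
    push_cast at this
    refine this.trans ?_
    gcongr
    exact key u a b
  · have := H (u b - u a)
    push_cast at this
    rw [abs_sub_comm] at this
    refine this.trans ?_
    gcongr
    exact key u a b

/-- The kernel of one step of the induction, weighted by its natural exponential growth, decays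
in `u` faster than any power, with polynomial growth in `v`. -/
theorem exists_crossGamma_decay (n : ℕ) {δ₁ : ℝ} (hδ : 0 < δ₁) (δ₂ θ : ℝ) (k : ℕ) :
    ∃ C : ℝ, 0 < C ∧ ∃ M : ℕ, ∀ (z : ℂ) (u : Fin n → ℝ) (v : Fin (n + 1) → ℝ),
      δ₁ ≤ z.re → z.re ≤ δ₂ → |z.im| ≤ θ → (1 + ‖u‖) ^ k *
        (Real.exp (Real.pi / (2 * h) * (spread u / 2)) *
          Real.exp (Real.pi / (2 * h) * (spread v / 2)) * ‖crossGamma h z u v‖) ≤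
        C * (1 + ‖v‖) ^ M := by
  obtain ⟨C, hC, M, H⟩ := exists_norm_crossGamma_le hh n hδ δ₂ θ
  -- The extra `M` pays for the polynomial growth in `u` of the bound on `crossGamma`.
  obtain ⟨C', hC', H'⟩ := exists_exp_interlacing_le (κ := Real.pi / (2 * h)) (by positivity) (k + M)
  refine ⟨C * C', by positivity, M + (k + M), fun z u v h1 h2 h3 => ?_⟩
  have := H' u v
  set κ := Real.pi / (2 * h) with hκ
  calc _ ≤ (1 + ‖u‖) ^ k * (Real.exp (κ * (spread u / 2)) * Real.exp (κ * (spread v / 2)) *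
        (C * ((1 + ‖u‖) * (1 + ‖v‖)) ^ M * Real.exp (-κ * crossDist u v))) := by
        gcongr; exact H z u v h1 h2 h3
    _ = C * (1 + ‖v‖) ^ M * ((1 + ‖u‖) ^ (k + M) *
        Real.exp (κ * (spread u / 2 + spread v / 2 - crossDist u v))) := by
        rw [show κ * (spread u / 2 + spread v / 2 - crossDist u v) = κ * (spread u / 2) +
          κ * (spread v / 2) + -κ * crossDist u v by ring, Real.exp_add, Real.exp_add,
          mul_pow]
        ring
    _ ≤ C * (1 + ‖v‖) ^ M * (C' * (1 + ‖v‖) ^ (k + M)) := by gcongr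
    _ = _ := by ring

end Bounds

/-! ### The kernel at real spectral parameters and its behaviour under translations. -/

/-- The kernel `φ_v(x)` at real spectral parameters. -/
noncomputable def realKernel (h : ℝ) (n : ℕ) (α : ℕ → ℝ) (v : Fin n → ℝ) (x : Fin n → ℝ) : ℂ :=
  whittakerKernel h n α (contourPoint 0 v) x

/-- The contours seen from the outermost one. -/
def shiftSeq (α : ℕ → ℝ) (s : ℕ) : ℝ := α (s + 1) - α 0

theorem shiftSeq_pos {α : ℕ → ℝ} (hα : StrictMono α) : 0 < shiftSeq α 0 :=
  sub_pos.2 (hα (Nat.lt_succ_self 0))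

theorem shiftSeq_strictMono {α : ℕ → ℝ} (hα : StrictMono α) : StrictMono (shiftSeq α) :=
  fun _ _ hab => sub_lt_sub_right (hα (Nat.succ_lt_succ hab)) _

/-- The plane wave factor of one step of the induction. -/
noncomputable def stepPhase (h : ℝ) {n : ℕ} (z : ℂ) (x : Fin (n + 1) → ℝ) (u : Fin n → ℝ)
    (v : Fin (n + 1) → ℝ) : ℂ :=
  Complex.exp (Complex.I / h * (((∑ b, v b - ∑ a, u a : ℝ) : ℂ) + n * Complex.I * z) *
    (x (Fin.last n) : ℂ) + z / h * ((∑ a : Fin n, x a.castSucc : ℝ) : ℂ))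

theorem sum_contourPoint {n : ℕ} (β : ℝ) (u : Fin n → ℝ) :
    ∑ a, contourPoint β u a = ((∑ a, u a : ℝ) : ℂ) - n * Complex.I * β := by
  simp [contourPoint, Finset.sum_sub_distrib, mul_assoc]

/-- Lowering the spectral parameters and the contour together by `γ` changes the integrand only by
`exp(γ ∑ x / ħ)`. The functions `φ` and `ψ` stand for inner kernels with two families of contours,
both reduced to the same `K` at real parameters. -/
theorem mbIntegrand_contourPoint_of_translation (h β γ : ℝ) {n : ℕ}
    {φ ψ : (Fin n → ℂ) → (Fin n → ℝ) → ℂ} {x : Fin (n + 1) → ℝ} {u : Fin n → ℝ} {K : ℂ}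
    (hφ : φ (contourPoint β u) (fun a => x a.castSucc) =
      Complex.exp (β / h * ((∑ a : Fin n, x a.castSucc : ℝ) : ℂ)) * K)
    (hψ : ψ (contourPoint (β - γ) u) (fun a => x a.castSucc) =
      Complex.exp ((β - γ : ℝ) / h * ((∑ a : Fin n, x a.castSucc : ℝ) : ℂ)) * K)
    (v : Fin (n + 1) → ℝ) :
    mbIntegrand h φ β (contourPoint γ v) x u =
      Complex.exp (γ / h * ((∑ a, x a : ℝ) : ℂ)) *
        mbIntegrand h ψ (β - γ) (contourPoint 0 v) x u := by
  rw [mbIntegrand, mbIntegrand, hφ, hψ, mbWeight_contourPoint, mbWeight_contourPoint,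
    sum_contourPoint, sum_contourPoint, sum_contourPoint, sum_contourPoint, sub_zero]
  have e : Complex.exp (Complex.I / h * ((((∑ a, v a : ℝ) : ℂ) - (n + 1 : ℕ) * Complex.I * γ) -
        (((∑ a, u a : ℝ) : ℂ) - n * Complex.I * β)) * (x (Fin.last n) : ℝ)) *
        Complex.exp (β / h * ((∑ a : Fin n, x a.castSucc : ℝ) : ℂ)) =
      Complex.exp (γ / h * ((∑ a, x a : ℝ) : ℂ)) *
        (Complex.exp (Complex.I / h * ((((∑ a, v a : ℝ) : ℂ) - (n + 1 : ℕ) * Complex.I * (0 : ℝ)) -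
        (((∑ a, u a : ℝ) : ℂ) - n * Complex.I * (β - γ : ℝ))) * (x (Fin.last n) : ℝ)) *
        Complex.exp ((β - γ : ℝ) / h * ((∑ a : Fin n, x a.castSucc : ℝ) : ℂ))) := by
    rw [← Complex.exp_add, ← Complex.exp_add, ← Complex.exp_add, Fin.sum_univ_castSucc x]
    congr 1
    push_cast
    linear_combination (-(γ * (x (Fin.last n) : ℂ) / h)) * Complex.I_sq
  rw [← mul_assoc (Complex.exp _) (Complex.exp _) K, e]
  ring

/-- Parameters on a horizontal line can be made real by measuring all contours from that line. In
the induction both sides involve the same inner kernel, since `shiftSeq` is unchanged when a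
constant is subtracted from `α`. -/
theorem whittakerKernel_contourPoint (h : ℝ) (n : ℕ) : ∀ (α : ℕ → ℝ) (γ : ℝ) (v x : Fin n → ℝ),
    whittakerKernel h n α (contourPoint γ v) x =
      Complex.exp (γ / h * ((∑ a, x a : ℝ) : ℂ)) * realKernel h n (fun s => α s - γ) v x := by
  induction n with
  | zero => intro α γ v x; simp [whittakerKernel, realKernel]
  | succ n ih =>
    intro α γ v x
    rw [realKernel, whittakerKernel, whittakerKernel, ← integral_const_mul]
    refine integral_congr_ae (Filter.Eventually.of_forall fun u => ?_)
    refine mbIntegrand_contourPoint_of_translation h (α 0) γ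
      (K := realKernel h n (shiftSeq α) u fun a => x a.castSucc) (ih _ _ _ _) ?_ v
    rw [ih]
    congr 2
    funext s
    simp [shiftSeq]

/-- The integrand of one step of the induction at real spectral parameters, with the kernel in `n`
variables replaced by `K`, and with a complex contour shift `z`. -/
noncomputable def stepIntegrand (h : ℝ) {n : ℕ} (K : (Fin n → ℝ) → ℂ) (z : ℂ) (x : Fin (n + 1) → ℝ)
    (u : Fin n → ℝ) (v : Fin (n + 1) → ℝ) : ℂ :=
  stepPhase h z x u v * K u * (crossGamma h z u v * (halfDensity h u * halfDensity' h u)) /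
    ((n.factorial : ℂ) * (2 * (Real.pi : ℂ) * (h : ℂ)) ^ n)

theorem mbIntegrand_real (h : ℝ) {n : ℕ} (α : ℕ → ℝ) (v x : Fin (n + 1) → ℝ) (u : Fin n → ℝ) :
    mbIntegrand h (whittakerKernel h n fun s => α (s + 1)) (α 0) (contourPoint 0 v) x u =
      stepIntegrand h (fun u => realKernel h n (shiftSeq α) u fun a => x a.castSucc) (α 0) x u v := by
  rw [mbIntegrand, whittakerKernel_contourPoint, mbWeight_contourPoint, stepIntegrand, stepPhase,
    sum_contourPoint, sum_contourPoint, Complex.exp_add, sub_zero]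
  rw [show (((∑ a, v a : ℝ) : ℂ) - (n + 1 : ℕ) * Complex.I * (0 : ℝ)) -
        (((∑ a, u a : ℝ) : ℂ) - n * Complex.I * (α 0 : ℝ)) =
        (((∑ b, v b - ∑ a, u a : ℝ) : ℂ) + n * Complex.I * (α 0 : ℝ)) by push_cast; ring]
  rw [show shiftSeq α = fun s => α (s + 1) - α 0 from rfl]
  ring

theorem realKernel_succ (h : ℝ) (n : ℕ) (α : ℕ → ℝ) (v x : Fin (n + 1) → ℝ) :
    realKernel h (n + 1) α v x = ∫ u, stepIntegrand h
      (fun u => realKernel h n (shiftSeq α) u fun a => x a.castSucc) (α 0) x u v :=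
  integral_congr_ae (Filter.Eventually.of_forall fun u => mbIntegrand_real h α v x u)

theorem crossGamma_translate (h : ℝ) {n : ℕ} (z : ℂ) (u : Fin n → ℝ) (v : Fin (n + 1) → ℝ) (θ : ℝ) :
    crossGamma h z (fun a => u a + θ) (fun b => v b + θ) = crossGamma h z u v := by
  simp [crossGamma]

theorem halfDensity_translate (h : ℝ) {n : ℕ} (u : Fin n → ℝ) (θ : ℝ) :
    halfDensity h (fun a => u a + θ) = halfDensity h u := by
  simp [halfDensity]

theorem halfDensity'_translate (h : ℝ) {n : ℕ} (u : Fin n → ℝ) (θ : ℝ) :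
    halfDensity' h (fun a => u a + θ) = halfDensity' h u := by
  simp [halfDensity']

/-- A common real translation of the integration variables compensates that of the parameters at
every level. This equivariance later makes the contour integral invariant under vertical
displacements of its depth. -/
theorem realKernel_translate (h : ℝ) (n : ℕ) : ∀ (α : ℕ → ℝ) (v x : Fin n → ℝ) (θ : ℝ),
    realKernel h n α (fun a => v a + θ) x =
      Complex.exp (Complex.I * θ / h * ((∑ a, x a : ℝ) : ℂ)) * realKernel h n α v x := by
  induction n with
  | zero => intro α v x θ; simp [whittakerKernel, realKernel]
  | succ n ih =>
    intro α v x θ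
    rw [realKernel_succ, realKernel_succ, ← integral_const_mul,
      ← integral_add_right_eq_self _ (fun _ : Fin n => θ)]
    refine integral_congr_ae (Filter.Eventually.of_forall fun u => ?_)
    have e : (u + fun _ => θ) = fun a => u a + θ := rfl
    simp only [stepIntegrand, e]
    rw [crossGamma_translate, halfDensity_translate, halfDensity'_translate, ih]
    have e2 : stepPhase h (α 0) x (fun a => u a + θ) (fun b => v b + θ) *
        Complex.exp (Complex.I * θ / h * ((∑ a : Fin n, x a.castSucc : ℝ) : ℂ)) =
        Complex.exp (Complex.I * θ / h * ((∑ a, x a : ℝ) : ℂ)) * stepPhase h (α 0) x u v := by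
      rw [stepPhase, stepPhase, ← Complex.exp_add, ← Complex.exp_add]
      congr 1
      simp only [Finset.sum_add_distrib, Finset.sum_const, Finset.card_univ, Fintype.card_fin,
        nsmul_eq_mul]
      rw [Fin.sum_univ_castSucc x]
      push_cast
      ring
    rw [← mul_assoc (stepPhase _ _ _ _ _), e2]
    ring

/-! ### Growth of the kernels and absolute convergence. -/

section Bounds
variable {h : ℝ} (hh : 0 < h)

/-- The modulus involves neither `u` nor `v` nor `Im z`, so for fixed `x` the plane wave is harmless
in every estimate. -/
theorem norm_stepPhase (h : ℝ) {n : ℕ} (z : ℂ) (x : Fin (n + 1) → ℝ) (u : Fin n → ℝ)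
    (v : Fin (n + 1) → ℝ) : ‖stepPhase h z x u v‖ =
      Real.exp (z.re / h * (∑ a : Fin n, x a.castSucc - n * x (Fin.last n))) := by
  rw [stepPhase, Complex.norm_exp]
  congr 1
  rw [Complex.add_re, Complex.re_mul_ofReal, Complex.re_mul_ofReal, div_mul_eq_mul_div,
    Complex.div_ofReal_re, Complex.div_ofReal_re, mul_add, Complex.add_re]
  rw [show Complex.I * (n * Complex.I * z) = ((-n : ℝ) : ℂ) * z by
    push_cast; linear_combination (n * z) * Complex.I_sq]
  rw [Complex.re_ofReal_mul, mul_comm Complex.I, Complex.re_ofReal_mul, Complex.I_re]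
  ring

theorem continuous_stepPhase (h : ℝ) {n : ℕ} (x : Fin (n + 1) → ℝ) :
    Continuous fun p : ℂ × (Fin n → ℝ) × (Fin (n + 1) → ℝ) => stepPhase h p.1 x p.2.1 p.2.2 := by
  unfold stepPhase; fun_prop

include hh

theorem differentiableAt_mbFactor {s : ℂ} (hs : 0 < s.im) : DifferentiableAt ℂ (mbFactor h) s := by
  unfold mbFactor
  have h0 : (h : ℂ) ≠ 0 := by exact_mod_cast hh.ne'
  refine DifferentiableAt.mul ?_ ?_
  · exact (DifferentiableAt.const_cpow (by fun_prop) (Or.inl h0))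
  · refine DifferentiableAt.comp s (Complex.differentiableAt_Gamma _ fun m hm => ?_) (by fun_prop)
    have := congrArg Complex.re hm
    rw [div_I_mul_re hh] at this
    simp at this
    have h1 : 0 < s.im / h := by positivity
    have h2 : (0 : ℝ) ≤ m := m.cast_nonneg
    linarith

theorem continuousOn_crossGamma (n : ℕ) :
    ContinuousOn (fun p : ℂ × (Fin n → ℝ) × (Fin (n + 1) → ℝ) => crossGamma h p.1 p.2.1 p.2.2)
      {p | 0 < p.1.re} := by
  unfold crossGamma
  refine continuousOn_finsetProd _ fun a _ => continuousOn_finsetProd _ fun b _ => ?_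
  intro p hp
  refine ContinuousAt.continuousWithinAt ?_
  refine ContinuousAt.comp (f := fun p : ℂ × (Fin n → ℝ) × (Fin (n + 1) → ℝ) =>
    ((p.2.2 b : ℂ) - p.2.1 a + Complex.I * p.1)) (g := mbFactor h) ?_ ?_
  · exact (differentiableAt_mbFactor hh (by simpa using hp)).continuousAt
  · exact Continuous.continuousAt (by fun_prop)

theorem continuous_crossGamma (n : ℕ) {z : ℂ} (hz : 0 < z.re) :
    Continuous fun p : (Fin n → ℝ) × (Fin (n + 1) → ℝ) => crossGamma h z p.1 p.2 :=
  (continuousOn_crossGamma hh n).comp_continuous (f := fun p => (z, p)) (by fun_prop) fun _ => hz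

omit hh in
theorem continuous_halfDensity (h : ℝ) (n : ℕ) : Continuous fun u : Fin n → ℝ => halfDensity h u := by
  unfold halfDensity
  refine continuous_finsetProd _ fun a _ => continuous_finsetProd _ fun b _ => ?_
  exact Complex.differentiable_one_div_Gamma.continuous.comp (by fun_prop :
    Continuous fun u : Fin n → ℝ => ((u a : ℂ) - u b) / (Complex.I * h))

omit hh in
theorem continuous_halfDensity' (h : ℝ) (n : ℕ) :
    Continuous fun u : Fin n → ℝ => halfDensity' h u := by
  unfold halfDensity'
  refine continuous_finsetProd _ fun a _ => continuous_finsetProd _ fun b _ => ?_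
  exact Complex.differentiable_one_div_Gamma.continuous.comp (by fun_prop :
    Continuous fun u : Fin n → ℝ => ((u b : ℂ) - u a) / (Complex.I * h))

/-- A kernel with the natural exponential decay of the Whittaker functions. -/
def IsWhittakerBounded (h : ℝ) {n : ℕ} (K : (Fin n → ℝ) → ℂ) : Prop :=
  Measurable K ∧ ∃ C : ℝ, 0 < C ∧ ∃ M : ℕ, ∀ v,
    ‖K v‖ * Real.exp (Real.pi / (2 * h) * (spread v / 2)) ≤ C * (1 + ‖v‖) ^ M

theorem measurable_stepIntegrand {n : ℕ} {K : (Fin n → ℝ) → ℂ} (hK : Measurable K) {z : ℂ}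
    (hz : 0 < z.re) (x : Fin (n + 1) → ℝ) :
    Measurable fun p : (Fin n → ℝ) × (Fin (n + 1) → ℝ) => stepIntegrand h K z x p.1 p.2 := by
  unfold stepIntegrand
  have h1 : Measurable fun p : (Fin n → ℝ) × (Fin (n + 1) → ℝ) => stepPhase h z x p.1 p.2 :=
    ((continuous_stepPhase h x).comp (by fun_prop : Continuous fun p :
      (Fin n → ℝ) × (Fin (n + 1) → ℝ) => (z, p.1, p.2))).measurable
  have h2 := (continuous_crossGamma hh n hz).measurable
  have h3 := (continuous_halfDensity h n).measurable
  have h4 := (continuous_halfDensity' h n).measurable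
  exact ((h1.mul (hK.comp measurable_fst)).mul (h2.mul ((h3.comp measurable_fst).mul
    (h4.comp measurable_fst)))).div_const _

/-- Balance of exponentials in `u`: `K` contributes `-κ spread u / 2` and the two half densities `+κ
spread u / 2` each. The net growth, together with the weight in `v`, is what
`exists_crossGamma_decay` absorbs. -/
theorem exists_stepIntegrand_decay {n : ℕ} {K : (Fin n → ℝ) → ℂ} (hK : IsWhittakerBounded h K)
    {δ₁ : ℝ} (hδ : 0 < δ₁) (δ₂ θ : ℝ) (x : Fin (n + 1) → ℝ) (k : ℕ) :
    ∃ C : ℝ, 0 < C ∧ ∃ M : ℕ, ∀ (z : ℂ) (u : Fin n → ℝ) (v : Fin (n + 1) → ℝ),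
      δ₁ ≤ z.re → z.re ≤ δ₂ → |z.im| ≤ θ → (1 + ‖u‖) ^ k *
        (Real.exp (Real.pi / (2 * h) * (spread v / 2)) * ‖stepIntegrand h K z x u v‖) ≤
        C * (1 + ‖v‖) ^ M := by
  obtain ⟨C₁, hC₁, M₁, H₁⟩ := hK.2
  obtain ⟨C₂, hC₂, M₂, H₂⟩ := exists_norm_halfDensity_le hh n
  obtain ⟨C₃, hC₃, M₃, H₃⟩ := exists_crossGamma_decay hh n hδ δ₂ θ (k + M₁ + M₂ + M₂)
  set κ := Real.pi / (2 * h)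
  set X := |∑ a : Fin n, x a.castSucc - n * x (Fin.last n)|
  set c := ‖((n.factorial : ℂ) * (2 * (Real.pi : ℂ) * (h : ℂ)) ^ n)‖⁻¹
  have hc : 0 < c := by
    refine inv_pos.2 (norm_pos_iff.2 (mul_ne_zero ?_ (pow_ne_zero _ ?_)))
    · exact_mod_cast n.factorial_ne_zero
    · exact_mod_cast (by positivity : (2 * Real.pi * h) ≠ 0)
  refine ⟨Real.exp (δ₂ / h * X) * C₁ * C₂ * C₂ * c * C₃, by positivity, M₃,
    fun z u v h1 h2 h3 => ?_⟩
  have i1 := H₁ u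
  obtain ⟨i2, i3⟩ := H₂ u
  have i4 := H₃ z u v h1 h2 h3
  have i5 : ‖stepPhase h z x u v‖ ≤ Real.exp (δ₂ / h * X) := by
    rw [norm_stepPhase]
    refine Real.exp_le_exp.2 ?_
    have : 0 < z.re := by linarith
    calc _ ≤ z.re / h * X := by gcongr; exact le_abs_self _
      _ ≤ _ := by gcongr
  have i1' : ‖K u‖ * Real.exp (κ * (spread u / 2)) * Real.exp (κ * (spread u / 2)) ≤
      C₁ * (1 + ‖u‖) ^ M₁ * Real.exp (κ * (spread u / 2)) := by gcongr
  have e : ‖stepIntegrand h K z x u v‖ = ‖stepPhase h z x u v‖ * ‖K u‖ *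
      (‖crossGamma h z u v‖ * (‖halfDensity h u‖ * ‖halfDensity' h u‖)) * c := by
    rw [stepIntegrand, norm_div, norm_mul, norm_mul, norm_mul, norm_mul, div_eq_mul_inv]
  rw [e]
  calc _ ≤ (1 + ‖u‖) ^ k * (Real.exp (κ * (spread v / 2)) *
        (Real.exp (δ₂ / h * X) * ‖K u‖ * (‖crossGamma h z u v‖ *
          ((C₂ * (1 + ‖u‖) ^ M₂ * Real.exp (κ * (spread u / 2))) *
          (C₂ * (1 + ‖u‖) ^ M₂ * Real.exp (κ * (spread u / 2))))) * c)) := by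
        gcongr
    _ = (1 + ‖u‖) ^ (k + M₂ + M₂) * Real.exp (δ₂ / h * X) * C₂ * C₂ * c * Real.exp (κ * (spread v / 2)) *
          ‖crossGamma h z u v‖ *
          (‖K u‖ * Real.exp (κ * (spread u / 2)) * Real.exp (κ * (spread u / 2))) := by ring
    _ ≤ (1 + ‖u‖) ^ (k + M₂ + M₂) * Real.exp (δ₂ / h * X) * C₂ * C₂ * c * Real.exp (κ * (spread v / 2)) *
          ‖crossGamma h z u v‖ * (C₁ * (1 + ‖u‖) ^ M₁ * Real.exp (κ * (spread u / 2))) := by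
        gcongr
    _ = Real.exp (δ₂ / h * X) * C₁ * C₂ * C₂ * c * ((1 + ‖u‖) ^ (k + M₁ + M₂ + M₂) *
        (Real.exp (κ * (spread u / 2)) * Real.exp (κ * (spread v / 2)) * ‖crossGamma h z u v‖)) := by
        ring
    _ ≤ Real.exp (δ₂ / h * X) * C₁ * C₂ * C₂ * c * (C₃ * (1 + ‖v‖) ^ M₃) := by gcongr
    _ = _ := by ring

theorem integrable_stepIntegrand {n : ℕ} {K : (Fin n → ℝ) → ℂ} (hK : IsWhittakerBounded h K)
    {δ : ℝ} (hδ : 0 < δ) (x v : Fin (n + 1) → ℝ) :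
    Integrable fun u => stepIntegrand h K δ x u v := by
  -- The power `n + 1` exceeds the dimension of the space of `u`, which makes the bound integrable.
  obtain ⟨C, hC, M, H⟩ := exists_stepIntegrand_decay hh hK hδ δ 0 x (n + 1)
  refine integrable_of_decay (k := n + 1) (by simp) volume
    ((measurable_stepIntegrand hh hK.1 (by simpa using hδ) x).comp
      (measurable_prodMk_right (y := v))).aestronglyMeasurable (B := C * (1 + ‖v‖) ^ M) fun u => ?_
  refine le_trans ?_ (H δ u v (by simp) (by simp) (by simp))
  gcongr
  refine le_mul_of_one_le_left (norm_nonneg _) (Real.one_le_exp ?_)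
  have : 0 ≤ spread v := Finset.sum_nonneg fun _ _ => Finset.sum_nonneg fun _ _ => abs_nonneg _
  positivity

/-- The exponential weight in `v` does not depend on `u`, so it passes under the integral. This
closes the induction on the class of kernels. -/
theorem isWhittakerBounded_integral_stepIntegrand {n : ℕ} {K : (Fin n → ℝ) → ℂ}
    (hK : IsWhittakerBounded h K) {δ : ℝ} (hδ : 0 < δ) (x : Fin (n + 1) → ℝ) :
    IsWhittakerBounded h fun v => ∫ u, stepIntegrand h K δ x u v := by
  refine ⟨?_, ?_⟩
  · exact (((measurable_stepIntegrand hh hK.1 (z := δ) (by simpa using hδ) x).comp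
      measurable_swap).stronglyMeasurable.integral_prod_right').measurable
  · obtain ⟨C, hC, M, H⟩ := exists_stepIntegrand_decay hh hK hδ δ 0 x (n + 1)
    set B := ∫ u : Fin n → ℝ, ((1 + ‖u‖) ^ (n + 1))⁻¹
    have hB : 0 ≤ B := integral_nonneg fun u => by positivity
    refine ⟨C * (B + 1), by positivity, M, fun v => ?_⟩
    have := norm_integral_le_of_decay (k := n + 1) (by simp) volume
      (f := fun u => (Real.exp (Real.pi / (2 * h) * (spread v / 2)) : ℂ) * stepIntegrand h K δ x u v)
      (B := C * (1 + ‖v‖) ^ M) fun u => by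
        rw [norm_mul, Complex.norm_real, Real.norm_of_nonneg (Real.exp_pos _).le]
        exact H δ u v (by simp) (by simp) (by simp)
    rw [integral_const_mul, norm_mul, Complex.norm_real,
      Real.norm_of_nonneg (Real.exp_pos _).le] at this
    rw [mul_comm]
    refine this.trans ?_
    rw [mul_right_comm]
    gcongr
    linarith

theorem isWhittakerBounded_realKernel (n : ℕ) : ∀ (α : ℕ → ℝ) (x : Fin n → ℝ), 0 < α 0 →
    StrictMono α → IsWhittakerBounded h fun v => realKernel h n α v x := by
  induction n with
  | zero =>
    intro α x _ _
    refine ⟨by simp [realKernel, whittakerKernel], 1, one_pos, 0, fun v => ?_⟩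
    simp [realKernel, whittakerKernel, spread]
  | succ n ih =>
    intro α x h0 hα
    simp only [realKernel_succ]
    exact isWhittakerBounded_integral_stepIntegrand hh
      (ih _ _ (shiftSeq_pos hα) (shiftSeq_strictMono hα)) h0 x

/-- Inner kernels are evaluated on the preceding contour, so the induction needs parameters on any
line above the first contour; translation reduces each integral to real parameters and depth `α 0 -
γ > 0`. -/
theorem kernelConverges_contourPoint (n : ℕ) : ∀ (α : ℕ → ℝ) (γ : ℝ) (v x : Fin n → ℝ), γ < α 0 →
    StrictMono α → KernelConverges h n α (contourPoint γ v) x := by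
  induction n with
  | zero => intro α γ v x _ _; trivial
  | succ n ih =>
    intro α γ v x h0 hα
    refine ⟨fun u => ih _ _ u _ (hα (Nat.lt_succ_self 0))
      (fun a b hab => hα (Nat.succ_lt_succ hab)), ?_⟩
    have key : ∀ u, mbIntegrand h (whittakerKernel h n fun s => α (s + 1)) (α 0) (contourPoint γ v) x u =
        Complex.exp (γ / h * ((∑ a, x a : ℝ) : ℂ)) * stepIntegrand h
          (fun u => realKernel h n (shiftSeq α) u fun a => x a.castSucc) ((α 0 - γ : ℝ) : ℂ) x u v := by
      intro u
      have := mbIntegrand_real h (fun s => α s - γ) v x u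
      have e : shiftSeq (fun s => α s - γ) = shiftSeq α := by funext s; simp [shiftSeq]
      rw [e] at this
      rw [← this]
      refine mbIntegrand_contourPoint_of_translation h (α 0) γ
        (K := realKernel h n (shiftSeq α) u fun a => x a.castSucc)
        (whittakerKernel_contourPoint h n _ _ _ _) ?_ v
      rw [whittakerKernel_contourPoint]
      congr 2
    rw [funext key]
    exact (integrable_stepIntegrand hh (isWhittakerBounded_realKernel hh n _ _ (shiftSeq_pos hα)
      (shiftSeq_strictMono hα)) (sub_pos.2 h0) x v).const_mul _

end Bounds

/-! ### Schwartz functions: products, and integration over some of the variables. -/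

section Schwartz
variable {E G F A X : Type} [NormedAddCommGroup E] [NormedSpace ℝ E]
  [NormedAddCommGroup G] [NormedSpace ℝ G] [NormedAddCommGroup F] [NormedSpace ℝ F]
  [NormedAddCommGroup A] [NormedSpace ℝ A] [NormedAddCommGroup X] [NormedSpace ℝ X]

theorem SchwartzMap.exists_one_add_pow_mul_iteratedFDeriv_le (f : 𝓢(E, F)) (k n : ℕ) :
    ∃ C : ℝ, 0 < C ∧ ∀ x, (1 + ‖x‖) ^ k * ‖iteratedFDeriv ℝ n f x‖ ≤ C := by
  refine ⟨max 1 (2 ^ k * (Finset.Iic (k, n)).sup (fun m => SchwartzMap.seminorm ℝ m.1 m.2) f),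
    by positivity, fun x => le_trans ?_ (le_max_right _ _)⟩
  exact SchwartzMap.one_add_le_sup_seminorm_apply (𝕜 := ℝ) (m := (k, n)) le_rfl le_rfl f x

theorem SchwartzMap.exists_one_add_pow_mul_le (f : 𝓢(E, F)) (k : ℕ) :
    ∃ C : ℝ, 0 < C ∧ ∀ x, (1 + ‖x‖) ^ k * ‖f x‖ ≤ C := by
  obtain ⟨C, hC, H⟩ := f.exists_one_add_pow_mul_iteratedFDeriv_le k 0
  exact ⟨C, hC, fun x => by simpa using H x⟩

/-- Joint decay of a Schwartz function in two groups of variables. -/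
theorem SchwartzMap.exists_prod_decay (f : 𝓢(E × G, F)) (k l : ℕ) :
    ∃ C : ℝ, 0 < C ∧ ∀ e y, (1 + ‖e‖) ^ k * ((1 + ‖y‖) ^ l * ‖f (e, y)‖) ≤ C := by
  obtain ⟨C, hC, H⟩ := f.exists_one_add_pow_mul_le (k + l)
  refine ⟨C, hC, fun e y => le_trans ?_ (H (e, y))⟩
  rw [← mul_assoc, pow_add]
  have h1 : ‖e‖ ≤ ‖(e, y)‖ := by simp [Prod.norm_def]
  have h2 : ‖y‖ ≤ ‖(e, y)‖ := by simp [Prod.norm_def]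
  gcongr

/-- Build a Schwartz function from bounds with the weight `(1 + ‖x‖) ^ k`. -/
theorem SchwartzMap.exists_of_bounds {f : E → F} (hf : ContDiff ℝ (⊤ : ℕ∞) f)
    (h : ∀ k n : ℕ, ∃ C : ℝ, ∀ x, (1 + ‖x‖) ^ k * ‖iteratedFDeriv ℝ n f x‖ ≤ C) :
    ∃ g : 𝓢(E, F), ∀ x, g x = f x := by
  refine ⟨⟨f, hf, fun k n => ?_⟩, fun x => rfl⟩
  obtain ⟨C, H⟩ := h k n
  refine ⟨C, fun x => le_trans ?_ (H x)⟩
  gcongr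
  linarith

/-- Product of a Schwartz function in some of the variables with a function which decays, together
with its derivatives, in the other variables. -/
theorem SchwartzMap.exists_mul_comp (f : 𝓢(A, ℂ)) (π : X →L[ℝ] A) {m : X → ℂ}
    (hm : ContDiff ℝ (⊤ : ℕ∞) m)
    (H : ∀ n k : ℕ, ∃ C : ℝ, ∃ M : ℕ, ∀ x, (1 + ‖x‖) ^ k * ‖iteratedFDeriv ℝ n m x‖ ≤
      C * (1 + ‖π x‖) ^ M) : ∃ g : 𝓢(X, ℂ), ∀ x, g x = m x * f (π x) := by
  have hfπ : ContDiff ℝ (⊤ : ℕ∞) (f ∘ π) := (f.smooth ⊤).comp π.contDiff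
  refine SchwartzMap.exists_of_bounds (hm.mul hfπ) fun k n => ?_
  have key : ∀ i : ℕ, ∃ B : ℝ, ∀ x, (1 + ‖x‖) ^ k * (‖iteratedFDeriv ℝ i m x‖ *
      ‖iteratedFDeriv ℝ (n - i) (f ∘ π) x‖) ≤ B := fun i => by
    obtain ⟨C, M, h1⟩ := H i k
    obtain ⟨C', hC', h2⟩ := f.exists_one_add_pow_mul_iteratedFDeriv_le M (n - i)
    refine ⟨|C| * (C' * ‖π‖ ^ (n - i)), fun x => ?_⟩
    have h3 : ‖iteratedFDeriv ℝ (n - i) (f ∘ π) x‖ ≤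
        ‖iteratedFDeriv ℝ (n - i) f (π x)‖ * ‖π‖ ^ (n - i) := by
      rw [π.iteratedFDeriv_comp_right (f.smooth ⊤) x (i := n - i)
        (WithTop.coe_le_coe.2 le_top)]
      refine (ContinuousMultilinearMap.norm_compContinuousLinearMap_le _ _).trans ?_
      simp
    calc _ = ((1 + ‖x‖) ^ k * ‖iteratedFDeriv ℝ i m x‖) * ‖iteratedFDeriv ℝ (n - i) (f ∘ π) x‖ := by
          ring
      _ ≤ (|C| * (1 + ‖π x‖) ^ M) * (‖iteratedFDeriv ℝ (n - i) f (π x)‖ * ‖π‖ ^ (n - i)) := by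
          refine mul_le_mul ((h1 x).trans ?_) h3 (norm_nonneg _) (by positivity)
          gcongr
          exact le_abs_self C
      _ = |C| * (((1 + ‖π x‖) ^ M * ‖iteratedFDeriv ℝ (n - i) f (π x)‖) * ‖π‖ ^ (n - i)) := by ring
      _ ≤ _ := by gcongr; exact h2 _
  choose B hB using key
  refine ⟨∑ i ∈ Finset.range (n + 1), (n.choose i : ℝ) * B i, fun x => ?_⟩
  have := norm_iteratedFDeriv_mul_le (n := n) hm hfπ x (WithTop.coe_le_coe.2 le_top)
  calc _ ≤ (1 + ‖x‖) ^ k * ∑ i ∈ Finset.range (n + 1), (n.choose i : ℝ) *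
        ‖iteratedFDeriv ℝ i m x‖ * ‖iteratedFDeriv ℝ (n - i) (f ∘ π) x‖ := by gcongr; exact this
    _ = ∑ i ∈ Finset.range (n + 1), (n.choose i : ℝ) * ((1 + ‖x‖) ^ k *
        (‖iteratedFDeriv ℝ i m x‖ * ‖iteratedFDeriv ℝ (n - i) (f ∘ π) x‖)) := by
        rw [Finset.mul_sum]; exact Finset.sum_congr rfl fun i _ => by ring
    _ ≤ _ := by gcongr with i; exact hB i x

section ParamIntegral
variable [FiniteDimensional ℝ G] [MeasurableSpace G] [BorelSpace G] (μ : Measure G)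
  [μ.IsAddHaarMeasure]

theorem SchwartzMap.integrable_weight_smul_slice (g : 𝓢(E × G, F)) {m : G → ℝ} (hm : Measurable m)
    {B : ℝ} {l : ℕ} (hB : ∀ y, |m y| ≤ B * (1 + ‖y‖) ^ l) (e : E) :
    Integrable (fun y => m y • g (e, y)) μ := by
  obtain ⟨C, hC, H⟩ := g.exists_prod_decay 0 (Module.finrank ℝ G + 1 + l)
  refine integrable_of_decay (k := Module.finrank ℝ G + 1) (Nat.lt_succ_self _) μ
    (hm.aestronglyMeasurable.smul (g.continuous.comp (by fun_prop)).aestronglyMeasurable)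
    (B := |B| * C) fun y => ?_
  rw [norm_smul, Real.norm_eq_abs]
  have h1 := H e y
  rw [pow_zero, one_mul] at h1
  have h2 : |m y| ≤ |B| * (1 + ‖y‖) ^ l := (hB y).trans (by gcongr; exact le_abs_self B)
  calc (1 + ‖y‖) ^ (Module.finrank ℝ G + 1) * (|m y| * ‖g (e, y)‖)
      ≤ (1 + ‖y‖) ^ (Module.finrank ℝ G + 1) * ((|B| * (1 + ‖y‖) ^ l) * ‖g (e, y)‖) := by
        gcongr
    _ = |B| * ((1 + ‖y‖) ^ (Module.finrank ℝ G + 1 + l) * ‖g (e, y)‖) := by ring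
    _ ≤ _ := by gcongr

theorem SchwartzMap.exists_norm_weight_integral_le (g : 𝓢(E × G, F)) {m : G → ℝ} {B : ℝ} {l : ℕ}
    (hB : ∀ y, |m y| ≤ B * (1 + ‖y‖) ^ l) (k : ℕ) :
    ∃ C : ℝ, ∀ e, (1 + ‖e‖) ^ k * ‖∫ y, m y • g (e, y) ∂μ‖ ≤ C := by
  obtain ⟨C, hC, H⟩ := g.exists_prod_decay k (Module.finrank ℝ G + 1 + l)
  refine ⟨|B| * C * ∫ y, ((1 + ‖y‖) ^ (Module.finrank ℝ G + 1))⁻¹ ∂μ, fun e => ?_⟩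
  have := norm_integral_le_of_decay (k := Module.finrank ℝ G + 1) (Nat.lt_succ_self _) μ
    (f := fun y => (1 + ‖e‖) ^ k • (m y • g (e, y))) (B := |B| * C) fun y => by
      rw [norm_smul, norm_smul, Real.norm_of_nonneg (by positivity : 0 ≤ (1 + ‖e‖) ^ k),
        Real.norm_eq_abs]
      have h2 : |m y| ≤ |B| * (1 + ‖y‖) ^ l := (hB y).trans (by gcongr; exact le_abs_self B)
      calc (1 + ‖y‖) ^ (Module.finrank ℝ G + 1) * ((1 + ‖e‖) ^ k * (|m y| * ‖g (e, y)‖))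
          ≤ (1 + ‖y‖) ^ (Module.finrank ℝ G + 1) * ((1 + ‖e‖) ^ k *
            ((|B| * (1 + ‖y‖) ^ l) * ‖g (e, y)‖)) := by gcongr
        _ = |B| * ((1 + ‖e‖) ^ k * ((1 + ‖y‖) ^ (Module.finrank ℝ G + 1 + l) * ‖g (e, y)‖)) := by
            ring
        _ ≤ _ := by gcongr; exact H e y
  rwa [integral_smul, norm_smul, Real.norm_of_nonneg (by positivity : 0 ≤ (1 + ‖e‖) ^ k)] at this

/-- The restriction to the first variables of the derivative. -/
noncomputable def SchwartzMap.fderivFst (g : 𝓢(E × G, F)) : 𝓢(E × G, E →L[ℝ] F) :=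
  (SchwartzMap.fderivCLM ℝ (E × G) F g).postcompCLM
    ((ContinuousLinearMap.compL ℝ E (E × G) F).flip (ContinuousLinearMap.inl ℝ E G))

omit [FiniteDimensional ℝ G] [MeasurableSpace G] [BorelSpace G] in
theorem SchwartzMap.hasFDerivAt_slice (g : 𝓢(E × G, F)) (e : E) (y : G) :
    HasFDerivAt (fun e => g (e, y)) (g.fderivFst (e, y)) e := by
  exact HasFDerivAt.comp (g := g) (f := fun e => (e, y)) e (g.hasFDerivAt (x := (e, y)))
    (hasFDerivAt_prodMk_left e y)

theorem SchwartzMap.hasFDerivAt_weight_integral (g : 𝓢(E × G, F)) {m : G → ℝ} (hm : Measurable m)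
    {B : ℝ} {l : ℕ} (hB : ∀ y, |m y| ≤ B * (1 + ‖y‖) ^ l) (e : E) :
    HasFDerivAt (fun e => ∫ y, m y • g (e, y) ∂μ) (∫ y, m y • g.fderivFst (e, y) ∂μ) e := by
  obtain ⟨C, hC, H⟩ := g.fderivFst.exists_prod_decay 0 (Module.finrank ℝ G + 1 + l)
  refine hasFDerivAt_integral_of_dominated_of_fderiv_le (s := Set.univ)
    (bound := fun y => |B| * C * ((1 + ‖y‖) ^ (Module.finrank ℝ G + 1))⁻¹) Filter.univ_mem
    (Filter.Eventually.of_forall fun e => (g.integrable_weight_smul_slice μ hm hB e).1)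
    (g.integrable_weight_smul_slice μ hm hB e)
    (g.fderivFst.integrable_weight_smul_slice μ hm hB e).1
    (Filter.Eventually.of_forall fun y e _ => ?_)
    ((integrable_inv_one_add_norm_pow (Nat.lt_succ_self _) μ).const_mul _)
    (Filter.Eventually.of_forall fun y e _ => (g.hasFDerivAt_slice e y).const_smul (m y))
  rw [← div_eq_mul_inv, le_div_iff₀ (by positivity), norm_smul, Real.norm_eq_abs]
  have h1 := H e y
  rw [pow_zero, one_mul] at h1
  have h2 : |m y| ≤ |B| * (1 + ‖y‖) ^ l := (hB y).trans (by gcongr; exact le_abs_self B)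
  calc |m y| * ‖g.fderivFst (e, y)‖ * (1 + ‖y‖) ^ (Module.finrank ℝ G + 1)
      ≤ (|B| * (1 + ‖y‖) ^ l) * ‖g.fderivFst (e, y)‖ * (1 + ‖y‖) ^ (Module.finrank ℝ G + 1) := by
        gcongr
    _ = |B| * ((1 + ‖y‖) ^ (Module.finrank ℝ G + 1 + l) * ‖g.fderivFst (e, y)‖) := by ring
    _ ≤ _ := by gcongr

/-- The derivative is an integral of the same form, with `g.fderivFst` in place of `g`. Its values
lie in `E →L[ℝ] F`, so the target space is quantified inside the induction. -/
theorem SchwartzMap.contDiff_and_bounds_weight_integral {m : G → ℝ} (hm : Measurable m)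
    {B : ℝ} {l : ℕ} (hB : ∀ y, |m y| ≤ B * (1 + ‖y‖) ^ l) (n : ℕ) :
    ∀ (F : Type) [NormedAddCommGroup F] [NormedSpace ℝ F] (g : 𝓢(E × G, F)),
      ContDiff ℝ n (fun e => ∫ y, m y • g (e, y) ∂μ) ∧ ∀ k : ℕ, ∃ C : ℝ, ∀ e,
        (1 + ‖e‖) ^ k * ‖iteratedFDeriv ℝ n (fun e => ∫ y, m y • g (e, y) ∂μ) e‖ ≤ C := by
  induction n with
  | zero =>
    intro F _ _ g
    refine ⟨?_, fun k => ?_⟩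
    · rw [Nat.cast_zero, contDiff_zero]
      exact continuous_iff_continuousAt.2 fun e =>
        (g.hasFDerivAt_weight_integral μ hm hB e).continuousAt
    · simpa using g.exists_norm_weight_integral_le μ hB k
  | succ n ih =>
    intro F _ _ g
    have hd : fderiv ℝ (fun e => ∫ y, m y • g (e, y) ∂μ) =
        fun e => ∫ y, m y • g.fderivFst (e, y) ∂μ :=
      funext fun e => (g.hasFDerivAt_weight_integral μ hm hB e).fderiv
    obtain ⟨h1, h2⟩ := ih (E →L[ℝ] F) g.fderivFst
    refine ⟨?_, fun k => ?_⟩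
    · have : ((n + 1 : ℕ) : WithTop ℕ∞) = (n : WithTop ℕ∞) + 1 := by push_cast; rfl
      rw [this, contDiff_succ_iff_fderiv]
      refine ⟨fun e => (g.hasFDerivAt_weight_integral μ hm hB e).differentiableAt, by simp, ?_⟩
      rw [hd]; exact h1
    · simp only [← norm_iteratedFDeriv_fderiv, hd]
      exact h2 k

theorem SchwartzMap.exists_real_weight_integral (g : 𝓢(E × G, F)) {m : G → ℝ} (hm : Measurable m)
    {B : ℝ} {l : ℕ} (hB : ∀ y, |m y| ≤ B * (1 + ‖y‖) ^ l) :
    ∃ g' : 𝓢(E, F), ∀ e, g' e = ∫ y, m y • g (e, y) ∂μ :=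
  SchwartzMap.exists_of_bounds
    (contDiff_infty.2 fun n => (contDiff_and_bounds_weight_integral μ hm hB n F g).1)
    fun k n => (contDiff_and_bounds_weight_integral μ hm hB n F g).2 k

/-- Integration of a Schwartz function over some of the variables, against a weight of polynomial
growth, gives a Schwartz function of the other variables. -/
theorem SchwartzMap.exists_weight_integral (g : 𝓢(E × G, ℂ)) {m : G → ℂ} (hm : Measurable m)
    {B : ℝ} {l : ℕ} (hB : ∀ y, ‖m y‖ ≤ B * (1 + ‖y‖) ^ l) :
    ∃ g' : 𝓢(E, ℂ), ∀ e, g' e = ∫ y, g (e, y) * m y ∂μ := by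
  have b1 : ∀ y, |(m y).re| ≤ B * (1 + ‖y‖) ^ l := fun y => (Complex.abs_re_le_norm _).trans (hB y)
  have b2 : ∀ y, |(m y).im| ≤ B * (1 + ‖y‖) ^ l := fun y => (Complex.abs_im_le_norm _).trans (hB y)
  have m1 : Measurable fun y => (m y).re := Complex.measurable_re.comp hm
  have m2 : Measurable fun y => (m y).im := Complex.measurable_im.comp hm
  obtain ⟨g₁, h₁⟩ := g.exists_real_weight_integral μ m1 b1
  obtain ⟨g₂, h₂⟩ := g.exists_real_weight_integral μ m2 b2
  refine ⟨g₁ + Complex.I • g₂, fun e => ?_⟩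
  have i1 := g.integrable_weight_smul_slice μ m1 b1 e
  have i2 := g.integrable_weight_smul_slice μ m2 b2 e
  have : ∀ y, g (e, y) * m y = (m y).re • g (e, y) + Complex.I * ((m y).im • g (e, y)) := fun y => by
    conv_lhs => rw [← Complex.re_add_im (m y)]
    simp only [Complex.real_smul]
    ring
  simp only [this]
  rw [integral_add i1 (i2.const_mul _), integral_const_mul]
  simp [h₁, h₂]

end ParamIntegral
end Schwartz

/-! ### Weights of polynomial growth. -/

/-- Measurable functions of polynomial growth. -/
def PolyBounded {G : Type} [NormedAddCommGroup G] [MeasurableSpace G] (m : G → ℂ) : Prop :=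
  Measurable m ∧ ∃ (B : ℝ) (l : ℕ), ∀ y, ‖m y‖ ≤ B * (1 + ‖y‖) ^ l

section PolyBounded
variable {G : Type} [NormedAddCommGroup G] [MeasurableSpace G]

theorem PolyBounded.one : PolyBounded fun _ : G => (1 : ℂ) := ⟨measurable_const, 1, 0, by simp⟩

theorem PolyBounded.mul {m₁ m₂ : G → ℂ} (h₁ : PolyBounded m₁) (h₂ : PolyBounded m₂) :
    PolyBounded fun y => m₁ y * m₂ y := by
  obtain ⟨h₁, B₁, l₁, H₁⟩ := h₁
  obtain ⟨h₂, B₂, l₂, H₂⟩ := h₂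
  refine ⟨h₁.mul h₂, B₁ * B₂, l₁ + l₂, fun y => ?_⟩
  rw [norm_mul]
  refine (mul_le_mul (H₁ y) (H₂ y) (norm_nonneg _) ((norm_nonneg _).trans (H₁ y))).trans (le_of_eq ?_)
  ring

theorem PolyBounded.prod {ι : Type*} (s : Finset ι) {m : ι → G → ℂ}
    (h : ∀ i ∈ s, PolyBounded (m i)) : PolyBounded fun y => ∏ i ∈ s, m i y := by
  classical
  induction s using Finset.induction_on with
  | empty => simpa using PolyBounded.one
  | insert i s hi ih =>
    simp only [Finset.prod_insert hi]
    exact (h i (Finset.mem_insert_self _ _)).mul (ih fun j hj => h j (Finset.mem_insert_of_mem hj))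

theorem PolyBounded.comp_apply {n : ℕ} {κ : ℝ → ℂ} (h : PolyBounded κ) (a : Fin n) :
    PolyBounded fun r : Fin n → ℝ => κ (r a) := by
  obtain ⟨h, B, l, H⟩ := h
  refine ⟨h.comp (measurable_pi_apply a), B, l, fun y => (H _).trans ?_⟩
  have hB : 0 ≤ B := by simpa using (norm_nonneg _).trans (H 0)
  have := norm_le_pi_norm y a
  gcongr

theorem SchwartzMap.integrable_mul_polyBounded {E G : Type} [NormedAddCommGroup E]
    [NormedSpace ℝ E] [NormedAddCommGroup G] [NormedSpace ℝ G] [FiniteDimensional ℝ G]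
    [MeasurableSpace G] [BorelSpace G] (μ : Measure G) [μ.IsAddHaarMeasure] (g : 𝓢(E × G, ℂ))
    {m : G → ℂ} (hm : PolyBounded m) (e : E) : Integrable (fun y => g (e, y) * m y) μ := by
  obtain ⟨hm, B, l, hB⟩ := hm
  obtain ⟨C, hC, H⟩ := g.exists_prod_decay 0 (Module.finrank ℝ G + 1 + l)
  have hg : Continuous fun y => g (e, y) := g.continuous.comp (by fun_prop)
  refine integrable_of_decay (k := Module.finrank ℝ G + 1) (Nat.lt_succ_self _) μ
    (hg.aestronglyMeasurable.mul hm.aestronglyMeasurable) (B := C * B) fun y => ?_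
  rw [norm_mul]
  have hB0 : 0 ≤ B := by simpa using (norm_nonneg _).trans (hB 0)
  have h1 := H e y
  rw [pow_zero, one_mul] at h1
  have h2 := hB y
  calc (1 + ‖y‖) ^ (Module.finrank ℝ G + 1) * (‖g (e, y)‖ * ‖m y‖)
      ≤ (1 + ‖y‖) ^ (Module.finrank ℝ G + 1) * (‖g (e, y)‖ * (B * (1 + ‖y‖) ^ l)) := by gcongr
    _ = ((1 + ‖y‖) ^ (Module.finrank ℝ G + 1 + l) * ‖g (e, y)‖) * B := by ring
    _ ≤ _ := by gcongr

end PolyBounded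

/-! ### Integration by parts against products of weights. -/

section ByParts
variable {E : Type} [NormedAddCommGroup E] [NormedSpace ℝ E] {n : ℕ}

theorem SchwartzMap.integral_mul_weight_deriv (g : 𝓢(E × (Fin n → ℝ), ℂ)) (a : Fin n) {κ κ' : ℝ → ℂ}
    (hκ : PolyBounded κ) (hκ' : PolyBounded κ') (hd : ∀ t, HasDerivAt κ (κ' t) t)
    {R : (Fin n → ℝ) → ℂ} (hR : PolyBounded R)
    (hRa : ∀ (r : Fin n → ℝ) (t : ℝ), R (r + t • Pi.single a 1) = R r) (e : E) :
    ∫ r, g (e, r) * (κ' (r a) * R r) =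
      -∫ r, (∂_{((0 : E), (Pi.single a 1 : Fin n → ℝ))} g) (e, r) * (κ (r a) * R r) := by
  refine integral_bilinear_hasLineDerivAt_right_eq_neg_left_of_integrable
    (B := ContinuousLinearMap.mul ℝ ℂ) (v := (Pi.single a 1 : Fin n → ℝ))
    (f := fun r => g (e, r)) (g := fun r => κ (r a) * R r)
    (SchwartzMap.integrable_mul_polyBounded _ _ ((hκ.comp_apply a).mul hR) e)
    (SchwartzMap.integrable_mul_polyBounded _ _ ((hκ'.comp_apply a).mul hR) e)
    (SchwartzMap.integrable_mul_polyBounded _ _ ((hκ.comp_apply a).mul hR) e)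
    (fun r _ => ?_) (fun r _ => ?_)
  · have h1 : HasFDerivAt (fun r => g (e, r)) _ r := HasFDerivAt.comp (g := g) (f := fun r => (e, r)) r
      (g.hasFDerivAt (x := (e, r))) (hasFDerivAt_prodMk_right e r)
    have h2 := h1.hasLineDerivAt (Pi.single a 1)
    rw [SchwartzMap.lineDerivOp_apply_eq_fderiv]
    simpa using h2
  · have h1 : HasDerivAt (fun t : ℝ => κ (r a + t) * R r) (κ' (r a) * R r) 0 := by
      have : HasDerivAt (fun t : ℝ => κ (r a + t)) (κ' (r a)) 0 :=
        HasDerivAt.comp_const_add (r a) 0 (by simpa using hd (r a))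
      exact this.mul_const _
    unfold HasLineDerivAt
    simpa [hRa] using h1

/-- Two integrations by parts in each of the variables which are integrated. -/
theorem SchwartzMap.exists_integral_mul_prod_eq (g : 𝓢(E × (Fin n → ℝ), ℂ)) (s : Finset (Fin n)) :
    ∃ g' : 𝓢(E × (Fin n → ℝ), ℂ), ∀ κ₀ κ₁ κ₂ : ℝ → ℂ, PolyBounded κ₀ → PolyBounded κ₁ →
      PolyBounded κ₂ → (∀ t, HasDerivAt κ₀ (κ₁ t) t) → (∀ t, HasDerivAt κ₁ (κ₂ t) t) →
      ∀ e, ∫ r, g (e, r) * ∏ a, κ₂ (r a) =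
        ∫ r, g' (e, r) * ((∏ a ∈ s, κ₀ (r a)) * ∏ a ∈ sᶜ, κ₂ (r a)) := by
  induction s using Finset.induction_on with
  | empty => exact ⟨g, fun κ₀ κ₁ κ₂ _ _ _ _ _ e => by simp⟩
  | insert a s ha ih =>
    obtain ⟨g', H⟩ := ih
    -- The function is chosen before the weights, so the same one serves every `δ`; the two minus
    -- signs cancel.
    refine ⟨∂_{((0 : E), (Pi.single a 1 : Fin n → ℝ))} (∂_{((0 : E), (Pi.single a 1 : Fin n → ℝ))} g'),
      fun κ₀ κ₁ κ₂ h₀ h₁ h₂ d₀ d₁ e => ?_⟩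
    have hsc : sᶜ = insert a (insert a s)ᶜ := by
      ext b; by_cases hb : b = a <;> simp [hb, ha]
    set R : (Fin n → ℝ) → ℂ := fun r => (∏ b ∈ s, κ₀ (r b)) * ∏ b ∈ (insert a s)ᶜ, κ₂ (r b) with hRdef
    have hR : PolyBounded R := (PolyBounded.prod s fun b _ => h₀.comp_apply b).mul
      (PolyBounded.prod _ fun b _ => h₂.comp_apply b)
    have hRa : ∀ (r : Fin n → ℝ) (t : ℝ), R (r + t • Pi.single a 1) = R r := fun r t => by
      have key : ∀ b, b ≠ a → (r + t • (Pi.single a 1 : Fin n → ℝ)) b = r b := fun b hb => by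
        simp [Pi.single_eq_of_ne hb]
      simp only [hRdef]
      congr 1
      · exact Finset.prod_congr rfl fun b hb => by rw [key b (by rintro rfl; exact ha hb)]
      · exact Finset.prod_congr rfl fun b hb => by rw [key b (by rintro rfl; simp at hb)]
    rw [H κ₀ κ₁ κ₂ h₀ h₁ h₂ d₀ d₁ e]
    have e1 : ∀ r : Fin n → ℝ, (∏ b ∈ s, κ₀ (r b)) * ∏ b ∈ sᶜ, κ₂ (r b) = κ₂ (r a) * R r := fun r => by
      rw [hsc, Finset.prod_insert (by simp)]; simp only [hRdef]; ring
    have e2 : ∀ r : Fin n → ℝ, (∏ b ∈ insert a s, κ₀ (r b)) * ∏ b ∈ (insert a s)ᶜ, κ₂ (r b) =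
        κ₀ (r a) * R r := fun r => by
      rw [Finset.prod_insert ha]; simp only [hRdef]; ring
    simp only [e1, e2]
    rw [SchwartzMap.integral_mul_weight_deriv _ a h₁ h₂ d₁ hR hRa,
      SchwartzMap.integral_mul_weight_deriv _ a h₀ h₁ d₀ hR hRa, neg_neg]

end ByParts

/-! ### Boundary values of `1/s` from the upper half plane. -/

section CauchyKernel

/-- The second primitive `s log s - s` of `1 / s` on the line `Im s = δ`. -/
noncomputable def logPrimitive (δ t : ℝ) : ℂ :=
  (t + Complex.I * δ) * Complex.log (t + Complex.I * δ) - (t + Complex.I * δ)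

theorem hasDerivAt_line (δ t : ℝ) : HasDerivAt (fun t : ℝ => (t + Complex.I * δ : ℂ)) 1 t :=
  (Complex.ofRealCLM.hasDerivAt (x := t)).add_const _

theorem line_mem_slitPlane {δ : ℝ} (hδ : 0 < δ) (t : ℝ) : (t + Complex.I * δ : ℂ) ∈ Complex.slitPlane := by
  right; simp [hδ.ne']

theorem line_ne_zero {δ : ℝ} (hδ : 0 < δ) (t : ℝ) : (t + Complex.I * δ : ℂ) ≠ 0 :=
  Complex.slitPlane_ne_zero (line_mem_slitPlane hδ t)

theorem hasDerivAt_log_line {δ : ℝ} (hδ : 0 < δ) (t : ℝ) :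
    HasDerivAt (fun t : ℝ => Complex.log (t + Complex.I * δ)) (t + Complex.I * δ)⁻¹ t := by
  simpa using (hasDerivAt_line δ t).clog_real (line_mem_slitPlane hδ t)

theorem hasDerivAt_logPrimitive {δ : ℝ} (hδ : 0 < δ) (t : ℝ) :
    HasDerivAt (logPrimitive δ) (Complex.log (t + Complex.I * δ)) t := by
  have := ((hasDerivAt_line δ t).mul (hasDerivAt_log_line hδ t)).sub (hasDerivAt_line δ t)
  rw [mul_inv_cancel₀ (line_ne_zero hδ t)] at this
  exact this.congr_deriv (by ring)

theorem norm_line_le {δ : ℝ} (h0 : 0 ≤ δ) (h1 : δ ≤ 1) (t : ℝ) : ‖(t + Complex.I * δ : ℂ)‖ ≤ 1 + |t| := by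
  refine (norm_add_le _ _).trans ?_
  simp [abs_of_nonneg h0]
  linarith

theorem le_norm_line {δ : ℝ} (h0 : 0 ≤ δ) (t : ℝ) : δ ≤ ‖(t + Complex.I * δ : ℂ)‖ := by
  have := Complex.abs_im_le_norm (t + Complex.I * δ : ℂ)
  simpa [abs_of_nonneg h0] using this

theorem norm_log_le (s : ℂ) : ‖Complex.log s‖ ≤ |Real.log ‖s‖| + Real.pi := by
  refine (Complex.norm_le_abs_re_add_abs_im _).trans ?_
  rw [Complex.log_re, Complex.log_im]
  gcongr
  exact Complex.abs_arg_le_pi s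

/-- Unlike `1/s` and `log s`, the second primitive is bounded near `s = 0`, because `|s| |log |s||`
is. The bound is therefore uniform down to `δ = 0`, which explains the two integrations by parts. -/
theorem norm_logPrimitive_le {δ : ℝ} (h0 : 0 ≤ δ) (h1 : δ ≤ 1) (t : ℝ) :
    ‖logPrimitive δ t‖ ≤ 7 * (1 + |t|) ^ 2 := by
  unfold logPrimitive
  set s : ℂ := t + Complex.I * δ
  have hs : ‖s‖ ≤ 1 + |t| := norm_line_le h0 h1 t
  have hl : ‖s‖ * |Real.log ‖s‖| ≤ 1 + ‖s‖ ^ 2 := by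
    rcases le_or_gt 1 ‖s‖ with h | h
    · rw [abs_of_nonneg (Real.log_nonneg h)]
      nlinarith [Real.log_le_self (norm_nonneg s)]
    · rcases eq_or_lt_of_le (norm_nonneg s) with h' | h'
      · simp [← h']
      · have := Real.abs_log_mul_self_lt ‖s‖ h' h.le
        rw [abs_mul, abs_of_pos h'] at this
        nlinarith [sq_nonneg ‖s‖]
  have h2 : ‖s * Complex.log s - s‖ ≤ ‖s‖ * (|Real.log ‖s‖| + Real.pi) + ‖s‖ := by
    refine (norm_sub_le _ _).trans ?_
    rw [norm_mul]
    gcongr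
    exact norm_log_le s
  have h3 : Real.pi ≤ 4 := Real.pi_le_four
  have h4 := abs_nonneg t
  have h5 := norm_nonneg s
  nlinarith

theorem measurable_logPrimitive (δ : ℝ) : Measurable (logPrimitive δ) := by
  unfold logPrimitive; fun_prop

theorem polyBounded_logPrimitive {δ : ℝ} (h0 : 0 ≤ δ) (h1 : δ ≤ 1) : PolyBounded (logPrimitive δ) :=
  ⟨measurable_logPrimitive δ, 7, 2, fun t => norm_logPrimitive_le h0 h1 t⟩

/-- The constant blows up with `δ⁻¹`. This is harmless, since the first primitive appears only in
the integration by parts at fixed `δ`. -/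
theorem polyBounded_log_line {δ : ℝ} (h0 : 0 < δ) (h1 : δ ≤ 1) :
    PolyBounded fun t : ℝ => Complex.log (t + Complex.I * δ) := by
  refine ⟨by fun_prop, 1 + δ⁻¹ + Real.pi, 1, fun t => (norm_log_le _).trans ?_⟩
  have hs := norm_line_le h0.le h1 t
  have hs' := le_norm_line h0.le t
  set x := ‖(t + Complex.I * δ : ℂ)‖
  have hx : 0 < x := h0.trans_le hs'
  have h2 : |Real.log x| ≤ x + δ⁻¹ := by
    rw [abs_le]
    have a1 := Real.log_le_self hx.le
    have a2 := Real.log_le_self (inv_nonneg.2 hx.le)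
    rw [Real.log_inv] at a2
    have a3 : x⁻¹ ≤ δ⁻¹ := inv_anti₀ h0 hs'
    have a4 : 0 < δ⁻¹ := inv_pos.2 h0
    constructor <;> linarith
  have h3 : 0 ≤ (δ⁻¹ + Real.pi) * |t| := by positivity
  rw [pow_one, Real.norm_eq_abs]
  nlinarith

theorem polyBounded_inv_line {δ : ℝ} (h0 : 0 < δ) :
    PolyBounded fun t : ℝ => (t + Complex.I * δ : ℂ)⁻¹ := by
  refine ⟨by fun_prop, δ⁻¹, 0, fun t => ?_⟩
  rw [norm_inv, pow_zero, mul_one]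
  exact inv_anti₀ h0 (le_norm_line h0.le t)

theorem tendsto_logPrimitive (t : ℝ) :
    Filter.Tendsto (fun δ => logPrimitive δ t) (𝓝[>] 0) (𝓝 (logPrimitive 0 t)) := by
  unfold logPrimitive
  have hs : Filter.Tendsto (fun δ : ℝ => (t + Complex.I * δ : ℂ)) (𝓝[>] 0)
      (𝓝 (t + Complex.I * (0 : ℝ))) :=
    ((by fun_prop : Continuous fun δ : ℝ => (t + Complex.I * δ : ℂ)).tendsto 0).mono_left nhdsWithin_le_nhds
  refine Filter.Tendsto.sub ?_ hs
  -- For `t < 0` the cut of the logarithm is approached from above, where `log` is continuous up to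
  -- the cut; for `t = 0` the product `s log s` tends to `0`; for `t > 0` there is nothing singular.
  rcases lt_trichotomy t 0 with ht | ht | ht
  · refine hs.mul ?_
    have h1 := Complex.continuousWithinAt_log_of_re_neg_of_im_zero (z := t + Complex.I * (0 : ℝ))
      (by simpa using ht) (by simp)
    refine h1.tendsto.comp (tendsto_nhdsWithin_iff.2 ⟨hs, ?_⟩)
    filter_upwards [self_mem_nhdsWithin] with δ hδ
    simpa using (le_of_lt (Set.mem_Ioi.1 hδ))
  · subst ht
    rw [tendsto_iff_norm_sub_tendsto_zero]
    have h2 : Filter.Tendsto (fun δ : ℝ => |δ * Real.log δ| + δ * Real.pi) (𝓝[>] 0) (𝓝 0) := by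
      have h1 : Continuous fun δ : ℝ => |δ * Real.log δ| + δ * Real.pi :=
        Real.continuous_mul_log.abs.add (continuous_id.mul continuous_const)
      have h2 := h1.tendsto 0
      rw [Real.log_zero, mul_zero, abs_zero, zero_mul, add_zero] at h2
      exact h2.mono_left nhdsWithin_le_nhds
    refine squeeze_zero' (Filter.Eventually.of_forall fun _ => norm_nonneg _) ?_ h2
    filter_upwards [self_mem_nhdsWithin] with δ hδ
    have hδ' : 0 < δ := hδ
    have h3 := norm_log_le (Complex.I * δ)
    have h4 : ‖Complex.I * (δ : ℂ)‖ = δ := by simp [abs_of_pos hδ']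
    rw [h4] at h3
    simp only [Complex.ofReal_zero, zero_add, mul_zero, zero_mul, sub_zero]
    rw [norm_mul, h4, abs_mul, abs_of_pos hδ']
    nlinarith
  · refine hs.mul ((continuousAt_clog ?_).tendsto.comp hs)
    left; simpa using ht

end CauchyKernel

/-! ### The limit of the integral against simple poles. -/

section SingularLimit
variable {E : Type} [NormedAddCommGroup E] [NormedSpace ℝ E] {n : ℕ}

theorem norm_prod_logPrimitive_le {δ : ℝ} (h0 : 0 ≤ δ) (h1 : δ ≤ 1) (r : Fin n → ℝ) :
    ‖∏ a, logPrimitive δ (r a)‖ ≤ 7 ^ n * (1 + ‖r‖) ^ (2 * n) := by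
  rw [norm_prod]
  calc ∏ a, ‖logPrimitive δ (r a)‖ ≤ ∏ _a : Fin n, 7 * (1 + ‖r‖) ^ 2 := by
        refine Finset.prod_le_prod (fun _ _ => norm_nonneg _) fun a _ =>
          (norm_logPrimitive_le h0 h1 _).trans ?_
        have := norm_le_pi_norm r a
        rw [Real.norm_eq_abs] at this
        gcongr
    _ = _ := by simp [mul_pow, pow_mul]

/-- The integral of a Schwartz function against the singular kernel `∏ (r_a + i δ)⁻¹` converges as
`δ → 0+` to a Schwartz function of the remaining variables, and is bounded uniformly in `δ`. -/
theorem SchwartzMap.exists_singular_limit (g : 𝓢((ℝ × E) × (Fin n → ℝ), ℂ)) :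
    ∃ G : 𝓢(E, ℂ), (∀ δ : ℝ → ℝ, Filter.Tendsto δ (𝓝[>] 0) (𝓝[>] 0) → ∀ e,
      Filter.Tendsto (fun θ => ∫ r, g ((θ, e), r) * ∏ a, (r a + Complex.I * δ θ : ℂ)⁻¹) (𝓝[>] 0)
        (𝓝 (G e))) ∧
      ∀ k : ℕ, ∃ C : ℝ, ∀ (θ : ℝ) (e : E) (δ : ℝ), 0 < δ → δ ≤ 1 →
        (1 + ‖e‖) ^ k * ‖∫ r, g ((θ, e), r) * ∏ a, (r a + Complex.I * δ : ℂ)⁻¹‖ ≤ C := by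
  obtain ⟨g', H⟩ := g.exists_integral_mul_prod_eq Finset.univ
  have H' : ∀ (θ : ℝ) (e : E) (δ : ℝ), 0 < δ → δ ≤ 1 →
      ∫ r, g ((θ, e), r) * ∏ a, (r a + Complex.I * δ : ℂ)⁻¹ =
        ∫ r, g' ((θ, e), r) * ∏ a, logPrimitive δ (r a) := fun θ e δ h0 h1 => by
    have := H (logPrimitive δ) _ _ (polyBounded_logPrimitive h0.le h1) (polyBounded_log_line h0 h1)
      (polyBounded_inv_line h0) (hasDerivAt_logPrimitive h0) (hasDerivAt_log_line h0) (θ, e)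
    simpa using this
  obtain ⟨G₀, hG₀⟩ := g'.exists_weight_integral volume (m := fun r => ∏ a, logPrimitive 0 (r a))
    (PolyBounded.prod Finset.univ fun a _ =>
      (polyBounded_logPrimitive le_rfl zero_le_one).comp_apply a).1
    (fun r => norm_prod_logPrimitive_le le_rfl zero_le_one r)
  -- The variable `θ` is also sent to `0`, so the limit is the slice `θ = 0` of the integral against
  -- the boundary weight.
  obtain ⟨G, hG⟩ : ∃ G : 𝓢(E, ℂ), ∀ e, G e = G₀ (0, e) :=
    ⟨SchwartzMap.compCLMOfAntilipschitz ℝ (g := ContinuousLinearMap.inr ℝ ℝ E) (K := 1)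
      (ContinuousLinearMap.hasTemperateGrowth _)
      (AddMonoidHomClass.antilipschitz_of_bound _ fun x => by simp) G₀, fun e => rfl⟩
  refine ⟨G, fun δ hδ e => ?_, fun k => ?_⟩
  · obtain ⟨C, hC, HC⟩ := g'.exists_prod_decay 0 (n + 1 + 2 * n)
    have hδ1 : ∀ᶠ θ in 𝓝[>] (0 : ℝ), 0 < δ θ ∧ δ θ ≤ 1 := by
      have := hδ.eventually (Ioc_mem_nhdsGT (zero_lt_one (α := ℝ)))
      exact this
    rw [hG, hG₀]
    refine Filter.Tendsto.congr' (f₁ := fun θ => ∫ r, g' ((θ, e), r) *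
      ∏ a, logPrimitive (δ θ) (r a)) ?_ ?_
    · filter_upwards [hδ1] with θ hθ
      rw [H' θ e (δ θ) hθ.1 hθ.2]
    refine tendsto_integral_filter_of_dominated_convergence
      (fun r => C * 7 ^ n * ((1 + ‖r‖) ^ (n + 1))⁻¹) ?_ ?_
      ((integrable_inv_one_add_norm_pow (by simp) volume).const_mul _) ?_
    · filter_upwards [hδ1] with θ hθ
      exact (SchwartzMap.integrable_mul_polyBounded volume g' (PolyBounded.prod Finset.univ fun a _ =>
        (polyBounded_logPrimitive hθ.1.le hθ.2).comp_apply a) (θ, e)).1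
    · filter_upwards [hδ1] with θ hθ
      refine Filter.Eventually.of_forall fun r => ?_
      rw [← div_eq_mul_inv, le_div_iff₀ (by positivity), norm_mul]
      have h1 := HC (θ, e) r
      rw [pow_zero, one_mul] at h1
      have h2 := norm_prod_logPrimitive_le hθ.1.le hθ.2 r
      calc ‖g' ((θ, e), r)‖ * ‖∏ a, logPrimitive (δ θ) (r a)‖ * (1 + ‖r‖) ^ (n + 1)
          ≤ ‖g' ((θ, e), r)‖ * (7 ^ n * (1 + ‖r‖) ^ (2 * n)) * (1 + ‖r‖) ^ (n + 1) := by gcongr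
        _ = ((1 + ‖r‖) ^ (n + 1 + 2 * n) * ‖g' ((θ, e), r)‖) * 7 ^ n := by ring
        _ ≤ _ := by gcongr
    · refine Filter.Eventually.of_forall fun r => Filter.Tendsto.mul ?_ ?_
      · have : Continuous fun θ : ℝ => g' ((θ, e), r) := g'.continuous.comp (by fun_prop)
        exact (this.tendsto 0).mono_left nhdsWithin_le_nhds
      · exact tendsto_finsetProd _ fun a _ => (tendsto_logPrimitive (r a)).comp hδ
  · obtain ⟨C, hC, HC⟩ := g'.exists_prod_decay k (n + 1 + 2 * n)
    refine ⟨C * 7 ^ n * ∫ r : Fin n → ℝ, ((1 + ‖r‖) ^ (n + 1))⁻¹, fun θ e δ h0 h1 => ?_⟩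
    rw [H' θ e δ h0 h1]
    have := norm_integral_le_of_decay (k := n + 1) (by simp) volume (B := C * 7 ^ n)
      (f := fun r : Fin n → ℝ => (1 + ‖e‖) ^ k • (g' ((θ, e), r) * ∏ a, logPrimitive δ (r a)))
      fun r => by
        rw [norm_smul, norm_mul, Real.norm_of_nonneg (by positivity)]
        have h1 := HC (θ, e) r
        have h2 := norm_prod_logPrimitive_le h0.le ‹_› r
        have h3 : ‖e‖ ≤ ‖(θ, e)‖ := le_max_right _ _
        calc (1 + ‖r‖) ^ (n + 1) * ((1 + ‖e‖) ^ k * (‖g' ((θ, e), r)‖ * ‖∏ a, logPrimitive δ (r a)‖))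
            ≤ (1 + ‖r‖) ^ (n + 1) * ((1 + ‖(θ, e)‖) ^ k * (‖g' ((θ, e), r)‖ *
              (7 ^ n * (1 + ‖r‖) ^ (2 * n)))) := by gcongr
          _ = ((1 + ‖(θ, e)‖) ^ k * ((1 + ‖r‖) ^ (n + 1 + 2 * n) * ‖g' ((θ, e), r)‖)) * 7 ^ n := by
            ring
          _ ≤ _ := by gcongr
    rwa [integral_smul, norm_smul, Real.norm_of_nonneg (by positivity)] at this

end SingularLimit

/-! ### Cauchy's estimates in several variables. -/

section CauchyEstimate

/-- Cauchy's estimates for the real derivatives of a function which is the restriction of an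
analytic function of several complex variables. -/
theorem exists_norm_iteratedFDeriv_comp_le {V E : Type} [NormedAddCommGroup V] [NormedSpace ℂ V]
    [NormedAddCommGroup E] [NormedSpace ℝ E] (L : E →L[ℝ] V) (n : ℕ) : ∀ ρ : ℝ, 0 < ρ →
    ∃ C : ℝ, ∀ (F : Type) [NormedAddCommGroup F] [NormedSpace ℂ F] [CompleteSpace F] (K : V → F)
      (x : E) (B : ℝ), AnalyticOnNhd ℂ K (Metric.ball (L x) ρ) →
      (∀ y ∈ Metric.ball (L x) ρ, ‖K y‖ ≤ B) → ‖iteratedFDeriv ℝ n (K ∘ L) x‖ ≤ C * B := by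
  induction n with
  | zero =>
    intro ρ hρ
    refine ⟨1, fun F _ _ _ K x B _ hB => ?_⟩
    simpa using hB (L x) (Metric.mem_ball_self hρ)
  | succ n ih =>
    intro ρ hρ
    obtain ⟨C, H⟩ := ih (ρ / 2) (by positivity)
    refine ⟨‖L‖ * |C| * (4 / ρ), fun F _ _ _ K x B hK hB => ?_⟩
    have hB0 : 0 ≤ B := (norm_nonneg _).trans (hB (L x) (Metric.mem_ball_self hρ))
    -- Composition with `L` makes the derivative of `K ∘ L` equal to `T ∘ (K' ∘ L)` near `x`. The
    -- induction then applies to `K'` on the half ball, with a new target space.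
    set T : (V →L[ℂ] F) →L[ℝ] (E →L[ℝ] F) :=
      ((ContinuousLinearMap.compL ℝ E V F).flip L).comp
        (ContinuousLinearMap.restrictScalarsIsometry ℂ V F ℝ ℝ).toContinuousLinearMap with hT
    have hTa : ∀ A : V →L[ℂ] F, T A = (A.restrictScalars ℝ).comp L := fun A => rfl
    have hTn : ‖T‖ ≤ ‖L‖ := by
      refine ContinuousLinearMap.opNorm_le_bound _ (norm_nonneg _) fun A => ?_
      rw [hTa]
      refine (ContinuousLinearMap.opNorm_comp_le _ _).trans ?_
      rw [ContinuousLinearMap.norm_restrictScalars, mul_comm]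
    have hopen : ∀ᶠ y in 𝓝 x, L y ∈ Metric.ball (L x) ρ :=
      L.continuous.continuousAt (Metric.ball_mem_nhds _ hρ)
    have hd : fderiv ℝ (K ∘ L) =ᶠ[𝓝 x] T ∘ (fderiv ℂ K ∘ L) := by
      filter_upwards [hopen] with y hy
      have h1 := ((hK (L y) hy).differentiableAt.hasFDerivAt.restrictScalars ℝ).comp y L.hasFDerivAt
      exact h1.fderiv
    rw [← norm_iteratedFDeriv_fderiv, (Filter.EventuallyEq.iteratedFDeriv ℝ hd n).eq_of_nhds]
    have hK' : AnalyticOnNhd ℂ (fderiv ℂ K) (Metric.ball (L x) ρ) := hK.fderiv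
    have hsm : ContDiffAt ℝ n (fderiv ℂ K ∘ L) x := by
      have h1 : AnalyticAt ℝ (fderiv ℂ K) (L x) :=
        (hK' (L x) (Metric.mem_ball_self hρ)).restrictScalars
      exact (h1.contDiffAt (n := n)).comp x L.contDiff.contDiffAt
    refine (T.norm_iteratedFDeriv_comp_left hsm le_rfl).trans ?_
    have h2 := H (V →L[ℂ] F) (fderiv ℂ K) x (2 * B / (ρ / 2))
      (hK'.mono (Metric.ball_subset_ball (by linarith))) fun y hy => by
        have hsub : Metric.ball y (ρ / 2) ⊆ Metric.ball (L x) ρ :=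
          Metric.ball_subset_ball' (by have := Metric.mem_ball.1 hy; linarith)
        refine Complex.norm_fderiv_le_div_of_mapsTo_ball
          (fun z hz => (hK z (hsub hz)).differentiableAt.differentiableWithinAt) (fun z hz => ?_)
          (by positivity)
        rw [mem_closedBall_iff_norm]
        have a1 := hB z (hsub hz)
        have a2 := hB y (hsub (Metric.mem_ball_self (by positivity)))
        linarith [norm_sub_le (K z) (K y)]
    calc ‖T‖ * ‖iteratedFDeriv ℝ n (fderiv ℂ K ∘ L) x‖ ≤ ‖L‖ * (C * (2 * B / (ρ / 2))) := by gcongr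
      _ ≤ ‖L‖ * (|C| * (2 * B / (ρ / 2))) := by gcongr; exact le_abs_self C
      _ = _ := by field_simp; ring

end CauchyEstimate

/-! ### The kernel with its poles removed. -/

/-- The entire function `1 / Γ(1 + s/(iħ))`. -/
noncomputable def regInvGamma (h : ℝ) (s : ℂ) : ℂ := (Complex.Gamma (1 + s / (Complex.I * h)))⁻¹

/-- The Mellin-Barnes factor with its pole at the origin removed. -/
noncomputable def regFactor (h : ℝ) (s : ℂ) : ℂ :=
  Complex.I * h * ((h : ℂ) ^ (-(Complex.I / h * s)) * Complex.Gamma (1 + s / (Complex.I * h)))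

theorem norm_sin_le {z : ℂ} (hz : |z.im| ≤ 1) : ‖Complex.sin z‖ ≤ 3 := by
  have h1 : ‖Complex.exp (-z * Complex.I)‖ ≤ Real.exp 1 := by
    rw [Complex.norm_exp]; refine Real.exp_le_exp.2 ?_
    simpa using (le_abs_self _).trans hz
  have h2 : ‖Complex.exp (z * Complex.I)‖ ≤ Real.exp 1 := by
    rw [Complex.norm_exp]; refine Real.exp_le_exp.2 ?_
    simpa using (neg_le_abs _).trans hz
  rw [Complex.sin, norm_div, norm_mul, Complex.norm_I, mul_one]
  have h3 := norm_sub_le (Complex.exp (-z * Complex.I)) (Complex.exp (z * Complex.I))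
  have h4 := Real.exp_one_lt_d9
  rw [Complex.norm_two, div_le_iff₀ two_pos]
  linarith

/-- In a strip `|Im z| ≤ 1` the modulus is still Gaussian in `Re z`, and `1 + |t| ≤ 2 + |Re z|` is
dominated by it. -/
theorem exists_one_add_abs_pow_mul_norm_exp_neg_sq_le (k : ℕ) : ∃ C : ℝ, 0 < C ∧ ∀ (z : ℂ) (t : ℝ),
    ‖z - t‖ ≤ 1 → (1 + |t|) ^ k * ‖Complex.exp (-z ^ 2)‖ ≤ C := by
  refine ⟨k.factorial * Real.exp 4, by positivity, fun z t hz => ?_⟩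
  have h1 : |z.re - t| ≤ 1 := by simpa using (Complex.abs_re_le_norm _).trans hz
  have h2 : |z.im| ≤ 1 := by simpa using (Complex.abs_im_le_norm _).trans hz
  have h3 : (1 + |t|) ^ k ≤ k.factorial * Real.exp (1 + |t|) := by
    have := Real.pow_div_factorial_le_exp (1 + |t|) (by positivity) k
    rwa [div_le_iff₀ (by positivity), mul_comm] at this
  have h4 : (-z ^ 2).re = z.im ^ 2 - z.re ^ 2 := by simp [sq]
  rw [Complex.norm_exp, h4]
  calc _ ≤ k.factorial * Real.exp (1 + |t|) * Real.exp (z.im ^ 2 - z.re ^ 2) := by gcongr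
    _ = k.factorial * Real.exp (1 + |t| + (z.im ^ 2 - z.re ^ 2)) := by rw [Real.exp_add (1 + |t|)]; ring
    _ ≤ _ := by
      gcongr
      have a1 : z.im ^ 2 ≤ 1 := by rw [← sq_abs]; nlinarith [abs_nonneg z.im]
      have a2 : |t| ≤ |z.re| + 1 := by
        have := abs_sub_abs_le_abs_sub t z.re
        rw [abs_sub_comm] at this; linarith
      nlinarith [sq_abs z.re, sq_nonneg (|z.re| - 1)]

section Reg
variable {h : ℝ} (hh : 0 < h)
include hh

/-- Within `ħ/2` of a real point, the argument of `Γ(1 + ·)` has real part at least `1/2`, so no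
pole is met. Its imaginary part changes by at most `1/2`, which alters the exponentials only by a
constant. -/
theorem div_I_mul_bounds {s : ℂ} {x : ℝ} (hs : ‖s - x‖ ≤ h / 2) :
    |(s / (Complex.I * h)).re| ≤ 1 / 2 ∧ 1 + |(s / (Complex.I * h)).im| ≤ (2 + h⁻¹) * (1 + |x|) ∧
      |(|(s / (Complex.I * h)).im| - |x| / h)| ≤ 1 / 2 := by
  have h1 : |s.re - x| ≤ h / 2 := by simpa using (Complex.abs_re_le_norm _).trans hs
  have h2 : |s.im| ≤ h / 2 := by simpa using (Complex.abs_im_le_norm _).trans hs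
  rw [div_I_mul_re hh, div_I_mul_im hh, abs_neg, abs_div, abs_of_pos hh, abs_div, abs_of_pos hh]
  have h3 : |(|s.re| / h - |x| / h)| ≤ 1 / 2 := by
    rw [← sub_div, abs_div, abs_of_pos hh, div_le_iff₀ hh]
    linarith [abs_abs_sub_abs_le_abs_sub s.re x]
  refine ⟨by rw [div_le_iff₀ hh]; linarith, ?_, h3⟩
  have h4 := (abs_le.1 h3).2
  have h5 : |x| / h = h⁻¹ * |x| := by field_simp
  have h6 : 0 < h⁻¹ := by positivity
  rw [h5] at h4
  nlinarith [abs_nonneg x]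

theorem exists_norm_regInvGamma_le : ∃ C : ℝ, 0 < C ∧ ∃ M : ℕ, ∀ (s : ℂ) (x : ℝ), ‖s - x‖ ≤ h / 2 →
    ‖regInvGamma h s‖ ≤ C * (1 + |x|) ^ M * Real.exp (Real.pi / (2 * h) * |x|) := by
  obtain ⟨C, hC, M, H⟩ := exists_norm_inv_Gamma_one_add_le
  refine ⟨C * (2 + h⁻¹) ^ M * Real.exp Real.pi, by positivity, M, fun s x hs => ?_⟩
  obtain ⟨h1, h2, h3⟩ := div_I_mul_bounds hh hs
  refine (H _ h1).trans ?_
  set t := |(s / (Complex.I * h)).im|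
  have h4 : t ≤ |x| / h + 1 / 2 := by linarith [(abs_le.1 h3).2]
  calc C * (1 + t) ^ M * Real.exp (Real.pi / 2 * t) ≤ C * ((2 + h⁻¹) * (1 + |x|)) ^ M *
        Real.exp (Real.pi + Real.pi / (2 * h) * |x|) := by
        gcongr
        have : Real.pi / (2 * h) * |x| = Real.pi / 2 * (|x| / h) := by field_simp
        rw [this]
        nlinarith [Real.pi_pos]
    _ = _ := by rw [Real.exp_add, mul_pow]; ring

theorem exists_norm_regFactor_le : ∃ C : ℝ, 0 < C ∧ ∃ M : ℕ, ∀ (s : ℂ) (x : ℝ), ‖s - x‖ ≤ h / 2 →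
    ‖regFactor h s‖ ≤ C * (1 + |x|) ^ M * Real.exp (-(Real.pi / (2 * h)) * |x|) := by
  obtain ⟨C, hC, M, H⟩ := exists_norm_Gamma_le (a := 1 / 2) (by norm_num) (3 / 2)
  refine ⟨h * Real.exp (|Real.log h| * (h / 2 / h)) * C * (2 + h⁻¹) ^ M * Real.exp Real.pi,
    by positivity, M, fun s x hs => ?_⟩
  obtain ⟨h1, h2, h3⟩ := div_I_mul_bounds hh hs
  have g1 := abs_le.1 h1
  have h5 := H (1 + s / (Complex.I * h)) (by rw [Complex.add_re, Complex.one_re]; linarith)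
    (by rw [Complex.add_re, Complex.one_re]; linarith)
  rw [Complex.add_im, Complex.one_im, zero_add] at h5
  set t := |(s / (Complex.I * h)).im|
  have h4 : |x| / h - 1 / 2 ≤ t := by linarith [(abs_le.1 h3).1]
  have h6 := norm_hbar_cpow_le hh (δ := h / 2)
    (by simpa using (Complex.abs_im_le_norm _).trans hs : |s.im| ≤ h / 2)
  have h7 : ‖Complex.I * (h : ℂ)‖ = h := by simp [abs_of_pos hh]
  rw [regFactor, norm_mul (Complex.I * (h : ℂ)), h7, norm_mul]
  calc _ ≤ h * (Real.exp (|Real.log h| * (h / 2 / h)) * (C * ((2 + h⁻¹) * (1 + |x|)) ^ M *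
        Real.exp (Real.pi + -(Real.pi / (2 * h)) * |x|))) := by
        gcongr
        refine h5.trans ?_
        gcongr
        have : -(Real.pi / (2 * h)) * |x| = -(Real.pi / 2 * (|x| / h)) := by field_simp
        rw [this]
        nlinarith [Real.pi_pos]
    _ = _ := by rw [Real.exp_add, mul_pow]; ring

omit hh in
theorem differentiable_regInvGamma (h : ℝ) : Differentiable ℂ (regInvGamma h) :=
  Complex.differentiable_one_div_Gamma.comp (by fun_prop)

theorem differentiableAt_regFactor {s : ℂ} {x : ℝ} (hs : ‖s - x‖ ≤ h / 2) :
    DifferentiableAt ℂ (regFactor h) s := by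
  unfold regFactor
  have h0 : (h : ℂ) ≠ 0 := by exact_mod_cast hh.ne'
  refine DifferentiableAt.const_mul (DifferentiableAt.mul ?_ ?_) _
  · exact (DifferentiableAt.const_cpow (by fun_prop) (Or.inl h0))
  · refine DifferentiableAt.comp s (Complex.differentiableAt_Gamma _ fun m hm => ?_) (by fun_prop)
    have g1 := (abs_le.1 (div_I_mul_bounds hh hs).1).1
    have g2 := congrArg Complex.re hm
    rw [Complex.add_re, Complex.one_re, Complex.neg_re, Complex.natCast_re] at g2
    have : (0 : ℝ) ≤ m := Nat.cast_nonneg m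
    linarith

theorem mbFactor_eq {s : ℂ} (hs : s ≠ 0) : mbFactor h s = regFactor h s * s⁻¹ := by
  have h0 : (h : ℂ) ≠ 0 := by exact_mod_cast hh.ne'
  have h1 : s / (Complex.I * h) ≠ 0 := div_ne_zero hs (mul_ne_zero Complex.I_ne_zero h0)
  rw [mbFactor, regFactor, add_comm, Complex.Gamma_add_one _ h1]
  field_simp

theorem inv_Gamma_eq (s : ℂ) : (Complex.Gamma (s / (Complex.I * h)))⁻¹ =
    s / (Complex.I * h) * regInvGamma h s := by
  have h0 : (h : ℂ) ≠ 0 := by exact_mod_cast hh.ne'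
  rcases eq_or_ne s 0 with rfl | hs
  · simp
  have h1 : s / (Complex.I * h) ≠ 0 := div_ne_zero hs (mul_ne_zero Complex.I_ne_zero h0)
  rw [regInvGamma, add_comm, Complex.Gamma_add_one _ h1, mul_inv, ← mul_assoc, mul_inv_cancel₀ h1,
    one_mul]

end Reg

/-- The Mellin-Barnes kernel, with its poles removed, on the contour at the distance `ħ/24 sin θ`
from the real axis, and with a Gaussian factor. It is analytic in all the variables. -/
noncomputable def regKernel (h : ℝ) {n : ℕ} (y : ℂ × (Fin n → ℂ) × (Fin (n + 1) → ℂ)) : ℂ :=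
  Complex.exp (-y.1 ^ 2) *
    ((∏ a, ∏ b ∈ Finset.Ioi a, regInvGamma h (y.2.1 b - y.2.1 a)) *
      ((∏ a, ∏ b ∈ Finset.Ioi a, regInvGamma h (y.2.2 a - y.2.2 b)) *
        ∏ a, ∏ b, regFactor h (y.2.2 b - y.2.1 a + Complex.I * (h / 24 * Complex.sin y.1))))

/-- The complexification of a real point. -/
def ofRealPoint {n : ℕ} (θ : ℝ) (u : Fin n → ℝ) (v : Fin (n + 1) → ℝ) :
    ℂ × (Fin n → ℂ) × (Fin (n + 1) → ℂ) := (θ, fun a => u a, fun b => v b)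

theorem norm_sub_ofRealPoint {n : ℕ} {θ : ℝ} {u : Fin n → ℝ} {v : Fin (n + 1) → ℝ}
    {y : ℂ × (Fin n → ℂ) × (Fin (n + 1) → ℂ)} {ρ : ℝ} (hy : y ∈ Metric.ball (ofRealPoint θ u v) ρ) :
    ‖y.1 - θ‖ ≤ ρ ∧ (∀ a, ‖y.2.1 a - u a‖ ≤ ρ) ∧ ∀ b, ‖y.2.2 b - v b‖ ≤ ρ := by
  rw [mem_ball_iff_norm] at hy
  have h1 : ‖y.1 - θ‖ ≤ ‖y - ofRealPoint θ u v‖ := norm_fst_le (y - ofRealPoint θ u v)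
  have h2 : ‖(y - ofRealPoint θ u v).2‖ ≤ ‖y - ofRealPoint θ u v‖ := norm_snd_le _
  have h3 : ‖(y - ofRealPoint θ u v).2.1‖ ≤ ‖(y - ofRealPoint θ u v).2‖ := norm_fst_le _
  have h4 : ‖(y - ofRealPoint θ u v).2.2‖ ≤ ‖(y - ofRealPoint θ u v).2‖ := norm_snd_le _
  refine ⟨by linarith, fun a => ?_, fun b => ?_⟩
  · have : ‖y.2.1 a - u a‖ ≤ ‖(y - ofRealPoint θ u v).2.1‖ :=
      norm_le_pi_norm ((y - ofRealPoint θ u v).2.1) a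
    linarith
  · have : ‖y.2.2 b - v b‖ ≤ ‖(y - ofRealPoint θ u v).2.2‖ :=
      norm_le_pi_norm ((y - ofRealPoint θ u v).2.2) b
    linarith

section RegKernel
variable {h : ℝ} (hh : 0 < h)
include hh

/-- Each of `u` and `v` contributes at most `ħ/8`, and the depth at most `3ħ/24`, since `|sin| ≤ 3`
on the unit strip. The total `3ħ/8` is below `ħ/2`, which accounts for the constant `24` and the
radius `min 1 (ħ/8)`. -/
theorem norm_sub_arg_le {θ u₀ v₀ : ℝ} {t u v : ℂ} (h1 : ‖t - θ‖ ≤ min 1 (h / 8))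
    (h2 : ‖u - u₀‖ ≤ min 1 (h / 8)) (h3 : ‖v - v₀‖ ≤ min 1 (h / 8)) :
    ‖v - u + Complex.I * (h / 24 * Complex.sin t) - (v₀ - u₀ : ℝ)‖ < h / 2 := by
  have e : v - u + Complex.I * (h / 24 * Complex.sin t) - (v₀ - u₀ : ℝ) =
      (v - v₀) - (u - u₀) + Complex.I * (h / 24 * Complex.sin t) := by push_cast; ring
  have h4 : ‖Complex.sin t‖ ≤ 3 := norm_sin_le (by
    have := (Complex.abs_im_le_norm _).trans (h1.trans (min_le_left _ _)); simpa using this)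
  have h5 : ‖Complex.I * (h / 24 * Complex.sin t)‖ ≤ h / 24 * 3 := by
    rw [norm_mul, Complex.norm_I, one_mul, norm_mul, norm_div, Complex.norm_real,
      Real.norm_of_nonneg hh.le]
    norm_num
    gcongr
  rw [e]
  have := min_le_right 1 (h / 8)
  linarith [norm_add_le ((v - v₀) - (u - u₀)) (Complex.I * (h / 24 * Complex.sin t)),
    norm_sub_le (v - v₀) (u - u₀)]

omit hh in
theorem norm_sub_sub_le {u₀ v₀ : ℝ} {u v : ℂ} (h2 : ‖u - u₀‖ ≤ min 1 (h / 8))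
    (h3 : ‖v - v₀‖ ≤ min 1 (h / 8)) : ‖v - u - (v₀ - u₀ : ℝ)‖ ≤ h / 2 := by
  have e : v - u - (v₀ - u₀ : ℝ) = (v - v₀) - (u - u₀) := by push_cast; ring
  rw [e]
  have h5 := min_le_right 1 (h / 8)
  have h0 := (norm_nonneg _).trans h2
  linarith [norm_sub_le (v - v₀) (u - u₀)]

theorem analyticOnNhd_regKernel {n : ℕ} (θ : ℝ) (u : Fin n → ℝ) (v : Fin (n + 1) → ℝ) :
    AnalyticOnNhd ℂ (regKernel h (n := n)) (Metric.ball (ofRealPoint θ u v) (min 1 (h / 8))) := by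
  intro y hy
  obtain ⟨h1, h2, h3⟩ := norm_sub_ofRealPoint hy
  have hg : ∀ s, AnalyticAt ℂ (regInvGamma h) s := fun s =>
    (differentiable_regInvGamma h).analyticAt s
  have hf : ∀ a b, AnalyticAt ℂ (regFactor h)
      (y.2.2 b - y.2.1 a + Complex.I * (h / 24 * Complex.sin y.1)) := fun a b => by
    rw [Complex.analyticAt_iff_eventually_differentiableAt]
    filter_upwards [Metric.isOpen_ball.mem_nhds
      (mem_ball_iff_norm.2 (norm_sub_arg_le hh h1 (h2 a) (h3 b)))] with s hs
    exact differentiableAt_regFactor hh (mem_ball_iff_norm.1 hs).le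
  have e1 : AnalyticAt ℂ (fun y : ℂ × (Fin n → ℂ) × (Fin (n + 1) → ℂ) => y.1) y := analyticAt_fst
  have e2 : ∀ a, AnalyticAt ℂ (fun y : ℂ × (Fin n → ℂ) × (Fin (n + 1) → ℂ) => y.2.1 a) y := fun a =>
    ((ContinuousLinearMap.proj a).comp ((ContinuousLinearMap.fst ℂ _ _).comp
      (ContinuousLinearMap.snd ℂ ℂ ((Fin n → ℂ) × (Fin (n + 1) → ℂ))))).analyticAt y
  have e3 : ∀ a, AnalyticAt ℂ (fun y : ℂ × (Fin n → ℂ) × (Fin (n + 1) → ℂ) => y.2.2 a) y := fun a =>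
    ((ContinuousLinearMap.proj a).comp ((ContinuousLinearMap.snd ℂ _ _).comp
      (ContinuousLinearMap.snd ℂ ℂ ((Fin n → ℂ) × (Fin (n + 1) → ℂ))))).analyticAt y
  unfold regKernel
  refine AnalyticAt.mul ?_ (AnalyticAt.mul ?_ (AnalyticAt.mul ?_ ?_))
  · exact (e1.pow 2).neg.cexp
  · exact Finset.analyticAt_fun_prod _ fun a _ => Finset.analyticAt_fun_prod _ fun b _ =>
      (hg _).comp ((e2 b).sub (e2 a))
  · exact Finset.analyticAt_fun_prod _ fun a _ => Finset.analyticAt_fun_prod _ fun b _ =>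
      (hg _).comp ((e3 a).sub (e3 b))
  · exact Finset.analyticAt_fun_prod _ fun a _ => Finset.analyticAt_fun_prod _ fun b _ =>
      AnalyticAt.comp (hf a b) (f := fun y : ℂ × (Fin n → ℂ) × (Fin (n + 1) → ℂ) =>
        y.2.2 b - y.2.1 a + Complex.I * (h / 24 * Complex.sin y.1)) (((e3 b).sub (e2 a)).add
        (analyticAt_const.mul (analyticAt_const.mul
          ((Complex.differentiable_sin.analyticAt _).comp e1))))

omit hh in
-- The real reference points `ε a b` are prescribed only up to sign, so the lemma serves both orders
-- of subtraction, which differ between the `u` and the `v` factors.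
theorem norm_prod_Ioi_regInvGamma_le {C : ℝ} (hC : 0 < C) {M : ℕ} (H : ∀ (s : ℂ) (x : ℝ),
    ‖s - x‖ ≤ h / 2 → ‖regInvGamma h s‖ ≤ C * (1 + |x|) ^ M * Real.exp (Real.pi / (2 * h) * |x|))
    {n : ℕ} {u : Fin n → ℝ} {f : Fin n → Fin n → ℂ} {ε : Fin n → Fin n → ℝ}
    (hε : ∀ a b, |ε a b| = |u a - u b|)
    (hf : ∀ a b, ‖f a b - ε a b‖ ≤ h / 2) :
    ‖∏ a, ∏ b ∈ Finset.Ioi a, regInvGamma h (f a b)‖ ≤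
      (C * 2 ^ M * (1 + ‖u‖) ^ M) ^ (Finset.univ.sigma fun a : Fin n => Finset.Ioi a).card *
        Real.exp (Real.pi / (2 * h) * (spread u / 2)) := by
  rw [← sum_Ioi_abs_sub, mul_assoc C, ← mul_pow]
  rw [show 2 * (1 + ‖u‖) = 1 + (2 * ‖u‖ + 1) by ring]
  refine norm_prod_prod_le_of_exp_bound (fun a => Finset.Ioi a) fun a b _ => ?_
  refine (H _ _ (hf a b)).trans ?_
  rw [hε]
  have := abs_sub_le_two_mul_norm u a b
  gcongr
  linarith

/-- The regularised kernel decays in `u` and `θ`, with polynomial growth in `v`. -/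
theorem exists_norm_regKernel_le (n k : ℕ) : ∃ C : ℝ, 0 < C ∧ ∃ M : ℕ, ∀ (θ : ℝ) (u : Fin n → ℝ)
    (v : Fin (n + 1) → ℝ), ∀ y ∈ Metric.ball (ofRealPoint θ u v) (min 1 (h / 8)),
      (1 + |θ|) ^ k * (1 + ‖u‖) ^ k * ‖regKernel h y‖ ≤ C * (1 + ‖v‖) ^ M := by
  obtain ⟨C₁, hC₁, H₁⟩ := exists_one_add_abs_pow_mul_norm_exp_neg_sq_le k
  obtain ⟨C₂, hC₂, M₂, H₂⟩ := exists_norm_regInvGamma_le hh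
  obtain ⟨C₃, hC₃, M₃, H₃⟩ := exists_norm_regFactor_le hh
  set c := (Finset.univ.sigma fun a : Fin n => Finset.Ioi a).card
  set c' := (Finset.univ.sigma fun a : Fin (n + 1) => Finset.Ioi a).card
  set d := (Finset.univ.sigma fun _ : Fin n => (Finset.univ : Finset (Fin (n + 1)))).card
  -- The exponent collects all powers of `1 + ‖u‖`: the required `k`, those of the `1/Γ` factors,
  -- and those of the cross factors.
  obtain ⟨C₄, hC₄, H₄⟩ := exists_exp_interlacing_le (κ := Real.pi / (2 * h)) (by positivity)
    (k + M₂ * c + M₃ * d)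
  set κ := Real.pi / (2 * h) with hκ
  refine ⟨C₁ * (C₂ * 2 ^ M₂) ^ c * (C₂ * 2 ^ M₂) ^ c' * C₃ ^ d * C₄, by positivity,
    M₂ * c' + M₃ * d + (k + M₂ * c + M₃ * d), fun θ u v y hy => ?_⟩
  obtain ⟨h1, h2, h3⟩ := norm_sub_ofRealPoint hy
  have b1 := H₁ y.1 θ (h1.trans (min_le_left _ _))
  have b2 := norm_prod_Ioi_regInvGamma_le hC₂ H₂ (u := u) (f := fun a b => y.2.1 b - y.2.1 a)
    (ε := fun a b => u b - u a) (fun a b => abs_sub_comm _ _) fun a b => norm_sub_sub_le (h2 a) (h2 b)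
  have b3 := norm_prod_Ioi_regInvGamma_le hC₂ H₂ (u := v) (f := fun a b => y.2.2 a - y.2.2 b)
    (ε := fun a b => v a - v b) (fun a b => rfl) fun a b => norm_sub_sub_le (h3 b) (h3 a)
  have b4 : ‖∏ a, ∏ b, regFactor h (y.2.2 b - y.2.1 a + Complex.I * (h / 24 * Complex.sin y.1))‖ ≤
      (C₃ * (1 + (‖u‖ + ‖v‖)) ^ M₃) ^ d * Real.exp (-κ * crossDist u v) := by
    refine norm_prod_prod_le_of_exp_bound (fun _ => Finset.univ)
      (f := fun a b => regFactor h (y.2.2 b - y.2.1 a + Complex.I * (h / 24 * Complex.sin y.1)))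
      (x := fun a b => |v b - u a|) fun a b _ => ?_
    refine (H₃ _ _ (norm_sub_arg_le hh h1 (h2 a) (h3 b)).le).trans ?_
    have := abs_sub_le_norm_add_norm u v a b
    gcongr
  have b5 : 1 + (‖u‖ + ‖v‖) ≤ (1 + ‖u‖) * (1 + ‖v‖) := by nlinarith [norm_nonneg u, norm_nonneg v]
  have b6 := H₄ u v
  rw [regKernel, norm_mul, norm_mul, norm_mul]
  calc _ = ((1 + |θ|) ^ k * ‖Complex.exp (-y.1 ^ 2)‖) * ((1 + ‖u‖) ^ k *
        (‖∏ a, ∏ b ∈ Finset.Ioi a, regInvGamma h (y.2.1 b - y.2.1 a)‖ *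
        (‖∏ a, ∏ b ∈ Finset.Ioi a, regInvGamma h (y.2.2 a - y.2.2 b)‖ *
        ‖∏ a, ∏ b, regFactor h (y.2.2 b - y.2.1 a + Complex.I * (h / 24 * Complex.sin y.1))‖))) := by
        ring
    _ ≤ C₁ * ((1 + ‖u‖) ^ k *
        (((C₂ * 2 ^ M₂ * (1 + ‖u‖) ^ M₂) ^ c * Real.exp (κ * (spread u / 2))) *
        (((C₂ * 2 ^ M₂ * (1 + ‖v‖) ^ M₂) ^ c' * Real.exp (κ * (spread v / 2))) *
        ((C₃ * ((1 + ‖u‖) * (1 + ‖v‖)) ^ M₃) ^ d * Real.exp (-κ * crossDist u v))))) := by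
        refine mul_le_mul b1 ?_ (by positivity) hC₁.le
        refine mul_le_mul_of_nonneg_left ?_ (by positivity)
        refine mul_le_mul b2 ?_ (by positivity) (by positivity)
        refine mul_le_mul b3 (b4.trans ?_) (by positivity) (by positivity)
        gcongr
    _ = C₁ * (C₂ * 2 ^ M₂) ^ c * (C₂ * 2 ^ M₂) ^ c' * C₃ ^ d * (1 + ‖v‖) ^ (M₂ * c' + M₃ * d) *
        ((1 + ‖u‖) ^ (k + M₂ * c + M₃ * d) *
          Real.exp (κ * (spread u / 2 + spread v / 2 - crossDist u v))) := by
        rw [show κ * (spread u / 2 + spread v / 2 - crossDist u v) = κ * (spread u / 2) +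
          κ * (spread v / 2) + -κ * crossDist u v by ring, Real.exp_add, Real.exp_add,
          mul_pow (1 + ‖u‖) (1 + ‖v‖)]
        ring
    _ ≤ C₁ * (C₂ * 2 ^ M₂) ^ c * (C₂ * 2 ^ M₂) ^ c' * C₃ ^ d * (1 + ‖v‖) ^ (M₂ * c' + M₃ * d) *
        (C₄ * (1 + ‖v‖) ^ (k + M₂ * c + M₃ * d)) := by gcongr
    _ = _ := by ring

end RegKernel

/-! ### The step kernel as a sum over simple poles. -/

section Algebra
variable {h : ℝ} (hh : 0 < h)
include hh

/-- Each `1/Γ(s/(iħ))` vanishes at `s = 0`; collecting these zeros gives a Vandermonde product,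
which the Cauchy determinant consumes. The minus sign comes from the order `u_a - u_b`. -/
theorem halfDensity_eq {n : ℕ} (u : Fin n → ℝ) :
    halfDensity h u = (∏ a : Fin n, ∏ _b ∈ Finset.Ioi a, (-(1 / (Complex.I * h)) : ℂ)) *
      vdm (fun a => (u a : ℂ)) * ∏ a, ∏ b ∈ Finset.Ioi a, regInvGamma h ((u a : ℂ) - u b) := by
  simp only [halfDensity, vdm, ← Finset.prod_mul_distrib]
  refine Finset.prod_congr rfl fun a _ => Finset.prod_congr rfl fun b _ => ?_
  rw [inv_Gamma_eq hh]; ring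

theorem halfDensity'_eq {n : ℕ} (u : Fin n → ℝ) :
    halfDensity' h u = (∏ a : Fin n, ∏ _b ∈ Finset.Ioi a, (1 / (Complex.I * h) : ℂ)) *
      vdm (fun a => (u a : ℂ)) * ∏ a, ∏ b ∈ Finset.Ioi a, regInvGamma h ((u b : ℂ) - u a) := by
  simp only [halfDensity', vdm, ← Finset.prod_mul_distrib]
  refine Finset.prod_congr rfl fun a _ => Finset.prod_congr rfl fun b _ => ?_
  rw [inv_Gamma_eq hh]; ring

omit hh in
/-- The constant in `crossGamma_mul_eq_sum`. -/
noncomputable def stepConst (h : ℝ) (n : ℕ) : ℂ :=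
  (∏ a : Fin n, ∏ _b ∈ Finset.Ioi a, (1 / (Complex.I * h) : ℂ)) *
    (∏ a : Fin (n + 1), ∏ _b ∈ Finset.Ioi a, (-(1 / (Complex.I * h)) : ℂ)) * borderSign n

/-- The kernel of one step, as a sum of products of simple poles. -/
theorem crossGamma_mul_eq_sum {n : ℕ} {θ δ : ℝ} (hδ : 0 < δ) (hθ : δ = h / 24 * Real.sin θ)
    (u : Fin n → ℝ) (v : Fin (n + 1) → ℝ) :
    crossGamma h δ u v * halfDensity' h u * halfDensity h v =
      Complex.exp ((θ : ℂ) ^ 2) * stepConst h n * ∑ σ : Equiv.Perm (Fin (n + 1)),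
        ((Equiv.Perm.sign σ : ℤ) : ℂ) * (regKernel h (ofRealPoint θ u v) *
          ∏ a : Fin n, (((v (σ a.succ) - u a : ℝ) : ℂ) + Complex.I * δ)⁻¹) := by
  have hs : ∀ a b, ((v b : ℂ) - u a + Complex.I * δ) ≠ 0 := fun a b hab => by
    have := congrArg Complex.im hab
    simp at this
    exact hδ.ne' this
  have hδ' : ((h : ℂ) / 24 * Complex.sin θ) = δ := by rw [hθ]; push_cast; ring
  have h1 : crossGamma h δ u v = (∏ a, ∏ b, regFactor h ((v b : ℂ) - u a + Complex.I * δ)) *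
      (∏ a, ∏ b, ((v b : ℂ) - u a + Complex.I * δ))⁻¹ := by
    simp only [crossGamma, ← Finset.prod_inv_distrib, ← Finset.prod_mul_distrib]
    exact Finset.prod_congr rfl fun a _ => Finset.prod_congr rfl fun b _ => mbFactor_eq hh (hs a b)
  -- The nodes are `w_a = u_a - iδ`. Their common shift leaves the Vandermonde product unchanged and
  -- turns `v_b - w_a` into the required denominators.
  have h2 := vdm_mul_vdm (fun a => (u a : ℂ) - Complex.I * δ) (fun b => (v b : ℂ)) fun a b hab =>
    hs a b (by rw [hab]; ring)
  have h3 : vdm (fun a => (u a : ℂ) - Complex.I * δ) = vdm fun a => (u a : ℂ) := by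
    simp [vdm]
  have h4 : ∏ a, ∏ b, ((v b : ℂ) - u a + Complex.I * δ) ≠ 0 :=
    Finset.prod_ne_zero_iff.2 fun a _ => Finset.prod_ne_zero_iff.2 fun b _ => hs a b
  -- The factor `exp(θ²)` undoes the Gaussian in `regKernel`, which is there only to give decay in
  -- `θ`.
  have h5 : Complex.exp ((θ : ℂ) ^ 2) * Complex.exp (-(θ : ℂ) ^ 2) = 1 := by
    rw [← Complex.exp_add]; simp
  have h6 : ∀ a b, (v b : ℂ) - (u a - Complex.I * δ) = v b - u a + Complex.I * δ := fun a b => by ring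
  simp only [h3, h6] at h2
  simp only [mul_left_comm _ (regKernel h (ofRealPoint θ u v)) _, ← Finset.mul_sum]
  rw [h1, halfDensity_eq hh, halfDensity'_eq hh, regKernel, stepConst]
  simp only [ofRealPoint, hδ']
  push_cast
  set S := ∑ σ : Equiv.Perm (Fin (n + 1)), ((Equiv.Perm.sign σ : ℤ) : ℂ) *
    ∏ a : Fin n, ((v (σ a.succ) : ℂ) - u a + Complex.I * δ)⁻¹
  set Q := ∏ a, ∏ b, ((v b : ℂ) - u a + Complex.I * δ)
  set V₁ := vdm fun a => (u a : ℂ)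
  set V₂ := vdm fun b => (v b : ℂ)
  generalize (∏ a, ∏ b, regFactor h ((v b : ℂ) - u a + Complex.I * δ)) = R
  generalize (∏ a, ∏ b ∈ Finset.Ioi a, regInvGamma h ((u b : ℂ) - u a)) = R₁
  generalize (∏ a, ∏ b ∈ Finset.Ioi a, regInvGamma h ((v a : ℂ) - v b)) = R₂
  generalize (∏ a : Fin n, ∏ _b ∈ Finset.Ioi a, (1 / (Complex.I * h) : ℂ)) = c₁
  generalize (∏ a : Fin (n + 1), ∏ _b ∈ Finset.Ioi a, (-(1 / (Complex.I * h)) : ℂ)) = c₂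
  generalize borderSign n = c₃ at *
  calc _ = c₁ * c₂ * R * R₁ * R₂ * Q⁻¹ * (V₁ * V₂) := by ring
    _ = c₁ * c₂ * R * R₁ * R₂ * c₃ * S := by rw [h2]; field_simp
    _ = (Complex.exp ((θ : ℂ) ^ 2) * Complex.exp (-(θ : ℂ) ^ 2)) *
        (c₁ * c₂ * R * R₁ * R₂ * c₃ * S) := by rw [h5, one_mul]
    _ = _ := by ring

end Algebra

/-! ### Coordinates adapted to the poles. -/

section Chart
variable {P : Type} [NormedAddCommGroup P] [NormedSpace ℝ P] {n : ℕ}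

/-- Coordinates on `ℝ^(n+1)` adapted to the poles of the kernel: `v (σ (a + 1)) = u a + r a` and
`∑ v = τ + ∑ u`. -/
def chartPoint (σ : Equiv.Perm (Fin (n + 1))) (u : Fin n → ℝ) (τ : ℝ) (r : Fin n → ℝ) :
    Fin (n + 1) → ℝ :=
  fun b => (Fin.cons (τ - ∑ a, r a) (fun a => u a + r a) : Fin (n + 1) → ℝ) (σ.symm b)

theorem chartPoint_succ (σ : Equiv.Perm (Fin (n + 1))) (u : Fin n → ℝ) (τ : ℝ) (r : Fin n → ℝ)
    (a : Fin n) : chartPoint σ u τ r (σ a.succ) = u a + r a := by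
  simp [chartPoint]

theorem sum_chartPoint (σ : Equiv.Perm (Fin (n + 1))) (u : Fin n → ℝ) (τ : ℝ) (r : Fin n → ℝ) :
    ∑ b, chartPoint σ u τ r b = τ + ∑ a, u a := by
  unfold chartPoint
  rw [Equiv.sum_comp σ.symm (Fin.cons (τ - ∑ a, r a) (fun a => u a + r a) : Fin (n + 1) → ℝ),
    Fin.sum_univ_succ]
  simp [Finset.sum_add_distrib]

theorem continuous_chartPoint (σ : Equiv.Perm (Fin (n + 1))) :
    Continuous fun q : (Fin n → ℝ) × ℝ × (Fin n → ℝ) => chartPoint σ q.1 q.2.1 q.2.2 := by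
  refine continuous_pi fun b => ?_
  unfold chartPoint
  refine Fin.cases ?_ (fun a => ?_) (σ.symm b)
  · simp only [Fin.cons_zero]; fun_prop
  · simp only [Fin.cons_succ]; fun_prop

variable (P n) in
/-- The variables `((θ, (u, (τ, p))), r)`. -/
abbrev ChartSpace : Type := (ℝ × ((Fin n → ℝ) × (ℝ × P))) × (Fin n → ℝ)

/-- `chartPoint` as a continuous linear map. -/
def chartCLM (σ : Equiv.Perm (Fin (n + 1))) : ChartSpace P n →L[ℝ] (Fin (n + 1) → ℝ) where
  toFun x := chartPoint σ x.1.2.1 x.1.2.2.1 x.2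
  map_add' x y := by
    ext b
    simp only [chartPoint, Pi.add_apply]
    refine Fin.cases ?_ (fun a => ?_) (σ.symm b)
    · simp [Finset.sum_add_distrib]; ring
    · simp; ring
  map_smul' c x := by
    ext b
    simp only [chartPoint, Pi.smul_apply, RingHom.id_apply]
    refine Fin.cases ?_ (fun a => ?_) (σ.symm b)
    · simp [← Finset.mul_sum]; ring
    · simp; ring
  cont := (continuous_chartPoint σ).comp (by fun_prop : Continuous fun x : ChartSpace P n =>
    (x.1.2.1, x.1.2.2.1, x.2))

/-- The complexification of the variables of the kernel. -/
noncomputable def chartComplex (σ : Equiv.Perm (Fin (n + 1))) :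
    ChartSpace P n →L[ℝ] ℂ × (Fin n → ℂ) × (Fin (n + 1) → ℂ) :=
  (Complex.ofRealCLM.comp ((ContinuousLinearMap.fst ℝ _ _).comp (ContinuousLinearMap.fst ℝ _ _))).prod
    ((ContinuousLinearMap.pi fun a => Complex.ofRealCLM.comp ((ContinuousLinearMap.proj a).comp
      ((ContinuousLinearMap.fst ℝ _ _).comp ((ContinuousLinearMap.snd ℝ _ _).comp
        (ContinuousLinearMap.fst ℝ _ _))))).prod
    (ContinuousLinearMap.pi fun b => Complex.ofRealCLM.comp ((ContinuousLinearMap.proj b).comp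
      (chartCLM σ))))

omit [NormedSpace ℝ P] in
-- Both `r_a = v_{σ(a+1)} - u_a` and `τ = ∑ v - ∑ u` are controlled by `u` and `v`. Decay in `θ`,
-- `u` and `(v, p)` thus implies decay in all chart variables.
theorem one_add_norm_chart_le (σ : Equiv.Perm (Fin (n + 1))) (x : ChartSpace P n) :
    1 + ‖x‖ ≤ (n + 2) * ((1 + |x.1.1|) * (1 + ‖x.1.2.1‖) *
      (1 + ‖(chartPoint σ x.1.2.1 x.1.2.2.1 x.2, x.1.2.2.2)‖)) := by
  obtain ⟨⟨θ, u, τ, p⟩, r⟩ := x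
  set v := chartPoint σ u τ r with hv
  have h1 : ‖v‖ ≤ ‖(v, p)‖ := norm_fst_le (v, p)
  have h2 : ‖p‖ ≤ ‖(v, p)‖ := norm_snd_le (v, p)
  set N := ‖(v, p)‖
  have hu := norm_nonneg u
  have hN : 0 ≤ N := norm_nonneg _
  have hvn := norm_nonneg v
  have hr : ‖r‖ ≤ ‖v‖ + ‖u‖ := by
    refine (pi_norm_le_iff_of_nonneg (by positivity)).2 fun a => ?_
    have e : r a = v (σ a.succ) - u a := by rw [hv, chartPoint_succ]; ring
    rw [e]
    exact (norm_sub_le _ _).trans (add_le_add (norm_le_pi_norm _ _) (norm_le_pi_norm _ _))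
  have hτ : |τ| ≤ (n + 1) * ‖v‖ + n * ‖u‖ := by
    have e : τ = ∑ b, v b - ∑ a, u a := by rw [hv, sum_chartPoint]; ring
    have i1 : |∑ b, v b| ≤ (n + 1) * ‖v‖ := by
      refine (Finset.abs_sum_le_sum_abs _ _).trans ((Finset.sum_le_card_nsmul _ _ ‖v‖
        fun b _ => norm_le_pi_norm v b).trans (by simp))
    have i2 : |∑ a, u a| ≤ n * ‖u‖ := by
      refine (Finset.abs_sum_le_sum_abs _ _).trans ((Finset.sum_le_card_nsmul _ _ ‖u‖
        fun b _ => norm_le_pi_norm u b).trans (by simp))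
    rw [e]
    exact (abs_sub _ _).trans (add_le_add i1 i2)
  have hn : (0 : ℝ) ≤ n := Nat.cast_nonneg n
  have hT := abs_nonneg θ
  have key : ∀ y, y ≤ |θ| + (n + 1) * ‖u‖ + (n + 1) * N →
      1 + y ≤ (n + 2) * ((1 + |θ|) * (1 + ‖u‖) * (1 + N)) := fun y hy => by
    have a1 : 1 + |θ| + ‖u‖ + N ≤ (1 + |θ|) * (1 + ‖u‖) * (1 + N) := by
      have : 0 ≤ |θ| * ‖u‖ + |θ| * N + ‖u‖ * N + |θ| * ‖u‖ * N := by positivity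
      nlinarith
    nlinarith
  have g1 : 0 ≤ (n : ℝ) * ‖u‖ := by positivity
  have g2 : 0 ≤ (n : ℝ) * N := by positivity
  have g3 : (n : ℝ) * ‖v‖ ≤ n * N := by gcongr
  have : ‖(((θ, (u, (τ, p))), r) : ChartSpace P n)‖ ≤ |θ| + (n + 1) * ‖u‖ + (n + 1) * N := by
    simp only [Prod.norm_def, Real.norm_eq_abs, sup_le_iff]
    refine ⟨⟨?_, ?_, ?_, ?_⟩, ?_⟩ <;> linarith
  exact key _ this

/-- The kernel times a Schwartz function is a Schwartz function of all the variables. -/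
theorem exists_schwartz_regKernel_mul {h : ℝ} (hh : 0 < h) (σ : Equiv.Perm (Fin (n + 1)))
    (f : 𝓢((Fin (n + 1) → ℝ) × P, ℂ)) : ∃ g : 𝓢(ChartSpace P n, ℂ), ∀ θ u τ p r,
      g ((θ, (u, (τ, p))), r) = regKernel h (ofRealPoint θ u (chartPoint σ u τ r)) *
        f (chartPoint σ u τ r, p) := by
  set π : ChartSpace P n →L[ℝ] (Fin (n + 1) → ℝ) × P := (chartCLM σ).prod
    ((ContinuousLinearMap.snd ℝ _ _).comp ((ContinuousLinearMap.snd ℝ _ _).comp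
      ((ContinuousLinearMap.snd ℝ _ _).comp (ContinuousLinearMap.fst ℝ _ _))))
  have hπ : ∀ x, π x = (chartPoint σ x.1.2.1 x.1.2.2.1 x.2, x.1.2.2.2) := fun x => rfl
  have hρ : 0 < min 1 (h / 8) := by positivity
  have hsm : ContDiff ℝ (⊤ : ℕ∞) (regKernel h ∘ chartComplex (P := P) σ) := by
    refine contDiff_iff_contDiffAt.2 fun x => ?_
    have h1 : AnalyticAt ℝ (regKernel h (n := n)) (chartComplex σ x) :=
      ((analyticOnNhd_regKernel hh x.1.1 x.1.2.1 (chartPoint σ x.1.2.1 x.1.2.2.1 x.2))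
        (chartComplex σ x) (Metric.mem_ball_self hρ)).restrictScalars
    exact (h1.contDiffAt (n := (⊤ : ℕ∞))).comp x (chartComplex (P := P) σ).contDiff.contDiffAt
  obtain ⟨g, hg⟩ := f.exists_mul_comp π hsm fun l k => by
    obtain ⟨C, hC⟩ := exists_norm_iteratedFDeriv_comp_le (chartComplex (P := P) σ) l _ hρ
    obtain ⟨C', hC', M, H⟩ := exists_norm_regKernel_le hh n k
    refine ⟨(n + 2 : ℝ) ^ k * |C| * C', k + M, fun x => ?_⟩
    set v := chartPoint σ x.1.2.1 x.1.2.2.1 x.2 with hv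
    set W := (1 + |x.1.1|) ^ k * (1 + ‖x.1.2.1‖) ^ k with hW
    have hWpos : 0 < W := by positivity
    have h1 := hC ℂ (regKernel h) x (C' * (1 + ‖v‖) ^ M / W)
      (analyticOnNhd_regKernel hh _ _ _) fun y hy => by
        rw [le_div_iff₀ hWpos, mul_comm]
        exact H _ _ _ y hy
    have h2 := one_add_norm_chart_le σ x
    rw [← hπ] at h2
    have h3 : ‖v‖ ≤ ‖π x‖ := norm_fst_le (π x)
    have h4 : 0 ≤ C' * (1 + ‖v‖) ^ M / W := by positivity
    calc (1 + ‖x‖) ^ k * ‖iteratedFDeriv ℝ l (regKernel h ∘ chartComplex σ) x‖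
        ≤ ((n + 2) * ((1 + |x.1.1|) * (1 + ‖x.1.2.1‖) * (1 + ‖π x‖))) ^ k *
          (|C| * (C' * (1 + ‖v‖) ^ M / W)) := by
          refine mul_le_mul (by gcongr) (h1.trans ?_) (norm_nonneg _) (by positivity)
          gcongr
          exact le_abs_self C
      _ = (n + 2) ^ k * |C| * C' * (1 + ‖π x‖) ^ k * (1 + ‖v‖) ^ M * (W / W) := by
          rw [mul_pow, mul_pow, mul_pow, hW]; ring
      _ = (n + 2) ^ k * |C| * C' * (1 + ‖π x‖) ^ k * (1 + ‖v‖) ^ M := by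
          rw [div_self hWpos.ne', mul_one]
      _ ≤ (n + 2) ^ k * |C| * C' * (1 + ‖π x‖) ^ k * (1 + ‖π x‖) ^ M := by gcongr
      _ = _ := by ring
  exact ⟨g, fun θ u τ p r => hg ((θ, (u, (τ, p))), r)⟩

/-- The change of variables `v = chartPoint σ u τ r` preserves the Lebesgue measure. -/
theorem measurePreserving_chartPoint (σ : Equiv.Perm (Fin (n + 1))) (u : Fin n → ℝ) :
    MeasurePreserving (fun q : ℝ × (Fin n → ℝ) => chartPoint σ u q.1 q.2)
      (volume.prod volume) volume := by
  -- The chart is a shear, which translates each fibre, followed by a relabelling of the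
  -- coordinates.
  have h1 : MeasurePreserving (fun q : (Fin n → ℝ) × ℝ => (q.1 + u, q.2 + -∑ a, q.1 a))
      (volume.prod volume) (volume.prod volume) :=
    MeasurePreserving.skew_product (g := fun (r : Fin n → ℝ) (τ : ℝ) => τ + -∑ a, r a)
      (measurePreserving_add_right volume u) (by fun_prop)
      (Filter.Eventually.of_forall fun r => (measurePreserving_add_right volume _).map_eq)
  have h2 := (volume_preserving_arrowCongr' σ (MeasurableEquiv.refl ℝ) (MeasurePreserving.id _)).comp
    (((volume_preserving_piFinSuccAbove (fun _ : Fin (n + 1) => ℝ) 0).symm _).comp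
      (Measure.measurePreserving_swap.comp (h1.comp Measure.measurePreserving_swap)))
  have h3 : (fun q : ℝ × (Fin n → ℝ) => chartPoint σ u q.1 q.2) =
      MeasurableEquiv.arrowCongr' σ (MeasurableEquiv.refl ℝ) ∘
        (MeasurableEquiv.piFinSuccAbove (fun _ => ℝ) 0).symm ∘ Prod.swap ∘
          (fun q : (Fin n → ℝ) × ℝ => (q.1 + u, q.2 + -∑ a, q.1 a)) ∘ Prod.swap := ?_
  · rw [h3]; exact h2
  funext q
  ext b
  obtain ⟨b, rfl⟩ := σ.surjective b
  have h4 : ∀ F : Fin (n + 1) → ℝ,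
      MeasurableEquiv.arrowCongr' σ (MeasurableEquiv.refl ℝ) F (σ b) = F b := fun F => by
    change F (σ.symm (σ b)) = F b
    rw [Equiv.symm_apply_apply]
  rw [Function.comp_apply, h4]
  revert b
  refine fun b _ => Fin.cases ?_ (fun a => ?_) b
  · simp [chartPoint, sub_eq_add_neg]
  · simp [chartPoint, add_comm]

theorem measurableEmbedding_chartPoint (σ : Equiv.Perm (Fin (n + 1))) (u : Fin n → ℝ) :
    MeasurableEmbedding (fun q : ℝ × (Fin n → ℝ) => chartPoint σ u q.1 q.2) := by
  refine Continuous.measurableEmbedding ((continuous_chartPoint σ).comp (by fun_prop :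
    Continuous fun q : ℝ × (Fin n → ℝ) => (u, q.1, q.2))) fun q q' hq => ?_
  have h1 : ∀ a, q.2 a = q'.2 a := fun a => by
    have := congrFun hq (σ a.succ)
    simp only [chartPoint_succ] at this
    linarith
  have h2 : q.1 = q'.1 := by
    have := congrArg (fun v : Fin (n + 1) → ℝ => ∑ b, v b) hq
    simp only [sum_chartPoint] at this
    linarith
  exact Prod.ext h2 (funext h1)

end Chart

/-! ### Holomorphy in the depth of the contour, and independence of it. -/

section Holomorphy

/-- Only the integrand needs a dominating function: Cauchy's estimate on smaller discs dominates its
derivative, and the derivative is measurable as a limit of difference quotients. -/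
theorem differentiableAt_integral_of_dominated {α : Type*} [MeasurableSpace α] {μ : Measure α}
    {F : ℂ → α → ℂ} {z₀ : ℂ} {ρ : ℝ} (hρ : 0 < ρ) {bound : α → ℝ}
    (hm : ∀ z ∈ Metric.ball z₀ ρ, AEStronglyMeasurable (F z) μ)
    (hd : ∀ a, DifferentiableOn ℂ (fun z => F z a) (Metric.ball z₀ ρ)) (hi : Integrable bound μ)
    (hb : ∀ z ∈ Metric.ball z₀ ρ, ∀ a, ‖F z a‖ ≤ bound a) :
    DifferentiableAt ℂ (fun z => ∫ a, F z a ∂μ) z₀ := by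
  have hz₀ : z₀ ∈ Metric.ball z₀ ρ := Metric.mem_ball_self hρ
  have hda : ∀ z ∈ Metric.ball z₀ ρ, ∀ a, DifferentiableAt ℂ (fun z => F z a) z := fun z hz a =>
    (hd a).differentiableAt (Metric.isOpen_ball.mem_nhds hz)
  have hd₀ : AEStronglyMeasurable (fun a => deriv (fun z => F z a) z₀) μ := by
    set t : ℕ → ℂ := fun k => ((ρ / 2 * (1 / ((k : ℝ) + 1)) : ℝ) : ℂ) with ht
    have t0 : Filter.Tendsto t Filter.atTop (𝓝 0) := by
      have := (tendsto_one_div_add_atTop_nhds_zero_nat (𝕜 := ℝ)).const_mul (ρ / 2)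
      rw [mul_zero] at this
      rw [← Complex.ofReal_zero]
      exact (Complex.continuous_ofReal.tendsto 0).comp this
    have tne : ∀ k, t k ≠ 0 := fun k => by
      simp only [ht]; exact_mod_cast (by positivity : ρ / 2 * (1 / ((k : ℝ) + 1)) ≠ 0)
    have tn : ∀ k, z₀ + t k ∈ Metric.ball z₀ ρ := fun k => by
      rw [mem_ball_iff_norm, add_sub_cancel_left, ht, Complex.norm_real, Real.norm_of_nonneg
        (by positivity)]
      have : 1 / ((k : ℝ) + 1) ≤ 1 := by
        rw [div_le_one (by positivity)]; linarith [(Nat.cast_nonneg k : (0 : ℝ) ≤ k)]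
      nlinarith
    refine aestronglyMeasurable_of_tendsto_ae Filter.atTop
      (f := fun k a => (t k)⁻¹ • (F (z₀ + t k) a - F z₀ a))
      (fun k => ((hm _ (tn k)).sub (hm _ hz₀)).const_smul (t k)⁻¹)
      (Filter.Eventually.of_forall fun a => ?_)
    have h1 := (hasDerivAt_iff_tendsto_slope_zero.1 (hda z₀ hz₀ a).hasDerivAt)
    exact h1.comp (tendsto_nhdsWithin_iff.2 ⟨t0, Filter.Eventually.of_forall tne⟩)
  have key := hasDerivAt_integral_of_dominated_loc_of_deriv_le (μ := μ) (F := F) (x₀ := z₀)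
    (s := Metric.ball z₀ (ρ / 2)) (F' := fun z a => deriv (fun z => F z a) z)
    (bound := fun a => bound a / (ρ / 4)) (Metric.ball_mem_nhds _ (by positivity))
    (Filter.eventually_of_mem (Metric.ball_mem_nhds _ hρ) hm)
    (hi.mono' (hm _ hz₀) (Filter.Eventually.of_forall (hb _ hz₀))) hd₀
    (Filter.Eventually.of_forall fun a z hz => ?_) (hi.div_const _)
    (Filter.Eventually.of_forall fun a z hz =>
      (hda z (Metric.ball_subset_ball (by linarith) hz) a).hasDerivAt)
  · exact key.2.differentiableAt
  · have hsub : Metric.closedBall z (ρ / 4) ⊆ Metric.ball z₀ ρ := fun y hy => by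
      rw [Metric.mem_ball] at hz ⊢
      rw [Metric.mem_closedBall] at hy
      linarith [dist_triangle y z z₀]
    refine Complex.norm_deriv_le_of_forall_mem_sphere_norm_le (by positivity) ?_
      fun y hy => hb y (hsub (Metric.sphere_subset_closedBall hy)) a
    exact ((hd a).mono hsub).diffContOnCl_ball subset_rfl

/-- A holomorphic function on the right half plane which is invariant under vertical translations
is constant on the positive real axis. -/
theorem eq_of_vertical_invariant {Ψ : ℂ → ℂ} (hd : ∀ z : ℂ, 0 < z.re → DifferentiableAt ℂ Ψ z)
    (hinv : ∀ (z : ℂ) (θ : ℝ), 0 < z.re → Ψ (z + Complex.I * θ) = Ψ z) {δ δ' : ℝ} (hδ : 0 < δ)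
    (hδ' : 0 < δ') : Ψ δ = Ψ δ' := by
  have h0 : ∀ z : ℂ, 0 < z.re → deriv Ψ z = 0 := fun z hz => by
    -- The vertical derivative equals `iΨ'(z)` and vanishes by invariance.
    have h1 : HasDerivAt (fun θ : ℝ => Ψ (z + Complex.I * θ)) (deriv Ψ z * Complex.I) 0 := by
      have h2 : HasDerivAt (fun θ : ℝ => z + Complex.I * (θ : ℂ)) Complex.I 0 := by
        simpa using ((Complex.ofRealCLM.hasDerivAt (x := 0)).const_mul Complex.I).const_add z
      have h3 : HasDerivAt Ψ (deriv Ψ z) (z + Complex.I * ((0 : ℝ) : ℂ)) := by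
        simpa using (hd z hz).hasDerivAt
      exact h3.comp (0 : ℝ) h2
    simp only [hinv z _ hz] at h1
    have := h1.unique (hasDerivAt_const (0 : ℝ) (Ψ z))
    simpa [Complex.I_ne_zero] using this
  have hopen : IsOpen {z : ℂ | 0 < z.re} := isOpen_lt continuous_const Complex.continuous_re
  have hconv : Convex ℝ {z : ℂ | 0 < z.re} := convex_halfSpace_re_gt 0
  refine hopen.is_const_of_deriv_eq_zero (𝕜 := ℂ) hconv.isPreconnected
    (fun z hz => (hd z hz).differentiableWithinAt) (fun z hz => h0 z hz) ?_ ?_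
  · simpa using hδ
  · simpa using hδ'

end Holomorphy

/-- A weight which decays, up to the natural exponential growth of the half density. -/
def IsTestWeight (h : ℝ) {n : ℕ} (w : (Fin n → ℝ) → ℂ) : Prop :=
  Measurable w ∧ ∀ m : ℕ, ∃ C : ℝ, 0 < C ∧ ∀ v,
    (1 + ‖v‖) ^ m * ‖w v‖ ≤ C * Real.exp (Real.pi / (2 * h) * (spread v / 2))

section Independence
variable {h : ℝ} (hh : 0 < h) {n : ℕ} {K : (Fin n → ℝ) → ℂ} {w : (Fin (n + 1) → ℝ) → ℂ}
include hh

/-- The decay of the step integrand in `spread v` cancels the permitted growth of the test weight.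
The resulting bound is uniform for `z` in a rectangle, as the holomorphy argument requires. -/
theorem exists_norm_stepIntegrand_mul_le (hK : IsWhittakerBounded h K) (hw : IsTestWeight h w)
    {δ₁ : ℝ} (hδ : 0 < δ₁) (δ₂ θ : ℝ) (x : Fin (n + 1) → ℝ) :
    ∃ C : ℝ, ∀ (z : ℂ) (q : (Fin n → ℝ) × (Fin (n + 1) → ℝ)), δ₁ ≤ z.re → z.re ≤ δ₂ →
      |z.im| ≤ θ → ‖stepIntegrand h K z x q.1 q.2 * w q.2‖ ≤
        C * (((1 + ‖q.1‖) ^ (n + 1))⁻¹ * ((1 + ‖q.2‖) ^ (n + 2))⁻¹) := by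
  obtain ⟨C, hC, M, H⟩ := exists_stepIntegrand_decay hh hK hδ δ₂ θ x (n + 1)
  obtain ⟨C', hC', H'⟩ := hw.2 (M + (n + 2))
  refine ⟨C * C', fun z ⟨u, v⟩ h1 h2 h3 => ?_⟩
  have a1 := H z u v h1 h2 h3
  have a2 := H' v
  set E := Real.exp (Real.pi / (2 * h) * (spread v / 2))
  have hE : 0 < E := Real.exp_pos _
  simp only
  rw [← mul_inv, ← div_eq_mul_inv, le_div_iff₀ (by positivity), norm_mul]
  have a3 : ((1 + ‖u‖) ^ (n + 1) * (E * ‖stepIntegrand h K z x u v‖)) *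
      ((1 + ‖v‖) ^ (M + (n + 2)) * ‖w v‖) ≤ C * (1 + ‖v‖) ^ M * (C' * E) :=
    mul_le_mul a1 a2 (by positivity) (by positivity)
  refine le_of_mul_le_mul_left ?_ (by positivity : 0 < E * (1 + ‖v‖) ^ M)
  refine le_trans (le_of_eq ?_) (a3.trans (le_of_eq ?_))
  · rw [pow_add (1 + ‖v‖) M]; ring
  · ring

omit hh in
theorem integrable_prod_decay (n : ℕ) (C : ℝ) :
    Integrable fun q : (Fin n → ℝ) × (Fin (n + 1) → ℝ) =>
      C * (((1 + ‖q.1‖) ^ (n + 1))⁻¹ * ((1 + ‖q.2‖) ^ (n + 2))⁻¹) :=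
  ((integrable_inv_one_add_norm_pow (k := n + 1) (by simp) volume).mul_prod
    (integrable_inv_one_add_norm_pow (k := n + 2) (by simp) volume)).const_mul C

theorem measurable_stepIntegrand_mul (hK : IsWhittakerBounded h K) (hw : IsTestWeight h w) {z : ℂ}
    (hz : 0 < z.re) (x : Fin (n + 1) → ℝ) :
    Measurable fun q : (Fin n → ℝ) × (Fin (n + 1) → ℝ) => stepIntegrand h K z x q.1 q.2 * w q.2 :=
  (measurable_stepIntegrand hh hK.1 hz x).mul (hw.1.comp measurable_snd)

theorem integrable_stepIntegrand_mul (hK : IsWhittakerBounded h K) (hw : IsTestWeight h w) {δ : ℝ}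
    (hδ : 0 < δ) (x : Fin (n + 1) → ℝ) :
    Integrable fun q : (Fin n → ℝ) × (Fin (n + 1) → ℝ) =>
      stepIntegrand h K δ x q.1 q.2 * w q.2 := by
  obtain ⟨C, H⟩ := exists_norm_stepIntegrand_mul_le hh hK hw hδ δ 0 x
  exact (integrable_prod_decay n C).mono'
    (measurable_stepIntegrand_mul hh hK hw (by simpa using hδ) x).aestronglyMeasurable
    (Filter.Eventually.of_forall fun q => H δ q (by simp) (by simp) (by simp))

theorem differentiableAt_stepIntegrand (x : Fin (n + 1) → ℝ) (u : Fin n → ℝ) (v : Fin (n + 1) → ℝ)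
    {z : ℂ} (hz : 0 < z.re) : DifferentiableAt ℂ (fun z => stepIntegrand h K z x u v) z := by
  unfold stepIntegrand
  refine DifferentiableAt.div_const (DifferentiableAt.mul (DifferentiableAt.mul_const ?_ _)
    (DifferentiableAt.mul_const ?_ _)) _
  · unfold stepPhase; fun_prop
  · unfold crossGamma
    refine DifferentiableAt.fun_finsetProd fun a _ => DifferentiableAt.fun_finsetProd fun b _ => ?_
    refine DifferentiableAt.comp z (g := mbFactor h)
      (f := fun z => (v b : ℂ) - u a + Complex.I * z) (differentiableAt_mbFactor hh ?_) (by fun_prop)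
    simpa using hz

theorem differentiableAt_integral_stepIntegrand (hK : IsWhittakerBounded h K)
    (hw : IsTestWeight h w) (x : Fin (n + 1) → ℝ) {z : ℂ} (hz : 0 < z.re) :
    DifferentiableAt ℂ (fun z => ∫ q : (Fin n → ℝ) × (Fin (n + 1) → ℝ),
      stepIntegrand h K z x q.1 q.2 * w q.2) z := by
  obtain ⟨C, H⟩ := exists_norm_stepIntegrand_mul_le hh hK hw (half_pos hz) (z.re + z.re / 2)
    (|z.im| + z.re / 2) x
  have hball : ∀ y ∈ Metric.ball z (z.re / 2), z.re / 2 ≤ y.re ∧ y.re ≤ z.re + z.re / 2 ∧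
      |y.im| ≤ |z.im| + z.re / 2 := fun y hy => by
    rw [mem_ball_iff_norm] at hy
    have h1 := (Complex.abs_re_le_norm (y - z)).trans hy.le
    have h2 := (Complex.abs_im_le_norm (y - z)).trans hy.le
    rw [Complex.sub_re, abs_le] at h1
    rw [Complex.sub_im] at h2
    refine ⟨by linarith, by linarith, ?_⟩
    linarith [abs_sub_abs_le_abs_sub y.im z.im]
  refine differentiableAt_integral_of_dominated (half_pos hz) (fun y hy => ?_) (fun q y hy => ?_)
    (integrable_prod_decay n C) fun y hy q => ?_
  · exact (measurable_stepIntegrand_mul hh hK hw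
      ((half_pos hz).trans_le (hball y hy).1) x).aestronglyMeasurable
  · exact ((differentiableAt_stepIntegrand hh x q.1 q.2
      ((half_pos hz).trans_le (hball y hy).1)).mul_const _).differentiableWithinAt
  · exact H y q (hball y hy).1 (hball y hy).2.1 (hball y hy).2.2

omit hh in
-- Adding `iθ` to `z` replaces `v_b - u_a + iz` by `v_b - (u_a + θ) + iz`. The half densities ignore
-- the translation, and the equivariance of `K` supplies the missing phase.
theorem stepIntegrand_add_I_mul {x : Fin (n + 1) → ℝ} (hKt : ∀ (u : Fin n → ℝ) (θ : ℝ),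
    K (fun a => u a + θ) = Complex.exp (Complex.I * θ / h * ((∑ a : Fin n, x a.castSucc : ℝ) : ℂ)) * K u)
    (z : ℂ) (θ : ℝ) (u : Fin n → ℝ) (v : Fin (n + 1) → ℝ) :
    stepIntegrand h K (z + Complex.I * θ) x u v =
      stepIntegrand h K z x (fun a => u a + θ) v := by
  have h1 : crossGamma h (z + Complex.I * θ) u v = crossGamma h z (fun a => u a + θ) v := by
    unfold crossGamma
    refine Finset.prod_congr rfl fun a _ => Finset.prod_congr rfl fun b _ => ?_
    congr 1
    push_cast
    linear_combination (θ : ℂ) * Complex.I_sq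
  have h2 : stepPhase h (z + Complex.I * θ) x u v = stepPhase h z x (fun a => u a + θ) v *
      Complex.exp (Complex.I * θ / h * ((∑ a : Fin n, x a.castSucc : ℝ) : ℂ)) := by
    unfold stepPhase
    rw [← Complex.exp_add]
    congr 1
    simp only [Finset.sum_add_distrib, Finset.sum_const, Finset.card_univ, Fintype.card_fin,
      nsmul_eq_mul]
    push_cast
    linear_combination (n * θ * Complex.I / h * (x (Fin.last n) : ℂ)) * Complex.I_sq
  unfold stepIntegrand
  rw [h1, h2, hKt, halfDensity_translate, halfDensity'_translate]
  ring

/-- The contour of one step of the induction may be moved, after integration against a test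
weight. -/
theorem integral_stepIntegrand_eq (hK : IsWhittakerBounded h K) (hw : IsTestWeight h w)
    {x : Fin (n + 1) → ℝ} (hKt : ∀ (u : Fin n → ℝ) (θ : ℝ),
      K (fun a => u a + θ) = Complex.exp (Complex.I * θ / h * ((∑ a : Fin n, x a.castSucc : ℝ) : ℂ)) * K u)
    {δ δ' : ℝ} (hδ : 0 < δ) (hδ' : 0 < δ') :
    ∫ q : (Fin n → ℝ) × (Fin (n + 1) → ℝ), stepIntegrand h K δ x q.1 q.2 * w q.2 =
      ∫ q : (Fin n → ℝ) × (Fin (n + 1) → ℝ), stepIntegrand h K δ' x q.1 q.2 * w q.2 := by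
  refine eq_of_vertical_invariant (Ψ := fun z => ∫ q : (Fin n → ℝ) × (Fin (n + 1) → ℝ),
    stepIntegrand h K z x q.1 q.2 * w q.2)
    (fun z hz => differentiableAt_integral_stepIntegrand hh hK hw x hz) (fun z θ hz => ?_) hδ hδ'
  -- Translation of `u` alone preserves the product measure.
  have h1 := integral_add_right_eq_self 
    (μ := (volume : Measure (Fin n → ℝ)).prod (volume : Measure (Fin (n + 1) → ℝ)))
    (fun q => stepIntegrand h K z x q.1 q.2 * w q.2) ((fun _ : Fin n => θ), 0)
  refine Eq.trans (integral_congr_ae ?_) h1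
  refine Filter.Eventually.of_forall fun q => ?_
  simp only [stepIntegrand_add_I_mul hKt, Prod.fst_add, Prod.snd_add, add_zero]
  rfl

end Independence

/-! ### One step of the induction in the adapted coordinates. -/

section Step
variable {P : Type} [NormedAddCommGroup P] [NormedSpace ℝ P] {n : ℕ}

/-- The plane wave factor of one step as a function of `τ = ∑ v - ∑ u`. -/
noncomputable def chartPhase (h : ℝ) {n : ℕ} (δ : ℝ) (x : Fin (n + 1) → ℝ) (τ : ℝ) : ℂ :=
  Complex.exp (Complex.I / h * ((τ : ℂ) + n * Complex.I * δ) * (x (Fin.last n) : ℂ) +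
    δ / h * ((∑ a : Fin n, x a.castSucc : ℝ) : ℂ))

/-- The phase sees `u` and `v` only through `∑ v - ∑ u = τ`. Integration over `r` therefore never
meets `x`, and the Schwartz amplitude it produces does not depend on `x`. -/
theorem stepPhase_chartPoint (h : ℝ) (δ : ℝ) (x : Fin (n + 1) → ℝ) (σ : Equiv.Perm (Fin (n + 1)))
    (u : Fin n → ℝ) (τ : ℝ) (r : Fin n → ℝ) :
    stepPhase h δ x u (chartPoint σ u τ r) = chartPhase h δ x τ := by
  rw [stepPhase, chartPhase, sum_chartPoint, add_sub_cancel_right]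

theorem norm_chartPhase (h : ℝ) (δ : ℝ) (x : Fin (n + 1) → ℝ) (τ : ℝ) :
    ‖chartPhase h δ x τ‖ = Real.exp (δ / h * (∑ a : Fin n, x a.castSucc - n * x (Fin.last n))) := by
  rw [← stepPhase_chartPoint h δ x 1 0 τ 0, norm_stepPhase, Complex.ofReal_re]

theorem continuous_chartPhase (h : ℝ) (x : Fin (n + 1) → ℝ) :
    Continuous fun q : ℝ × ℝ => chartPhase h q.1 x q.2 := by
  unfold chartPhase; fun_prop

theorem chartPhase_zero (h : ℝ) (x : Fin (n + 1) → ℝ) (τ : ℝ) :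
    chartPhase h 0 x τ = Complex.exp (Complex.I / h * ((x (Fin.last n) * τ : ℝ) : ℂ)) := by
  simp [chartPhase]; ring_nf

/-- The integral over the variables transverse to the poles. -/
noncomputable def poleIntegral (g : 𝓢(ChartSpace P n, ℂ)) (θ δ : ℝ) (p : P)
    (q : (Fin n → ℝ) × ℝ) : ℂ :=
  ∫ r : Fin n → ℝ, g ((θ, (q.1, (q.2, p))), r) * ∏ a, (r a + Complex.I * δ : ℂ)⁻¹

theorem continuous_poleIntegral (g : 𝓢(ChartSpace P n, ℂ)) (θ : ℝ) {δ : ℝ} (hδ : 0 < δ) (p : P) :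
    Continuous (poleIntegral g θ δ p) := by
  obtain ⟨hm, B, l, hB⟩ := PolyBounded.prod Finset.univ fun (a : Fin n) _ =>
    (polyBounded_inv_line hδ).comp_apply a
  obtain ⟨g', hg'⟩ := g.exists_weight_integral volume hm hB
  have h1 : poleIntegral g θ δ p = fun q => g' (θ, (q.1, (q.2, p))) := funext fun q => (hg' _).symm
  rw [h1]
  exact g'.continuous.comp (by fun_prop)

theorem norm_prod_inv_line_le {δ : ℝ} (hδ : 0 < δ) (r : Fin n → ℝ) :
    ‖∏ a, (r a + Complex.I * δ : ℂ)⁻¹‖ ≤ δ⁻¹ ^ n := by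
  rw [norm_prod]
  calc _ ≤ ∏ _a : Fin n, δ⁻¹ := Finset.prod_le_prod (fun _ _ => norm_nonneg _) fun a _ => by
        rw [norm_inv]; exact inv_anti₀ hδ (le_norm_line hδ.le _)
    _ = _ := by simp

theorem integrable_chart (g : 𝓢(ChartSpace P n, ℂ)) (h : ℝ) (x : Fin (n + 1) → ℝ) (θ : ℝ) {δ : ℝ}
    (hδ : 0 < δ) (u : Fin n → ℝ) (p : P) :
    Integrable (fun q : ℝ × (Fin n → ℝ) => chartPhase h δ x q.1 * (g ((θ, (u, (q.1, p))), q.2) *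
      ∏ a, (q.2 a + Complex.I * δ : ℂ)⁻¹)) (volume.prod volume) := by
  obtain ⟨C, hC, H⟩ := g.exists_one_add_pow_mul_le (n + 2)
  set B := Real.exp (δ / h * (∑ a : Fin n, x a.castSucc - n * x (Fin.last n)))
  refine integrable_of_decay (k := n + 2) (by simp; omega) (volume.prod volume) ?_
    (B := B * C * δ⁻¹ ^ n) fun q => ?_
  · have h1 : Continuous fun q : ℝ × (Fin n → ℝ) => chartPhase h δ x q.1 :=
      (continuous_chartPhase h x).comp (by fun_prop : Continuous fun q : ℝ × (Fin n → ℝ) => (δ, q.1))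
    have h2 : Continuous fun q : ℝ × (Fin n → ℝ) => g ((θ, (u, (q.1, p))), q.2) :=
      g.continuous.comp (by fun_prop)
    have h3 : Measurable fun q : ℝ × (Fin n → ℝ) => ∏ a, (q.2 a + Complex.I * δ : ℂ)⁻¹ := by fun_prop
    exact (h1.measurable.mul (h2.measurable.mul h3)).aestronglyMeasurable
  · rw [norm_mul, norm_mul, norm_chartPhase]
    have h1 := H ((θ, (u, (q.1, p))), q.2)
    have h2 : ‖q‖ ≤ ‖(((θ, (u, (q.1, p))), q.2) : ChartSpace P n)‖ := by
      simp only [Prod.norm_def, sup_le_iff]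
      refine ⟨?_, le_max_right _ _⟩
      exact le_max_of_le_left (le_max_of_le_right (le_max_of_le_right (le_max_left _ _)))
    have h3 := norm_prod_inv_line_le hδ q.2
    calc (1 + ‖q‖) ^ (n + 2) * (B * (‖g ((θ, (u, (q.1, p))), q.2)‖ * ‖∏ a, (q.2 a + Complex.I * δ : ℂ)⁻¹‖))
        ≤ (1 + ‖(((θ, (u, (q.1, p))), q.2) : ChartSpace P n)‖) ^ (n + 2) *
          (B * (‖g ((θ, (u, (q.1, p))), q.2)‖ * δ⁻¹ ^ n)) := by gcongr
      _ = B * ((1 + ‖(((θ, (u, (q.1, p))), q.2) : ChartSpace P n)‖) ^ (n + 2) *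
          ‖g ((θ, (u, (q.1, p))), q.2)‖) * δ⁻¹ ^ n := by ring
      _ ≤ _ := by gcongr

/-- The integral over `v` of one simple pole term, in the adapted coordinates. -/
theorem integral_pole_term {h : ℝ} {σ : Equiv.Perm (Fin (n + 1))}
    {f : 𝓢((Fin (n + 1) → ℝ) × P, ℂ)} {g : 𝓢(ChartSpace P n, ℂ)}
    (hg : ∀ θ u τ p r, g ((θ, (u, (τ, p))), r) =
      regKernel h (ofRealPoint θ u (chartPoint σ u τ r)) * f (chartPoint σ u τ r, p))
    (x : Fin (n + 1) → ℝ) (θ : ℝ) {δ : ℝ} (hδ : 0 < δ) (u : Fin n → ℝ) (p : P) :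
    Integrable (fun v => stepPhase h δ x u v * ((regKernel h (ofRealPoint θ u v) * f (v, p)) *
      ∏ a : Fin n, (((v (σ a.succ) - u a : ℝ) : ℂ) + Complex.I * δ)⁻¹)) ∧
    ∫ v, stepPhase h δ x u v * ((regKernel h (ofRealPoint θ u v) * f (v, p)) *
      ∏ a : Fin n, (((v (σ a.succ) - u a : ℝ) : ℂ) + Complex.I * δ)⁻¹) =
      ∫ τ, chartPhase h δ x τ * poleIntegral g θ δ p (u, τ) := by
  set A : (Fin (n + 1) → ℝ) → ℂ := fun v => stepPhase h δ x u v * ((regKernel h (ofRealPoint θ u v) *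
    f (v, p)) * ∏ a : Fin n, (((v (σ a.succ) - u a : ℝ) : ℂ) + Complex.I * δ)⁻¹) with hA
  have e : (fun q : ℝ × (Fin n → ℝ) => chartPhase h δ x q.1 * (g ((θ, (u, (q.1, p))), q.2) *
      ∏ a, (q.2 a + Complex.I * δ : ℂ)⁻¹)) = A ∘ fun q => chartPoint σ u q.1 q.2 := by
    funext q
    simp only [hA, Function.comp_apply, stepPhase_chartPoint, chartPoint_succ, hg,
      add_sub_cancel_left]
  have hi := integrable_chart g h x θ hδ u p
  rw [e] at hi
  refine ⟨((measurePreserving_chartPoint σ u).integrable_comp_emb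
    (measurableEmbedding_chartPoint σ u)).1 hi, ?_⟩
  rw [← (measurePreserving_chartPoint σ u).integral_comp (measurableEmbedding_chartPoint σ u) A]
  have h1 : ∫ q : ℝ × (Fin n → ℝ), A (chartPoint σ u q.1 q.2) ∂(volume.prod volume) =
      ∫ τ, ∫ r, A (chartPoint σ u τ r) := integral_prod _ hi
  refine h1.trans (integral_congr_ae (Filter.Eventually.of_forall fun τ => ?_))
  simp only
  rw [poleIntegral, ← integral_const_mul]
  exact integral_congr_ae (Filter.Eventually.of_forall fun r => (congrFun e (τ, r)).symm)

section Bound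
variable {h : ℝ} (hh : 0 < h) {K : (Fin n → ℝ) → ℂ}
include hh

/-- The growth of one half density exactly cancels the exponential decay of a Whittaker bounded
kernel. -/
theorem exists_norm_mul_halfDensity_le (hK : IsWhittakerBounded h K) : ∃ C : ℝ, 0 < C ∧ ∃ M : ℕ,
    ∀ u, ‖K u * halfDensity h u‖ ≤ C * (1 + ‖u‖) ^ M := by
  obtain ⟨C, hC, M, H⟩ := hK.2
  obtain ⟨C', hC', M', H'⟩ := exists_norm_halfDensity_le hh n
  refine ⟨C * C', by positivity, M + M', fun u => ?_⟩
  rw [norm_mul]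
  calc _ ≤ ‖K u‖ * (C' * (1 + ‖u‖) ^ M' * Real.exp (Real.pi / (2 * h) * (spread u / 2))) := by
        gcongr; exact (H' u).1
    _ = (‖K u‖ * Real.exp (Real.pi / (2 * h) * (spread u / 2))) * (C' * (1 + ‖u‖) ^ M') := by ring
    _ ≤ (C * (1 + ‖u‖) ^ M) * (C' * (1 + ‖u‖) ^ M') :=
        mul_le_mul_of_nonneg_right (H u) (by positivity)
    _ = _ := by ring

/-- The bound is uniform over the index `i`, which will be `(θ, δ)`: this is the majorant for
dominated convergence as `δ` tends to `0`. -/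
theorem exists_norm_chart_integrand_le (hK : IsWhittakerBounded h K) {ι : Type}
    {φ : ι → ℝ → ℂ} {B : ℝ} (hφ : ∀ i τ, ‖φ i τ‖ ≤ B) {J : ι → (Fin n → ℝ) × ℝ → ℂ}
    (hJ : ∀ k : ℕ, ∃ C : ℝ, ∀ i q, (1 + ‖q‖) ^ k * ‖J i q‖ ≤ C) :
    ∃ C : ℝ, ∀ i q, ‖K q.1 * halfDensity h q.1 * (φ i q.2 * J i q)‖ ≤
      C * (((1 + ‖q.1‖) ^ (n + 1))⁻¹ * ((1 + ‖q.2‖) ^ 2)⁻¹) := by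
  obtain ⟨C, hC, M, H⟩ := exists_norm_mul_halfDensity_le hh hK
  obtain ⟨C', H'⟩ := hJ (M + (n + 1) + 2)
  refine ⟨C * |B| * C', fun i q => ?_⟩
  rw [← mul_inv, ← div_eq_mul_inv, le_div_iff₀ (by positivity),
    norm_mul (K q.1 * halfDensity h q.1), norm_mul (φ i q.2)]
  have h1 : ‖q.1‖ ≤ ‖q‖ := norm_fst_le q
  have h2 : ‖q.2‖ ≤ ‖q‖ := norm_snd_le q
  have h3 := H q.1
  have h4 := (hφ i q.2).trans (le_abs_self B)
  calc ‖K q.1 * halfDensity h q.1‖ * (‖φ i q.2‖ * ‖J i q‖) * ((1 + ‖q.1‖) ^ (n + 1) * (1 + ‖q.2‖) ^ 2)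
      ≤ (C * (1 + ‖q‖) ^ M) * (|B| * ‖J i q‖) * ((1 + ‖q‖) ^ (n + 1) * (1 + ‖q‖) ^ 2) := by
        gcongr
        exact h3.trans (by gcongr)
    _ = C * |B| * ((1 + ‖q‖) ^ (M + (n + 1) + 2) * ‖J i q‖) := by ring
    _ ≤ C * |B| * C' := mul_le_mul_of_nonneg_left (H' i q) (by positivity)

omit hh in
theorem integrable_chart_decay (n : ℕ) (C : ℝ) :
    Integrable (fun q : (Fin n → ℝ) × ℝ =>
      C * (((1 + ‖q.1‖) ^ (n + 1))⁻¹ * ((1 + ‖q.2‖) ^ 2)⁻¹)) (volume.prod volume) :=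
  ((integrable_inv_one_add_norm_pow (k := n + 1) (by simp) volume).mul_prod
    (integrable_inv_one_add_norm_pow (E := ℝ) (k := 2) (by simp) volume)).const_mul C

omit hh in
theorem aestronglyMeasurable_chart_integrand (hK : IsWhittakerBounded h K) {φ : ℝ → ℂ}
    (hφ : Continuous φ) {J : (Fin n → ℝ) × ℝ → ℂ} (hJ : Continuous J) :
    AEStronglyMeasurable (fun q : (Fin n → ℝ) × ℝ => K q.1 * halfDensity h q.1 * (φ q.2 * J q))
      (volume.prod volume) :=
  (((hK.1.mul (continuous_halfDensity h n).measurable).comp measurable_fst).mul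
    ((hφ.measurable.comp measurable_snd).mul hJ.measurable)).aestronglyMeasurable

omit [NormedSpace ℝ P] hh in
theorem one_add_norm_le_chart (q : (Fin n → ℝ) × ℝ) (p : P) : 1 + ‖q‖ ≤ 1 + ‖(q.1, (q.2, p))‖ := by
  have : ‖q‖ ≤ ‖(q.1, (q.2, p))‖ := by
    simp only [Prod.norm_def]
    exact max_le_max_left _ (le_max_left _ _)
  linarith

theorem isTestWeight_halfDensity_mul (f : 𝓢((Fin n → ℝ) × P, ℂ)) (p : P) :
    IsTestWeight h fun v => halfDensity h v * f (v, p) := by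
  refine ⟨((continuous_halfDensity h n).mul (g := fun v => f (v, p))
    (f.continuous.comp (by fun_prop))).measurable, fun m => ?_⟩
  obtain ⟨C, hC, M, H⟩ := exists_norm_halfDensity_le hh n
  obtain ⟨C', hC', H'⟩ := f.exists_one_add_pow_mul_le (m + M)
  refine ⟨C * C', by positivity, fun v => ?_⟩
  have h1 := H' (v, p)
  have h2 : ‖v‖ ≤ ‖(v, p)‖ := norm_fst_le (v, p)
  rw [norm_mul]
  set E := Real.exp (Real.pi / (2 * h) * (spread v / 2))
  calc _ ≤ (1 + ‖v‖) ^ m * ((C * (1 + ‖v‖) ^ M * E) * ‖f (v, p)‖) := by gcongr; exact (H v).1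
    _ = C * E * ((1 + ‖v‖) ^ (m + M) * ‖f (v, p)‖) := by ring
    _ ≤ C * E * ((1 + ‖(v, p)‖) ^ (m + M) * ‖f (v, p)‖) := by gcongr
    _ ≤ C * E * C' := by gcongr
    _ = _ := by ring

end Bound

end Step

/-! ### The limit of vanishing contour depth. -/

section Limit
variable {P : Type} [NormedAddCommGroup P] [NormedSpace ℝ P] {n : ℕ} {h : ℝ} (hh : 0 < h)
  {K : (Fin n → ℝ) → ℂ}
include hh

/-- The step of the induction at a small distance `δ` from the real axis, in the adapted
coordinates. -/
theorem integral_stepIntegrand_chart (hK : IsWhittakerBounded h K)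
    {f : 𝓢((Fin (n + 1) → ℝ) × P, ℂ)} {g : Equiv.Perm (Fin (n + 1)) → 𝓢(ChartSpace P n, ℂ)}
    (hg : ∀ σ θ u τ p r, g σ ((θ, (u, (τ, p))), r) =
      regKernel h (ofRealPoint θ u (chartPoint σ u τ r)) * f (chartPoint σ u τ r, p))
    (x : Fin (n + 1) → ℝ) {θ δ : ℝ} (hδ : 0 < δ) (hθ : δ = h / 24 * Real.sin θ) (p : P)
    (hi : ∀ σ, Integrable (fun q : (Fin n → ℝ) × ℝ => K q.1 * halfDensity h q.1 *
      (chartPhase h δ x q.2 * poleIntegral (g σ) θ δ p q)) (volume.prod volume)) :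
    ∫ q : (Fin n → ℝ) × (Fin (n + 1) → ℝ),
      stepIntegrand h K δ x q.1 q.2 * (halfDensity h q.2 * f (q.2, p)) =
    Complex.exp ((θ : ℂ) ^ 2) *
      (stepConst h n / ((n.factorial : ℂ) * (2 * (Real.pi : ℂ) * (h : ℂ)) ^ n)) *
      ∑ σ : Equiv.Perm (Fin (n + 1)), ((Equiv.Perm.sign σ : ℤ) : ℂ) *
        ∫ q : (Fin n → ℝ) × ℝ, K q.1 * halfDensity h q.1 *
          (chartPhase h δ x q.2 * poleIntegral (g σ) θ δ p q) ∂(volume.prod volume) := by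
  set c := Complex.exp ((θ : ℂ) ^ 2) *
    (stepConst h n / ((n.factorial : ℂ) * (2 * (Real.pi : ℂ) * (h : ℂ)) ^ n)) with hc
  -- The `u`-integral is kept outside, because the chart in `v` depends on `u`.
  have e0 := integral_prod _ (integrable_stepIntegrand_mul hh hK
    (isTestWeight_halfDensity_mul hh f p) hδ x)
  refine e0.trans ?_
  simp only
  have e1 : ∀ u v, stepIntegrand h K δ x u v * (halfDensity h v * f (v, p)) =
      c * ∑ σ : Equiv.Perm (Fin (n + 1)), ((Equiv.Perm.sign σ : ℤ) : ℂ) * (K u * halfDensity h u *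
        (stepPhase h δ x u v * ((regKernel h (ofRealPoint θ u v) * f (v, p)) *
          ∏ a : Fin n, (((v (σ a.succ) - u a : ℝ) : ℂ) + Complex.I * δ)⁻¹))) := fun u v => by
    have e2 := crossGamma_mul_eq_sum hh hδ hθ u v
    have e3 : stepIntegrand h K δ x u v * (halfDensity h v * f (v, p)) =
        stepPhase h δ x u v * K u * halfDensity h u * f (v, p) *
          (crossGamma h δ u v * halfDensity' h u * halfDensity h v) /
          ((n.factorial : ℂ) * (2 * (Real.pi : ℂ) * (h : ℂ)) ^ n) := by
      rw [stepIntegrand]; ring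
    rw [e3, e2, hc, Finset.mul_sum, Finset.mul_sum, Finset.mul_sum, Finset.sum_div]
    refine Finset.sum_congr rfl fun σ _ => ?_
    ring
  have e2 : ∀ u, ∫ v, stepIntegrand h K δ x u v * (halfDensity h v * f (v, p)) =
      c * ∑ σ : Equiv.Perm (Fin (n + 1)), ((Equiv.Perm.sign σ : ℤ) : ℂ) *
        ∫ τ, K u * halfDensity h u * (chartPhase h δ x τ * poleIntegral (g σ) θ δ p (u, τ)) :=
    fun u => by
    simp only [e1]
    rw [integral_const_mul, integral_finsetSum]
    · congr 1
      refine Finset.sum_congr rfl fun σ _ => ?_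
      rw [integral_const_mul, integral_const_mul, integral_const_mul,
        (integral_pole_term (hg σ) x θ hδ u p).2]
    · intro σ _
      exact ((integral_pole_term (hg σ) x θ hδ u p).1.const_mul _).const_mul _
  simp only [e2]
  rw [integral_const_mul, integral_finsetSum]
  · congr 1
    refine Finset.sum_congr rfl fun σ _ => ?_
    rw [integral_const_mul, integral_prod _ (hi σ)]
  · intro σ _
    exact (hi σ).integral_prod_left.const_mul _

omit hh in
theorem norm_chartPhase_le {h : ℝ} (hh : 0 < h) {δ : ℝ} (h0 : 0 ≤ δ) (h1 : δ ≤ 1)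
    (x : Fin (n + 1) → ℝ) (τ : ℝ) : ‖chartPhase h δ x τ‖ ≤
      Real.exp (h⁻¹ * |∑ a : Fin n, x a.castSucc - n * x (Fin.last n)|) := by
  rw [norm_chartPhase]
  refine Real.exp_le_exp.2 ?_
  have : δ / h ≤ h⁻¹ := by rw [div_eq_mul_inv]; exact mul_le_of_le_one_left (by positivity) h1
  calc _ ≤ δ / h * |∑ a : Fin n, x a.castSucc - n * x (Fin.last n)| := by
        gcongr; exact le_abs_self _
    _ ≤ _ := by gcongr

/-- The value of one step of the induction, on the real contour. -/
theorem integral_stepIntegrand_eq_limit (hK : IsWhittakerBounded h K)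
    {f : 𝓢((Fin (n + 1) → ℝ) × P, ℂ)} {g : Equiv.Perm (Fin (n + 1)) → 𝓢(ChartSpace P n, ℂ)}
    (hg : ∀ σ θ u τ p r, g σ ((θ, (u, (τ, p))), r) =
      regKernel h (ofRealPoint θ u (chartPoint σ u τ r)) * f (chartPoint σ u τ r, p))
    {G : Equiv.Perm (Fin (n + 1)) → 𝓢((Fin n → ℝ) × (ℝ × P), ℂ)}
    (hG : ∀ σ, ∀ δ : ℝ → ℝ, Filter.Tendsto δ (𝓝[>] 0) (𝓝[>] 0) → ∀ e,
      Filter.Tendsto (fun θ => ∫ r, g σ ((θ, e), r) * ∏ a, (r a + Complex.I * δ θ : ℂ)⁻¹) (𝓝[>] 0)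
        (𝓝 (G σ e)))
    (hGb : ∀ σ, ∀ k : ℕ, ∃ C : ℝ, ∀ (θ : ℝ) (e : (Fin n → ℝ) × (ℝ × P)) (δ : ℝ), 0 < δ → δ ≤ 1 →
        (1 + ‖e‖) ^ k * ‖∫ r, g σ ((θ, e), r) * ∏ a, (r a + Complex.I * δ : ℂ)⁻¹‖ ≤ C)
    {x : Fin (n + 1) → ℝ} (hKt : ∀ (u : Fin n → ℝ) (θ : ℝ),
      K (fun a => u a + θ) = Complex.exp (Complex.I * θ / h * ((∑ a : Fin n, x a.castSucc : ℝ) : ℂ)) * K u)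
    {δ₀ : ℝ} (hδ₀ : 0 < δ₀) (p : P) :
    ∫ q : (Fin n → ℝ) × (Fin (n + 1) → ℝ),
      stepIntegrand h K δ₀ x q.1 q.2 * (halfDensity h q.2 * f (q.2, p)) =
    (stepConst h n / ((n.factorial : ℂ) * (2 * (Real.pi : ℂ) * (h : ℂ)) ^ n)) *
      ∑ σ : Equiv.Perm (Fin (n + 1)), ((Equiv.Perm.sign σ : ℤ) : ℂ) *
        ∫ q : (Fin n → ℝ) × ℝ, K q.1 * halfDensity h q.1 *
          (chartPhase h 0 x q.2 * G σ (q.1, (q.2, p))) ∂(volume.prod volume) := by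
  -- Parametrising the depth by a sine keeps it bounded while `θ` runs over all of `ℝ`, so `θ` can
  -- be one of the variables of a Schwartz function.
  set δ : ℝ → ℝ := fun θ => h / 24 * Real.sin θ with hδdef
  have hδt : Filter.Tendsto δ (𝓝[>] 0) (𝓝[>] 0) := by
    refine tendsto_nhdsWithin_iff.2 ⟨?_, ?_⟩
    · have h1 : Continuous δ := by fun_prop
      have h2 := h1.tendsto 0
      simp only [hδdef, Real.sin_zero, mul_zero] at h2
      exact h2.mono_left nhdsWithin_le_nhds
    · filter_upwards [Ioo_mem_nhdsGT Real.pi_pos] with θ hθ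
      exact mul_pos (by positivity) (Real.sin_pos_of_pos_of_lt_pi hθ.1 hθ.2)
  have hδ1 : ∀ᶠ θ in 𝓝[>] (0 : ℝ), 0 < δ θ ∧ δ θ ≤ 1 :=
    hδt.eventually (Ioc_mem_nhdsGT (zero_lt_one (α := ℝ)))
  set B := Real.exp (h⁻¹ * |∑ a : Fin n, x a.castSucc - n * x (Fin.last n)|)
  have hbound : ∀ σ, ∃ C : ℝ, ∀ (i : ℝ × Set.Ioc (0 : ℝ) 1) (q : (Fin n → ℝ) × ℝ),
      ‖K q.1 * halfDensity h q.1 * (chartPhase h i.2 x q.2 * poleIntegral (g σ) i.1 i.2 p q)‖ ≤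
      C * (((1 + ‖q.1‖) ^ (n + 1))⁻¹ * ((1 + ‖q.2‖) ^ 2)⁻¹) := fun σ => by
    refine exists_norm_chart_integrand_le hh hK (φ := fun (i : ℝ × Set.Ioc (0 : ℝ) 1) τ =>
      chartPhase h i.2 x τ) (B := B) (fun i τ => norm_chartPhase_le hh i.2.2.1.le i.2.2.2 x τ)
      (J := fun (i : ℝ × Set.Ioc (0 : ℝ) 1) q => poleIntegral (g σ) i.1 i.2 p q) fun k => ?_
    obtain ⟨C, hC⟩ := hGb σ k
    refine ⟨C, fun i q => le_trans ?_ (hC i.1 (q.1, (q.2, p)) i.2 i.2.2.1 i.2.2.2)⟩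
    have := one_add_norm_le_chart q p
    rw [poleIntegral]
    gcongr
  choose C hC using hbound
  have hmeas : ∀ σ, ∀ θ δ : ℝ, 0 < δ → AEStronglyMeasurable (fun q : (Fin n → ℝ) × ℝ => K q.1 *
      halfDensity h q.1 * (chartPhase h δ x q.2 * poleIntegral (g σ) θ δ p q))
      (volume.prod volume) := fun σ θ δ hδ =>
    aestronglyMeasurable_chart_integrand hK ((continuous_chartPhase h x).comp
      (by fun_prop : Continuous fun τ : ℝ => (δ, τ))) (continuous_poleIntegral (g σ) θ hδ p)
  have hlim : ∀ σ, Filter.Tendsto (fun θ => ∫ q : (Fin n → ℝ) × ℝ, K q.1 * halfDensity h q.1 *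
      (chartPhase h (δ θ) x q.2 * poleIntegral (g σ) θ (δ θ) p q) ∂(volume.prod volume)) (𝓝[>] 0)
      (𝓝 (∫ q : (Fin n → ℝ) × ℝ, K q.1 * halfDensity h q.1 *
          (chartPhase h 0 x q.2 * G σ (q.1, (q.2, p))) ∂(volume.prod volume))) := fun σ => by
    refine tendsto_integral_filter_of_dominated_convergence _ ?_ ?_
      (integrable_chart_decay n (C σ)) ?_
    · filter_upwards [hδ1] with θ hθ using hmeas σ θ _ hθ.1
    · filter_upwards [hδ1] with θ hθ
      exact Filter.Eventually.of_forall fun q => hC σ (θ, ⟨δ θ, hθ⟩) q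
    · refine Filter.Eventually.of_forall fun q => Filter.Tendsto.const_mul _ (Filter.Tendsto.mul ?_ ?_)
      · have h1 : Continuous fun d : ℝ => chartPhase h d x q.2 :=
          (continuous_chartPhase h x).comp (by fun_prop : Continuous fun d : ℝ => (d, q.2))
        exact ((h1.tendsto 0).mono_left nhdsWithin_le_nhds).comp hδt
      · exact hG σ δ hδt (q.1, (q.2, p))
  have hexp : Filter.Tendsto (fun θ : ℝ => Complex.exp ((θ : ℂ) ^ 2)) (𝓝[>] 0) (𝓝 1) := by
    have h1 : Continuous fun θ : ℝ => Complex.exp ((θ : ℂ) ^ 2) := by fun_prop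
    have h2 := h1.tendsto 0
    simp only [Complex.ofReal_zero, ne_eq, OfNat.ofNat_ne_zero, not_false_eq_true, zero_pow,
      Complex.exp_zero] at h2
    exact h2.mono_left nhdsWithin_le_nhds
  have hall := (hexp.mul_const
    (stepConst h n / ((n.factorial : ℂ) * (2 * (Real.pi : ℂ) * (h : ℂ)) ^ n))).mul
    (tendsto_finsetSum Finset.univ fun σ _ =>
      (hlim σ).const_mul ((Equiv.Perm.sign σ : ℤ) : ℂ))
  rw [one_mul] at hall
  -- By contour independence the left side is the same for all small depths, so it equals the limit
  -- of the right side.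
  refine tendsto_nhds_unique (f := fun _ : ℝ => _) (tendsto_const_nhds (f := 𝓝[>] (0 : ℝ)))
    (hall.congr' ?_)
  filter_upwards [hδ1] with θ hθ
  rw [integral_stepIntegrand_eq hh hK (isTestWeight_halfDensity_mul hh f p) hKt hδ₀ hθ.1]
  exact (integral_stepIntegrand_chart hh hK hg x hθ.1 rfl p fun σ =>
    (integrable_chart_decay n (C σ)).mono' (hmeas σ θ _ hθ.1)
      (Filter.Eventually.of_forall fun q => hC σ (θ, ⟨δ θ, hθ⟩) q)).symm

end Limit

/-! ### The Fourier representation. -/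

theorem norm_exp_I_div_mul (h t : ℝ) : ‖Complex.exp (Complex.I / h * (t : ℂ))‖ = 1 := by
  rw [show Complex.I / h * (t : ℂ) = ((t / h : ℝ) : ℂ) * Complex.I by push_cast; ring]
  exact Complex.norm_exp_ofReal_mul_I _

section Representation
variable {P : Type} [NormedAddCommGroup P] [NormedSpace ℝ P] {n : ℕ}

theorem integrable_exp_mul_schwartz (h : ℝ) (x : Fin (n + 1) → ℝ) (p : P)
    (ρ : 𝓢((Fin n → ℝ) × (ℝ × P), ℂ)) :
    Integrable (fun q : ℝ × (Fin n → ℝ) => Complex.exp (Complex.I / h *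
      ((x (Fin.last n) * q.1 + ∑ j : Fin n, x j.castSucc * q.2 j : ℝ) : ℂ)) * ρ (q.2, (q.1, p)))
      (volume.prod volume) := by
  obtain ⟨C, hC, H⟩ := ρ.exists_one_add_pow_mul_le (n + 2)
  refine integrable_of_decay (k := n + 2) (by simp; omega) (volume.prod volume) (B := C) ?_ fun q => ?_
  · have h1 : Continuous fun q : ℝ × (Fin n → ℝ) => ρ (q.2, (q.1, p)) := ρ.continuous.comp (by fun_prop)
    exact Continuous.aestronglyMeasurable (by fun_prop)
  · rw [norm_mul, norm_exp_I_div_mul, one_mul]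
    refine le_trans ?_ (H (q.2, (q.1, p)))
    have : ‖q‖ ≤ ‖(q.2, (q.1, p))‖ := by
      simp only [Prod.norm_def, sup_le_iff]
      exact ⟨le_max_of_le_right (le_max_left _ _), le_max_left _ _⟩
    gcongr

/-- A Schwartz function with its last variable moved to the parameters. -/
theorem exists_schwartz_snoc (c : ℂ) (ρ : 𝓢((Fin n → ℝ) × (ℝ × P), ℂ)) :
    ∃ ρ' : 𝓢((Fin (n + 1) → ℝ) × P, ℂ), ∀ ξ p,
      ρ' (ξ, p) = c * ρ (fun j => ξ j.castSucc, (ξ (Fin.last n), p)) := by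
  set L : (Fin (n + 1) → ℝ) × P →L[ℝ] (Fin n → ℝ) × (ℝ × P) :=
    (ContinuousLinearMap.pi fun j : Fin n => (ContinuousLinearMap.proj (R := ℝ)
      (φ := fun _ : Fin (n + 1) => ℝ) (Fin.castSucc j)).comp (ContinuousLinearMap.fst ℝ _ P)).prod
    (((ContinuousLinearMap.proj (R := ℝ) (φ := fun _ : Fin (n + 1) => ℝ) (Fin.last n)).comp
      (ContinuousLinearMap.fst ℝ _ P)).prod (ContinuousLinearMap.snd ℝ _ P))
  have hL : ∀ ξ p, L (ξ, p) = (fun j => ξ j.castSucc, (ξ (Fin.last n), p)) := fun ξ p => rfl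
  have hLn : ∀ y, ‖y‖ ≤ (1 : NNReal) * ‖L y‖ := fun ⟨ξ, p⟩ => by
    rw [NNReal.coe_one, one_mul, hL]
    refine max_le ?_ ?_
    · refine (pi_norm_le_iff_of_nonneg (norm_nonneg _)).2 fun j => ?_
      refine Fin.lastCases ?_ (fun j => ?_) j
      · exact le_max_of_le_right (le_max_left _ _)
      · exact le_max_of_le_left (norm_le_pi_norm (fun j : Fin n => ξ j.castSucc) j)
    · exact le_max_of_le_right (le_max_right _ _)
  exact ⟨c • SchwartzMap.compCLMOfAntilipschitz ℝ (g := L) (K := 1) L.hasTemperateGrowth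
    (AddMonoidHomClass.antilipschitz_of_bound _ hLn) ρ, fun ξ p => rfl⟩

/-- Fubini for the last coordinate: the parameter `τ` of the induction hypothesis becomes the
Fourier variable dual to `x (Fin.last n)`. -/
theorem integral_exp_snoc (h : ℝ) (x : Fin (n + 1) → ℝ) (p : P) (c : ℂ)
    (ρ : 𝓢((Fin n → ℝ) × (ℝ × P), ℂ)) :
    ∫ ξ : Fin (n + 1) → ℝ, Complex.exp (Complex.I / h * ((∑ j, x j * ξ j : ℝ) : ℂ)) *
      (c * ρ (fun j => ξ j.castSucc, (ξ (Fin.last n), p))) =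
    c * ∫ τ : ℝ, Complex.exp (Complex.I / h * ((x (Fin.last n) * τ : ℝ) : ℂ)) *
      ∫ ξ : Fin n → ℝ, Complex.exp (Complex.I / h * ((∑ j : Fin n, x j.castSucc * ξ j : ℝ) : ℂ)) *
        ρ (ξ, (τ, p)) := by
  have h1 := (volume_preserving_piFinSuccAbove (fun _ : Fin (n + 1) => ℝ) (Fin.last n)).integral_comp'
    (fun q : ℝ × (Fin n → ℝ) => Complex.exp (Complex.I / h *
      ((x (Fin.last n) * q.1 + ∑ j : Fin n, x j.castSucc * q.2 j : ℝ) : ℂ)) * ρ (q.2, (q.1, p)))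
  have h2 := integral_prod _ (integrable_exp_mul_schwartz h x p ρ)
  have h3 := h1.trans h2
  simp only at h3
  have h4 : ∀ τ, ∫ ξ : Fin n → ℝ, Complex.exp (Complex.I / h *
      ((x (Fin.last n) * τ + ∑ j : Fin n, x j.castSucc * ξ j : ℝ) : ℂ)) * ρ (ξ, (τ, p)) =
      Complex.exp (Complex.I / h * ((x (Fin.last n) * τ : ℝ) : ℂ)) *
      ∫ ξ : Fin n → ℝ, Complex.exp (Complex.I / h * ((∑ j : Fin n, x j.castSucc * ξ j : ℝ) : ℂ)) *
        ρ (ξ, (τ, p)) := fun τ => by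
    rw [← integral_const_mul]
    refine integral_congr_ae (Filter.Eventually.of_forall fun ξ => ?_)
    simp only
    rw [← mul_assoc, ← Complex.exp_add, Complex.ofReal_add, mul_add]
  simp only [h4] at h3
  rw [← h3, ← integral_const_mul]
  refine integral_congr_ae (Filter.Eventually.of_forall fun ξ => ?_)
  have h5 : (Fin.last n).removeNth ξ = fun j => ξ j.castSucc := by
    funext j; simp [Fin.removeNth]
  simp only [MeasurableEquiv.piFinSuccAbove_apply, Fin.insertNthEquiv_symm_apply, h5]
  rw [Fin.sum_univ_castSucc, add_comm (x (Fin.last n) * ξ (Fin.last n))]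
  ring

/-- After integration against a Schwartz function, the kernel becomes a superposition of plane
waves with a Schwartz amplitude which does not depend on the contours. -/
theorem exists_fourier_representation {h : ℝ} (hh : 0 < h) (n : ℕ) :
    ∀ (P : Type) [NormedAddCommGroup P] [NormedSpace ℝ P] (f : 𝓢((Fin n → ℝ) × P, ℂ)),
    ∃ ρ : 𝓢((Fin n → ℝ) × P, ℂ), ∀ α : ℕ → ℝ, 0 < α 0 → StrictMono α → ∀ x p,
      ∫ v, realKernel h n α v x * (halfDensity h v * f (v, p)) =
        ∫ ξ, Complex.exp (Complex.I / h * ((∑ j, x j * ξ j : ℝ) : ℂ)) * ρ (ξ, p) := by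
  induction n with
  | zero =>
    intro P _ _ f
    refine ⟨f, fun α _ _ x p => ?_⟩
    simp [realKernel, whittakerKernel, halfDensity]
  | succ n ih =>
    intro P _ _ f
    choose g hg using fun σ => exists_schwartz_regKernel_mul hh σ f
    choose G hG hGb using fun σ => (g σ).exists_singular_limit
    -- All permutations are combined into one Schwartz function, with `τ` added to the parameters.
    -- No contour has been chosen yet, so `ρ` is independent of `α`.
    obtain ⟨ρ, hρ⟩ := ih (ℝ × P) (∑ σ : Equiv.Perm (Fin (n + 1)), ((Equiv.Perm.sign σ : ℤ) : ℂ) • G σ)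
    set c := stepConst h n / ((n.factorial : ℂ) * (2 * (Real.pi : ℂ) * (h : ℂ)) ^ n)
    obtain ⟨ρ', hρ'⟩ := exists_schwartz_snoc c ρ
    refine ⟨ρ', fun α h0 hα x p => ?_⟩
    set K : (Fin n → ℝ) → ℂ := fun u => realKernel h n (shiftSeq α) u fun a => x a.castSucc with hKdef
    have hK : IsWhittakerBounded h K :=
      isWhittakerBounded_realKernel hh n _ _ (shiftSeq_pos hα) (shiftSeq_strictMono hα)
    have hKt : ∀ (u : Fin n → ℝ) (θ : ℝ), K (fun a => u a + θ) =
        Complex.exp (Complex.I * θ / h * ((∑ a : Fin n, x a.castSucc : ℝ) : ℂ)) * K u :=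
      fun u θ => realKernel_translate h n _ u _ θ
    have hGi : ∀ σ, Integrable (fun q : (Fin n → ℝ) × ℝ => K q.1 * halfDensity h q.1 *
        (chartPhase h 0 x q.2 * G σ (q.1, (q.2, p)))) (volume.prod volume) := fun σ => by
      obtain ⟨C, hC⟩ := exists_norm_chart_integrand_le hh hK (ι := Unit)
        (φ := fun _ τ => chartPhase h 0 x τ) (B := _)
        (fun _ τ => norm_chartPhase_le hh le_rfl zero_le_one x τ)
        (J := fun _ q => G σ (q.1, (q.2, p))) fun k => by
          obtain ⟨C, _, H⟩ := (G σ).exists_one_add_pow_mul_le k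
          refine ⟨C, fun _ q => le_trans ?_ (H (q.1, (q.2, p)))⟩
          have := one_add_norm_le_chart q p
          gcongr
      exact (integrable_chart_decay n C).mono' (aestronglyMeasurable_chart_integrand hK
        ((continuous_chartPhase h x).comp (by fun_prop : Continuous fun τ : ℝ => ((0 : ℝ), τ)))
        ((G σ).continuous.comp (by fun_prop)))
        (Filter.Eventually.of_forall fun q => hC () q)
    have e1 : ∫ v, realKernel h (n + 1) α v x * (halfDensity h v * f (v, p)) =
        ∫ q : (Fin n → ℝ) × (Fin (n + 1) → ℝ),
          stepIntegrand h K (α 0) x q.1 q.2 * (halfDensity h q.2 * f (q.2, p)) := by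
      refine Eq.trans ?_ (integral_prod_symm _ (integrable_stepIntegrand_mul hh hK
        (isTestWeight_halfDensity_mul hh f p) h0 x)).symm
      refine integral_congr_ae (Filter.Eventually.of_forall fun v => ?_)
      simp only
      rw [realKernel_succ, integral_mul_const]
    -- With `τ` integrated last, the inner integral over `u` has exactly the form of the induction
    -- hypothesis.
    have e2 : ∑ σ : Equiv.Perm (Fin (n + 1)), ((Equiv.Perm.sign σ : ℤ) : ℂ) *
        ∫ q : (Fin n → ℝ) × ℝ, K q.1 * halfDensity h q.1 *
          (chartPhase h 0 x q.2 * G σ (q.1, (q.2, p))) ∂(volume.prod volume) =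
        ∫ τ, Complex.exp (Complex.I / h * ((x (Fin.last n) * τ : ℝ) : ℂ)) *
          ∫ u, K u * (halfDensity h u * (∑ σ : Equiv.Perm (Fin (n + 1)),
            ((Equiv.Perm.sign σ : ℤ) : ℂ) • G σ) (u, (τ, p))) := by
      simp only [← integral_const_mul]
      rw [← integral_finsetSum _ fun σ _ => (hGi σ).const_mul _, integral_prod_symm _
        (integrable_finsetSum _ fun σ _ => (hGi σ).const_mul _)]
      refine integral_congr_ae (Filter.Eventually.of_forall fun τ => ?_)
      refine integral_congr_ae (Filter.Eventually.of_forall fun u => ?_)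
      simp only [_root_.sum_apply, _root_.smul_apply, smul_eq_mul, chartPhase_zero,
        Finset.mul_sum]
      refine Finset.sum_congr rfl fun σ _ => ?_
      ring
    rw [e1, integral_stepIntegrand_eq_limit hh hK hg hG hGb hKt h0 p, e2]
    simp only [hKdef, hρ (shiftSeq α) (shiftSeq_pos hα) (shiftSeq_strictMono hα), hρ']
    rw [integral_exp_snoc]

end Representation

/-! ### The Fourier transform and the conclusion. -/

/-- The Fourier integral of a Schwartz function on `ℝ^N`, with the physical normalisation. -/
theorem exists_schwartz_fourier {h : ℝ} (hh : 0 < h) {N : ℕ} (ρ : 𝓢(Fin N → ℝ, ℂ)) :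
    ∃ G : 𝓢(Fin N → ℝ, ℂ), ∀ x, G x =
      ∫ ξ, Complex.exp (Complex.I / h * ((∑ j, x j * ξ j : ℝ) : ℂ)) * ρ ξ := by
  set e : EuclideanSpace ℝ (Fin N) ≃L[ℝ] (Fin N → ℝ) :=
    PiLp.continuousLinearEquiv 2 ℝ fun _ : Fin N => ℝ
  set ρ' : 𝓢(EuclideanSpace ℝ (Fin N), ℂ) := SchwartzMap.compCLMOfContinuousLinearEquiv ℝ e ρ
  have hc : 1 / (2 * Real.pi * h) ≠ 0 := by positivity
  -- This dilation converts the phase `2π⟨v, ·⟩` of the inverse Fourier transform into `x·ξ/ħ`; no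
  -- Jacobian appears because only the argument `x` is rescaled.
  set d : (Fin N → ℝ) ≃L[ℝ] (Fin N → ℝ) := ContinuousLinearEquiv.smulLeft (Units.mk0 _ hc) with hd
  refine ⟨SchwartzMap.compCLMOfContinuousLinearEquiv ℝ (d.trans e.symm) (𝓕⁻ ρ'), fun x => ?_⟩
  have h1 : SchwartzMap.compCLMOfContinuousLinearEquiv ℝ (d.trans e.symm) (𝓕⁻ ρ') x =
      (𝓕⁻ ρ') (e.symm (d x)) := rfl
  have h2 : ∀ v : EuclideanSpace ℝ (Fin N), inner ℝ v (e.symm (d x)) =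
      1 / (2 * Real.pi * h) * ∑ j, x j * e v j := fun v => by
    rw [PiLp.inner_apply, Finset.mul_sum]
    refine Finset.sum_congr rfl fun j _ => ?_
    change inner ℝ (e v j) (1 / (2 * Real.pi * h) * x j) = _
    simp
    ring
  rw [h1, SchwartzMap.fourierInv_coe, Real.fourierInv_eq']
  have h3 := (PiLp.volume_preserving_toLp (Fin N)).integral_comp
    (MeasurableEquiv.toLp 2 (Fin N → ℝ)).measurableEmbedding (fun v : EuclideanSpace ℝ (Fin N) =>
      Complex.exp ((↑(2 * Real.pi * inner ℝ v (e.symm (d x))) * Complex.I)) • ρ' v)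
  rw [← h3]
  refine integral_congr_ae (Filter.Eventually.of_forall fun ξ => ?_)
  have h4 : e (WithLp.toLp 2 ξ) = ξ := rfl
  have h5 : ρ' (WithLp.toLp 2 ξ) = ρ ξ := rfl
  simp only [h2, h4, h5, smul_eq_mul]
  congr 2
  have : (h : ℂ) ≠ 0 := by exact_mod_cast hh.ne'
  have : (Real.pi : ℂ) ≠ 0 := by exact_mod_cast Real.pi_ne_zero
  push_cast
  field_simp

theorem contDiff_halfDensity' (h : ℝ) (N : ℕ) :
    ContDiff ℝ (⊤ : ℕ∞) fun u : Fin N → ℝ => halfDensity' h u := by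
  unfold halfDensity'
  refine contDiff_prod fun a _ => contDiff_prod fun b _ => ?_
  have h1 : ContDiff ℝ (⊤ : ℕ∞) fun s : ℂ => (Complex.Gamma s)⁻¹ :=
    (Complex.differentiable_one_div_Gamma.contDiff (n := (⊤ : ℕ∞))).restrict_scalars ℝ
  have h2 : ContDiff ℝ (⊤ : ℕ∞) fun u : Fin N → ℝ => ((u b : ℂ) - u a) / (Complex.I * h) := by
    refine ContDiff.div_const (ContDiff.sub ?_ ?_) _
    · exact Complex.ofRealCLM.contDiff.comp (contDiff_apply ℝ ℝ b)
    · exact Complex.ofRealCLM.contDiff.comp (contDiff_apply ℝ ℝ a)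
  exact h1.comp h2

/-- One half density stays beside the kernel for the Fourier representation; the other, being
smooth, multiplies `F` without spoiling compact support. -/
theorem sovIntegrand_eq (h : ℝ) (α : ℕ → ℝ) {N : ℕ} (F : (Fin N → ℝ) → ℂ) (x y : Fin N → ℝ) :
    sovIntegrand h α F x y = 1 / (2 * (Real.pi : ℂ) * (h : ℂ)) ^ N *
      (realKernel h N α y x * (halfDensity h y * (F y * halfDensity' h y))) := by
  have h1 : (fun a => (y a : ℂ)) = contourPoint 0 y := by funext a; simp [contourPoint]
  rw [sovIntegrand, sklyaninDensity, prod_erase_inv_Gamma', h1, realKernel]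
  ring

theorem integrable_mul_of_isTestWeight {h : ℝ} {N : ℕ} {K w : (Fin N → ℝ) → ℂ}
    (hK : IsWhittakerBounded h K) (hw : IsTestWeight h w) : Integrable fun v => K v * w v := by
  obtain ⟨C, hC, M, H⟩ := hK.2
  obtain ⟨C', hC', H'⟩ := hw.2 (N + 1 + M)
  refine integrable_of_decay (k := N + 1) (by simp) volume
    (hK.1.mul hw.1).aestronglyMeasurable (B := C * C') fun v => ?_
  set E := Real.exp (Real.pi / (2 * h) * (spread v / 2))
  have hE : 0 < E := Real.exp_pos _
  rw [norm_mul]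
  refine le_of_mul_le_mul_left ?_ (by positivity : 0 < E * (1 + ‖v‖) ^ M)
  calc _ = (‖K v‖ * E) * ((1 + ‖v‖) ^ (N + 1 + M) * ‖w v‖) := by rw [pow_add]; ring
    _ ≤ (C * (1 + ‖v‖) ^ M) * (C' * E) := mul_le_mul (H v) (H' v) (by positivity) (by positivity)
    _ = _ := by ring

/-- A Schwartz function as a function of additional, trivial, variables. -/
theorem exists_schwartz_trivial_snd {N : ℕ} (f : 𝓢(Fin N → ℝ, ℂ)) :
    ∃ g : 𝓢((Fin N → ℝ) × (Fin 0 → ℝ), ℂ), ∀ v p, g (v, p) = f v := by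
  refine ⟨SchwartzMap.compCLMOfAntilipschitz ℝ
    (g := ContinuousLinearMap.fst ℝ (Fin N → ℝ) (Fin 0 → ℝ)) (K := 1)
    (ContinuousLinearMap.hasTemperateGrowth _)
    (AddMonoidHomClass.antilipschitz_of_bound _ fun y => ?_) f, fun v p => rfl⟩
  have h1 : ‖y.2‖ = 0 := by rw [Subsingleton.elim y.2 0, norm_zero]
  rw [NNReal.coe_one, one_mul, Prod.norm_def, h1]
  exact max_le le_rfl (norm_nonneg _)

theorem exists_schwartz_slice_trivial {N : ℕ} (g : 𝓢((Fin N → ℝ) × (Fin 0 → ℝ), ℂ)) :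
    ∃ f : 𝓢(Fin N → ℝ, ℂ), ∀ v, f v = g (v, 0) :=
  ⟨SchwartzMap.compCLMOfAntilipschitz ℝ
    (g := ContinuousLinearMap.inl ℝ (Fin N → ℝ) (Fin 0 → ℝ)) (K := 1)
    (ContinuousLinearMap.hasTemperateGrowth _)
    (AddMonoidHomClass.antilipschitz_of_bound _ fun y => by simp) g, fun v => rfl⟩
theorem mainTheorem8 (N : ℕ) (hbar : ℝ) (hbar_pos : 0 < hbar) (F : (Fin N → ℝ) → ℂ)
    (hF_smooth : ContDiff ℝ ((⊤ : ℕ∞) : WithTop ℕ∞) F) (hF_supp : HasCompactSupport F) :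
    ∃ G : SchwartzMap (Fin N → ℝ) ℂ,
      ∀ α : ℕ → ℝ, 0 < α 0 → StrictMono α →
        (∀ x y : Fin N → ℝ, KernelConverges hbar N α (fun a => (y a : ℂ)) x) ∧
        (∀ x : Fin N → ℝ, MeasureTheory.Integrable (sovIntegrand hbar α F x)) ∧
        (∀ x : Fin N → ℝ, sovTransform hbar α F x = G x) ∧
        MeasureTheory.MemLp (sovTransform hbar α F) 2 MeasureTheory.volume := by
  have hs : HasCompactSupport fun v => F v * halfDensity' hbar v := hF_supp.mul_right
  obtain ⟨f, hf⟩ := exists_schwartz_trivial_snd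
    (hs.toSchwartzMap (hF_smooth.mul (contDiff_halfDensity' hbar N)))
  have hf' : ∀ v p, f (v, p) = F v * halfDensity' hbar v := hf
  obtain ⟨ρ, hρ⟩ := exists_fourier_representation hbar_pos N _ f
  obtain ⟨ρ₀, hρ₀⟩ := exists_schwartz_slice_trivial ρ
  obtain ⟨G, hG⟩ := exists_schwartz_fourier hbar_pos ρ₀
  -- The Schwartz function is fixed before `α`, which is the independence of the contours.
  refine ⟨(1 / ((Real.sqrt (N.factorial : ℝ) : ℝ) : ℂ) *
    (1 / (2 * (Real.pi : ℂ) * (hbar : ℂ)) ^ N)) • G, fun α h0 hα => ?_⟩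
  have key : ∀ x, sovTransform hbar α F x = ((1 / ((Real.sqrt (N.factorial : ℝ) : ℝ) : ℂ) *
      (1 / (2 * (Real.pi : ℂ) * (hbar : ℂ)) ^ N)) • G) x := fun x => by
    have h1 := hρ α h0 hα x 0
    simp only [hf', ← hρ₀, ← hG] at h1
    rw [sovTransform]
    simp only [sovIntegrand_eq]
    rw [integral_const_mul, h1, ← mul_assoc]
    rfl
  refine ⟨fun x y => ?_, fun x => ?_, key, ?_⟩
  · have h1 : (fun a => (y a : ℂ)) = contourPoint 0 y := by funext a; simp [contourPoint]
    rw [h1]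
    exact kernelConverges_contourPoint hbar_pos N α 0 y x h0 hα
  · have h1 := integrable_mul_of_isTestWeight (isWhittakerBounded_realKernel hbar_pos N α x h0 hα)
      (isTestWeight_halfDensity_mul hbar_pos f 0)
    simp only [hf'] at h1
    exact (h1.const_mul _).congr (Filter.Eventually.of_forall fun y => (sovIntegrand_eq _ _ _ _ _).symm)
  · rw [funext key]
    exact SchwartzMap.memLp _ 2 volume
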